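/- Let $\mathbf k$ be a commutative $\mathbb Q$-algebra. *The group $\mathsf G^{\mathrm B}(\mathbf k)$.* Let $\mathcal V=\mathbf kF_2$ be the group algebra of the free group $F_2$ with generators $X_0,X_1$, let $I$ be its augmentation ideal, and let $\hat{\mathcal V}=\varprojlim_n\mathcal V/I^n$, with its decreasing filtration $F^n\hat{\mathcal V}=\ker(\hat{\mathcal V}\to\mathcal V/I^n)$. It is a topological Hopf algebra for the continuous extension of the coproduct of $\mathcal V$ given by $\gamma\mapsto\gamma\otimes\gamma$ for $\gamma\in F_2$. Let $\mathcal G(\hat{\mathcal V})$ be the group of its group-like elements (of counit $1$). For $a\in 1+F^1\hat{\mathcal V}$ and $\mu\in\mathbf k$ set $a^\mu:=\exp(\mu\log a)$. For $(\mu,g)\in\mathsf G^{\mathrm B}(\mathbf k):=\mathbf k^\times\times\mathcal G(\hat{\mathcal V})$, let $\mathrm{aut}^{(1)}_{(\mu,g)}$ be the continuous $\mathbf k$-algebra endomorphism of $\hat{\mathcal V}$ such that $X_0\mapsto g X_0^\mu g^{-1}$, $X_1\mapsto X_1^\mu$, let $\mathrm{aut}^{(10)}_{(\mu,g)}(a):=\mathrm{aut}^{(1)}_{(\mu,g)}(a)\cdot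 g$, and set $$(\mu,g)\circledast(\mu',g'):=(\mu\mu',\mathrm{aut}^{(10)}_{(\mu,g)}(g')).$$ *The subset $\mathsf G^{\mathrm B}_{\mathrm{quad}}(\mathbf k)$.* The algebra $\hat{\mathcal V}$ is topologically freely generated by $\log X_0,\log X_1$; for $g\in\hat{\mathcal V}$ and $w$ a word in $\log X_0,\log X_1$, let $(g|w)\in\mathbf k$ be the coefficient of $w$ in the expansion of $g$. Set $$\mathsf G^{\mathrm B}_{\mathrm{quad}}(\mathbf k):=\{(\mu,g)\in\mathsf G^{\mathrm B}(\mathbf k)\mid (g|\log X_0)=(g|\log X_1)=0,\ \mu^2=1+24(g|\log X_0\log X_1)\}.$$ *The module coproduct.* Let $\mathcal W=\mathbf k1\oplus\mathcal V(X_1-1)\subset\mathcal V$, and let $\Delta^{\mathcal W}:\mathcal W\to\mathcal W\otimes\mathcal W$ be the algebra morphism such that $X_1^{\pm1}\mapsto X_1^{\pm1}\otimes X_1^{\pm1}$ and, for $n\ge1$, $$Y_n^\pm\mapsto Y_n^\pm\otimes1+1\otimes Y_n^\pm+\sum_{n'+n''=n,\ n',n''\ge1}Y_{n'}^\pm\otimes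 Y_{n''}^\pm,\qquad Y_n^\pm:=(X_0^{\pm1}-1)^{n-1}X_0^{\pm1}(1-X_1^{\pm1}).$$ Let $\mathcal M=\mathcal V/\mathcal V(X_0-1)$ and let $1_{\mathrm B}$ be the class of $1$; the map $\mathcal W\to\mathcal M$, $w\mapsto w\cdot1_{\mathrm B}$ is bijective. Let $\Delta^{\mathcal M}:\mathcal M\to\mathcal M\otimes\mathcal M$ be the $\mathbf k$-linear map such that $w\cdot 1_{\mathrm B}\mapsto\Delta^{\mathcal W}(w)\cdot(1_{\mathrm B}\otimes1_{\mathrm B})$ for $w\in\mathcal W$. Let $\hat{\mathcal M}=\hat{\mathcal V}/\hat{\mathcal V}(X_0-1)$, let $F^n\hat{\mathcal M}$ be the image of $F^n\hat{\mathcal V}$, let $\mathcal M^{\otimes2\wedge}=\varprojlim_n\hat{\mathcal M}^{\otimes2}/\sum_{i+j=n}F^i\hat{\mathcal M}\otimes F^j\hat{\mathcal M}$ (tensor products over $\mathbf k$, with the images of the $F^i\hat{\mathcal M}\otimes F^j\hat{\mathcal M}$), and let $\hat\Delta^{\mathcal M}:\hat{\mathcal M}\to\mathcal M^{\otimes2\wedge}$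 be the continuous extension of $\Delta^{\mathcal M}$. *The stabilizer.* For $g\in\hat{\mathcal V}$ let $\Gamma_g(t):=\exp\bigl(\sum_{n\ge1}(-1)^{n+1}(g|(\log X_0)^{n-1}\log X_1)\,t^n/n\bigr)\in\mathbf k[[t]]^\times$. For $(\mu,g)\in\mathsf G^{\mathrm B}(\mathbf k)$, the map $\mathrm{aut}^{(10)}_{(\mu,g)}$ induces a $\mathbf k$-linear map $\mathrm{aut}^{\mathcal M,(10)}_{(\mu,g)}$ from $\hat{\mathcal M}$ to itself; let ${}^\Gamma\mathrm{aut}^{\mathcal M,(10)}_{(\mu,g)}$ be its composition with the subsequent left action of $\Gamma_g^{-1}(-\log X_1)\in\hat{\mathcal V}^\times$ on $\hat{\mathcal M}$. Set $$\mathsf{Stab}(\hat\Delta^{\mathcal M,\mathrm B})(\mathbf k):=\{(\mu,g)\in\mathsf G^{\mathrm B}(\mathbf k)\mid({}^\Gamma\mathrm{aut}^{\mathcal M,(10)}_{(\mu,g)})^{\otimes2}\circ\hat\Delta^{\mathcal M}=\hat\Delta^{\mathcal M}\circ{}^\Gamma\mathrm{aut}^{\mathcal M,(10)}_{(\mu,g)}\}.$$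 **Statement.** The product $\circledast$ makes $\mathsf G^{\mathrm B}(\mathbf k)$ a group, and $$\mathsf{DMR}^{\mathrm B}(\mathbf k):=\mathsf G^{\mathrm B}_{\mathrm{quad}}(\mathbf k)\cap\mathsf{Stab}(\hat\Delta^{\mathcal M,\mathrm B})(\mathbf k)$$ is a subgroup of $(\mathsf G^{\mathrm B}(\mathbf k),\circledast)$. -/

import Mathlib

open scoped TensorProduct PowerSeries

noncomputable section

namespace BettiDMR

/-! ### Completion of an algebra with respect to the powers of a two-sided ideal -/

section Completion

variable (k : Type*) [CommRing k] {A : Type*} [Ring A] [Algebra k A]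

/-- The completion `lim A / I ^ n` of the `k`-algebra `A`, as a subalgebra of a product. -/
def subCpl (I : Ideal A) [I.IsTwoSided] : Subalgebra k (∀ n : ℕ, A ⧸ I ^ n) where
  carrier := {x | ∀ (m n : ℕ) (h : m ≤ n),
    Ideal.Quotient.factorₐ k (Ideal.pow_le_pow_right (I := I) h) (x n) = x m}
  mul_mem' hx hy m n h := by simp only [Pi.mul_apply, map_mul, hx m n h, hy m n h]
  add_mem' hx hy m n h := by simp only [Pi.add_apply, map_add, hx m n h, hy m n h]
  algebraMap_mem' r m n h := by
    simp only [Pi.algebraMap_apply]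
    exact AlgHom.commutes _ r

/-- The completion `lim A / I ^ n` of the `k`-algebra `A`. -/
def Cpl (I : Ideal A) [I.IsTwoSided] : Type _ := subCpl k I

instance (I : Ideal A) [I.IsTwoSided] : Ring (Cpl k I) := inferInstanceAs (Ring (subCpl k I))

instance (I : Ideal A) [I.IsTwoSided] : Algebra k (Cpl k I) :=
  inferInstanceAs (Algebra k (subCpl k I))

namespace Cpl

variable (I : Ideal A) [I.IsTwoSided]

/-- The projection to the `n`-th level. -/
def proj (n : ℕ) : Cpl k I →ₐ[k] A ⧸ I ^ n :=
  (Pi.evalAlgHom k (fun n : ℕ => A ⧸ I ^ n) n).comp (subCpl k I).val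

/-- The canonical map from `A` to its completion. -/
def of : A →ₐ[k] Cpl k I :=
  (AlgHom.pi (R := k) (fun n : ℕ => Ideal.Quotient.mkₐ k (I ^ n))).codRestrict (subCpl k I)
    (fun _ _ _ _ => rfl)

/-- The decreasing filtration of the completion. -/
def fil (n : ℕ) : Ideal (Cpl k I) := RingHom.ker (proj k I n)

instance (n : ℕ) : (fil k I n).IsTwoSided := by unfold fil; infer_instance

variable {k I}

theorem ext {x y : Cpl k I} (h : ∀ n, proj k I n x = proj k I n y) : x = y :=
  Subtype.ext (funext h)

theorem mem_fil {n : ℕ} {x : Cpl k I} : x ∈ fil k I n ↔ proj k I n x = 0 := Iff.rfl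

theorem proj_of (n : ℕ) (a : A) : proj k I n (of k I a) = Ideal.Quotient.mk (I ^ n) a := rfl

theorem factor_proj {m n : ℕ} (h : m ≤ n) (x : Cpl k I) :
    Ideal.Quotient.factorₐ k (Ideal.pow_le_pow_right (I := I) h) (proj k I n x) = proj k I m x :=
  x.2 m n h

theorem of_mem_fil {n : ℕ} {a : A} (h : a ∈ I ^ n) : of k I a ∈ fil k I n :=
  mem_fil.2 (by rw [proj_of]; exact Ideal.Quotient.eq_zero_iff_mem.2 h)

theorem fil_anti : Antitone (fil k I) := fun m n h x hx => by
  rw [mem_fil] at *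
  rw [← factor_proj h, hx, map_zero]

theorem exists_rep {m n : ℕ} (h : m ≤ n) {x : Cpl k I} (hx : x ∈ fil k I m) :
    ∃ a ∈ I ^ m, proj k I n x = Ideal.Quotient.mk (I ^ n) a := by
  obtain ⟨a, ha⟩ := Ideal.Quotient.mk_surjective (proj k I n x)
  refine ⟨a, ?_, ha.symm⟩
  have h2 := factor_proj h x
  rw [mem_fil.1 hx, ← ha] at h2
  exact Ideal.Quotient.eq_zero_iff_mem.1 h2

theorem mul_mem_fil {m n : ℕ} {x y : Cpl k I} (hx : x ∈ fil k I m) (hy : y ∈ fil k I n) :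
    x * y ∈ fil k I (m + n) := by
  obtain ⟨a, ha, hxa⟩ := exists_rep (Nat.le_add_right m n) hx
  obtain ⟨b, hb, hyb⟩ := exists_rep (Nat.le_add_left n m) hy
  rw [mem_fil, map_mul, hxa, hyb, ← map_mul]
  refine Ideal.Quotient.eq_zero_iff_mem.2 ?_
  rw [Ideal.IsTwoSided.pow_add]
  exact Ideal.mul_mem_mul ha hb

theorem mem_fil_zero (x : Cpl k I) : x ∈ fil k I 0 := by
  obtain ⟨a, ha⟩ := Ideal.Quotient.mk_surjective (proj k I 0 x)
  rw [mem_fil, ← ha]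
  exact Ideal.Quotient.eq_zero_iff_mem.2 (by rw [Submodule.pow_zero, Ideal.one_eq_top]; trivial)

theorem pow_mem_fil {x : Cpl k I} (hx : x ∈ fil k I 1) (n : ℕ) : x ^ n ∈ fil k I n := by
  induction n with
  | zero => exact mem_fil_zero _
  | succ n ih => rw [pow_succ]; exact mul_mem_fil ih hx

theorem map_pow_mem_fil {B : Type*} [Ring B] [Algebra k B] {J : Ideal B} [J.IsTwoSided]
    {φ : A →ₐ[k] Cpl k J} (hφ : ∀ a ∈ I, φ a ∈ fil k J 1) (n : ℕ) :
    ∀ a ∈ I ^ n, φ a ∈ fil k J n := by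
  induction n with
  | zero => exact fun a _ => mem_fil_zero _
  | succ n ih =>
    intro a ha
    rw [Ideal.IsTwoSided.pow_add, Submodule.pow_one] at ha
    refine Submodule.mul_induction_on ha (fun x hx y hy => ?_) (fun x y hx hy => ?_)
    · rw [map_mul]; exact mul_mem_fil (ih x hx) (hφ y hy)
    · rw [map_add]; exact add_mem hx hy

/-- The continuous extension to the completion of `A` of an algebra morphism `φ` from `A` to a
completed algebra which is compatible with the filtrations. -/
def extend {B : Type*} [Ring B] [Algebra k B] {J : Ideal B} [J.IsTwoSided]
    (φ : A →ₐ[k] Cpl k J) (hφ : ∀ a ∈ I, φ a ∈ fil k J 1) : Cpl k I →ₐ[k] Cpl k J :=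
  (AlgHom.pi (R := k) (fun n : ℕ => (Ideal.Quotient.liftₐ (I ^ n) ((proj k J n).comp φ)
    (fun a ha => map_pow_mem_fil hφ n a ha)).comp (proj k I n))).codRestrict (subCpl k J) (by
      intro x m n h
      obtain ⟨a, ha⟩ := Ideal.Quotient.mk_surjective (proj k I n x)
      have h2 := factor_proj h x
      rw [← ha] at h2
      change Ideal.Quotient.factorₐ k _ (Ideal.Quotient.liftₐ (I ^ n) ((proj k J n).comp φ)
        (fun a ha => map_pow_mem_fil hφ n a ha) (proj k I n x)) =
          Ideal.Quotient.liftₐ (I ^ m) ((proj k J m).comp φ)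
            (fun a ha => map_pow_mem_fil hφ m a ha) (proj k I m x)
      rw [← ha, ← h2]
      exact factor_proj h (φ a))

theorem proj_extend {B : Type*} [Ring B] [Algebra k B] {J : Ideal B} [J.IsTwoSided]
    (φ : A →ₐ[k] Cpl k J) (hφ : ∀ a ∈ I, φ a ∈ fil k J 1) (n : ℕ) (x : Cpl k I) (a : A)
    (ha : proj k I n x = Ideal.Quotient.mk (I ^ n) a) :
    proj k J n (extend φ hφ x) = proj k J n (φ a) := by
  change Ideal.Quotient.liftₐ (I ^ n) ((proj k J n).comp φ)
    (fun a ha => map_pow_mem_fil hφ n a ha) (proj k I n x) = _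
  rw [ha]
  rfl

theorem extend_of {B : Type*} [Ring B] [Algebra k B] {J : Ideal B} [J.IsTwoSided]
    (φ : A →ₐ[k] Cpl k J) (hφ : ∀ a ∈ I, φ a ∈ fil k J 1) (a : A) :
    extend φ hφ (of k I a) = φ a :=
  ext fun n => proj_extend φ hφ n _ a rfl

theorem extend_mem_fil {B : Type*} [Ring B] [Algebra k B] {J : Ideal B} [J.IsTwoSided]
    (φ : A →ₐ[k] Cpl k J) (hφ : ∀ a ∈ I, φ a ∈ fil k J 1) {n : ℕ} {x : Cpl k I}
    (hx : x ∈ fil k I n) : extend φ hφ x ∈ fil k J n := by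
  rw [mem_fil, proj_extend φ hφ n x 0 (by rw [mem_fil.1 hx, map_zero]), map_zero, map_zero]

end Cpl

end Completion

/-! ### Evaluation of formal power series -/

section Evaluation

variable {k : Type*} [CommRing k]

theorem aeval_eq_sum_of_trunc_eq {A : Type*} [Ring A] [Algebra k A] {a : A} {n : ℕ}
    (ha : a ^ n = 0) (f : k⟦X⟧) (p : Polynomial k)
    (hp : PowerSeries.trunc n (p : k⟦X⟧) = PowerSeries.trunc n f) :
    Polynomial.aeval a p = ∑ i ∈ Finset.range n, PowerSeries.coeff i f • a ^ i := by
  rw [Polynomial.aeval_eq_sum_range' (n := max n (p.natDegree + 1))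
    (lt_of_lt_of_le (Nat.lt_succ_self _) (le_max_right _ _))]
  rw [← Finset.sum_subset (Finset.range_mono (le_max_left n (p.natDegree + 1)))]
  · refine Finset.sum_congr rfl fun i hi => ?_
    have h := congrArg (fun q => Polynomial.coeff q i) hp
    simp only [PowerSeries.coeff_trunc, Finset.mem_range.1 hi, if_true,
      Polynomial.coeff_coe] at h
    rw [h]
  · intro i _ hi
    rw [Finset.mem_range, not_lt] at hi
    rw [pow_eq_zero_of_le hi ha, smul_zero]

/-- The evaluation `∑ fᵢ aⁱ` of a power series at an element `a` with `a ^ n = 0`. -/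
def nilEval {A : Type*} [Ring A] [Algebra k A] (a : A) (n : ℕ) (ha : a ^ n = 0) :
    k⟦X⟧ →ₐ[k] A :=
  { toFun := fun f => ∑ i ∈ Finset.range n, PowerSeries.coeff i f • a ^ i
    map_one' := by
      rw [← aeval_eq_sum_of_trunc_eq ha 1 1 (by simp), map_one]
    map_zero' := by simp
    map_add' := fun f g => by simp [add_smul, Finset.sum_add_distrib]
    map_mul' := fun f g => by
      rw [← aeval_eq_sum_of_trunc_eq ha (f * g) (PowerSeries.trunc n f * PowerSeries.trunc n g)
        (by rw [Polynomial.coe_mul, PowerSeries.trunc_trunc_mul_trunc]), map_mul,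
        aeval_eq_sum_of_trunc_eq ha f _ (PowerSeries.trunc_trunc f),
        aeval_eq_sum_of_trunc_eq ha g _ (PowerSeries.trunc_trunc g)]
    commutes' := fun r => by
      rw [← aeval_eq_sum_of_trunc_eq ha (algebraMap k k⟦X⟧ r) (Polynomial.C r) (by simp),
        Polynomial.aeval_C] }

theorem nilEval_apply {A : Type*} [Ring A] [Algebra k A] (a : A) (n : ℕ) (ha : a ^ n = 0)
    (f : k⟦X⟧) : nilEval a n ha f = ∑ i ∈ Finset.range n, PowerSeries.coeff i f • a ^ i := rfl

variable {A : Type*} [Ring A] [Algebra k A] {I : Ideal A} [I.IsTwoSided]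

theorem proj_pow_eq_zero {x : Cpl k I} (hx : x ∈ Cpl.fil k I 1) (n : ℕ) :
    (Cpl.proj k I n x) ^ n = 0 := by
  rw [← map_pow]; exact Cpl.pow_mem_fil hx n

/-- The evaluation `f ↦ ∑ fᵢ xⁱ` of power series at an element `x` of the first step of the
filtration of a completed algebra. -/
def psEval (x : Cpl k I) (hx : x ∈ Cpl.fil k I 1) : k⟦X⟧ →ₐ[k] Cpl k I :=
  (AlgHom.pi (R := k) (fun n : ℕ => nilEval (Cpl.proj k I n x) n
    (proj_pow_eq_zero hx n))).codRestrict (subCpl k I) (by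
      intro f m n h
      change Ideal.Quotient.factorₐ k _ (nilEval (Cpl.proj k I n x) n (proj_pow_eq_zero hx n) f) =
        nilEval (Cpl.proj k I m x) m (proj_pow_eq_zero hx m) f
      rw [nilEval_apply, nilEval_apply, map_sum, ← Finset.sum_subset (Finset.range_mono h)]
      · refine Finset.sum_congr rfl fun i _ => ?_
        rw [map_smul, map_pow, Cpl.factor_proj h]
      · intro i _ hi
        rw [Finset.mem_range, not_lt] at hi
        rw [map_smul, map_pow, Cpl.factor_proj h,
          pow_eq_zero_of_le hi (proj_pow_eq_zero hx m), smul_zero])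

theorem proj_psEval (x : Cpl k I) (hx : x ∈ Cpl.fil k I 1) (f : k⟦X⟧) (n : ℕ) :
    Cpl.proj k I n (psEval x hx f) =
      ∑ i ∈ Finset.range n, PowerSeries.coeff i f • (Cpl.proj k I n x) ^ i := rfl

theorem psEval_X (x : Cpl k I) (hx : x ∈ Cpl.fil k I 1) : psEval x hx PowerSeries.X = x := by
  refine Cpl.ext fun n => ?_
  rw [proj_psEval]
  simp only [PowerSeries.coeff_X, ite_smul, one_smul, zero_smul, Finset.sum_ite_eq',
    Finset.mem_range, pow_one]
  split_ifs with h
  · rfl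
  · exact ((Cpl.fil_anti (not_lt.1 h)) hx).symm

theorem psEval_mem_fil (x : Cpl k I) (hx : x ∈ Cpl.fil k I 1) (f : k⟦X⟧)
    (hf : PowerSeries.constantCoeff f = 0) : psEval x hx f ∈ Cpl.fil k I 1 := by
  obtain ⟨g, rfl⟩ := PowerSeries.X_dvd_iff.2 hf
  rw [map_mul, psEval_X]
  exact Ideal.mul_mem_right _ _ hx

variable [Algebra ℚ k]

/-- The exponential series, as an invertible power series. -/
def expUnit (k : Type*) [CommRing k] [Algebra ℚ k] : k⟦X⟧ˣ where
  val := PowerSeries.exp k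
  inv := PowerSeries.evalNegHom (PowerSeries.exp k)
  val_inv := PowerSeries.exp_mul_exp_neg_eq_one
  inv_val := by rw [mul_comm]; exact PowerSeries.exp_mul_exp_neg_eq_one

/-- `exp x`, for `x` in the first step of the filtration. -/
def expC (x : Cpl k I) (hx : x ∈ Cpl.fil k I 1) : (Cpl k I)ˣ :=
  Units.map (psEval x hx : k⟦X⟧ →* Cpl k I) (expUnit k)

/-- `log a = ∑ (-1) ^ (n + 1) (a - 1) ^ n / n`, for `a` congruent to `1`. -/
def logC (a : Cpl k I) (ha : a - 1 ∈ Cpl.fil k I 1) : Cpl k I :=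
  psEval (a - 1) ha (PowerSeries.log k)

theorem logC_mem (a : Cpl k I) (ha : a - 1 ∈ Cpl.fil k I 1) : logC a ha ∈ Cpl.fil k I 1 :=
  psEval_mem_fil _ _ _ (by simp)

/-- `a ^ μ = exp (μ log a)`, for `μ : k` and `a` congruent to `1`. -/
def powC (a : Cpl k I) (ha : a - 1 ∈ Cpl.fil k I 1) (μ : k) : (Cpl k I)ˣ :=
  expC (μ • logC a ha) ((Cpl.fil k I 1).smul_of_tower_mem μ (logC_mem a ha))

theorem powC_sub_one (a : Cpl k I) (ha : a - 1 ∈ Cpl.fil k I 1) (μ : k) :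
    ∃ u : Cpl k I, (powC a ha μ : Cpl k I) - 1 = u * (a - 1) := by
  obtain ⟨e, he⟩ := PowerSeries.X_dvd_iff.2
    (show PowerSeries.constantCoeff (PowerSeries.exp k - 1) = 0 by simp)
  obtain ⟨l, hl⟩ := PowerSeries.X_dvd_iff.2 (PowerSeries.constantCoeff_log (A := k))
  have h1 : (powC a ha μ : Cpl k I) - 1 = psEval (μ • logC a ha)
      ((Cpl.fil k I 1).smul_of_tower_mem μ (logC_mem a ha)) (PowerSeries.exp k - 1) := by
    rw [map_sub, map_one]; rfl
  refine ⟨psEval (μ • logC a ha) ((Cpl.fil k I 1).smul_of_tower_mem μ (logC_mem a ha)) e *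
    (μ • psEval (a - 1) ha l), ?_⟩
  rw [h1, he, mul_comm PowerSeries.X e, map_mul, psEval_X, mul_assoc]
  congr 1
  rw [smul_mul_assoc]
  congr 1
  rw [logC, hl, mul_comm PowerSeries.X l, map_mul, psEval_X]

end Evaluation

/-! ### Completed tensor squares of filtered modules -/

section TensorSquare

variable {k : Type*} [CommRing k]

/-- The filtration `∑_{i + j ≥ n} Fⁱ ⊗ Fʲ` of `M ⊗ M` attached to a filtration `F` of `M`; for
decreasing `F` it is equal to `∑_{i + j = n} Fⁱ ⊗ Fʲ`. -/
def tensorFil {M : Type*} [AddCommGroup M] [Module k M] (F : ℕ → Submodule k M) (n : ℕ) :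
    Submodule k (M ⊗[k] M) :=
  ⨆ (p : ℕ × ℕ) (_ : n ≤ p.1 + p.2),
    LinearMap.range (TensorProduct.map (F p.1).subtype (F p.2).subtype)

section

variable {M N : Type*} [AddCommGroup M] [Module k M] [AddCommGroup N] [Module k N]
  {F : ℕ → Submodule k M} {G : ℕ → Submodule k N}

theorem tmul_mem_tensorFil {n i j : ℕ} (h : n ≤ i + j) {x y : M} (hx : x ∈ F i) (hy : y ∈ F j) :
    x ⊗ₜ[k] y ∈ tensorFil F n :=
  Submodule.mem_iSup_of_mem (i, j) (Submodule.mem_iSup_of_mem h ⟨(⟨x, hx⟩ ⊗ₜ ⟨y, hy⟩), rfl⟩)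

theorem tensorFil_le {n : ℕ} {P : Submodule k (M ⊗[k] M)}
    (h : ∀ i j, n ≤ i + j → ∀ x ∈ F i, ∀ y ∈ F j, x ⊗ₜ[k] y ∈ P) : tensorFil F n ≤ P := by
  refine iSup₂_le fun p hp => ?_
  rintro _ ⟨z, rfl⟩
  induction z with
  | zero => rw [map_zero]; exact zero_mem _
  | add a b ha hb => rw [map_add]; exact add_mem ha hb
  | tmul x y => exact h _ _ hp _ x.2 _ y.2

theorem tensorFil_anti (F : ℕ → Submodule k M) : Antitone (tensorFil F) := fun _ _ h =>
  tensorFil_le fun _ _ hij _ hx _ hy => tmul_mem_tensorFil (h.trans hij) hx hy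

theorem map_mem_tensorFil {f : M →ₗ[k] N} (hf : ∀ n, ∀ x ∈ F n, f x ∈ G n) {n : ℕ}
    {z : M ⊗[k] M} (hz : z ∈ tensorFil F n) : TensorProduct.map f f z ∈ tensorFil G n := by
  suffices h : tensorFil F n ≤ (tensorFil G n).comap (TensorProduct.map f f) from h hz
  exact tensorFil_le fun i j hij x hx y hy =>
    tmul_mem_tensorFil hij (hf _ _ hx) (hf _ _ hy)

/-- The completed tensor square `lim (M ⊗ M) / ∑_{i + j = n} Fⁱ ⊗ Fʲ` of a filtered module, as a
submodule of a product. -/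
def subTSq (F : ℕ → Submodule k M) : Submodule k (∀ n : ℕ, (M ⊗[k] M) ⧸ tensorFil F n) where
  carrier := {z | ∀ (m n : ℕ) (h : m ≤ n), Submodule.factor (tensorFil_anti F h) (z n) = z m}
  add_mem' hx hy m n h := by simp only [Pi.add_apply, map_add, hx m n h, hy m n h]
  zero_mem' m n h := by simp only [Pi.zero_apply, map_zero]
  smul_mem' r x hx m n h := by simp only [Pi.smul_apply, map_smul, hx m n h]

/-- The completed tensor square `lim (M ⊗ M) / ∑_{i + j = n} Fⁱ ⊗ Fʲ` of a filtered module. -/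
def TSq (F : ℕ → Submodule k M) : Type _ := subTSq F

instance (F : ℕ → Submodule k M) : AddCommGroup (TSq F) := inferInstanceAs (AddCommGroup (subTSq F))

instance (F : ℕ → Submodule k M) : Module k (TSq F) := inferInstanceAs (Module k (subTSq F))

namespace TSq

variable (F) in
/-- The canonical map from the tensor square to its completion. -/
def of : M ⊗[k] M →ₗ[k] TSq F :=
  (LinearMap.pi fun n => (tensorFil F n).mkQ).codRestrict (subTSq F) (fun _ _ _ _ => rfl)

/-- The completed tensor square of a linear map which is compatible with the filtrations. -/
def map (f : M →ₗ[k] N) (hf : ∀ n, ∀ x ∈ F n, f x ∈ G n) : TSq F →ₗ[k] TSq G :=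
  LinearMap.restrict (p := subTSq F) (q := subTSq G) (LinearMap.pi fun n => (Submodule.mapQ (tensorFil F n) (tensorFil G n)
    (TensorProduct.map f f) (fun _ hz => map_mem_tensorFil hf hz)).comp (LinearMap.proj n)) (by
      intro z hz m n h
      have h2 := hz m n h
      obtain ⟨a, ha⟩ := Submodule.mkQ_surjective _ (z n)
      simp only [LinearMap.pi_apply, LinearMap.comp_apply, LinearMap.proj_apply]
      rw [← h2, ← ha]
      rfl)

variable {A : Type*} [Ring A] [Algebra k A] {I : Ideal A} [I.IsTwoSided]

/-- The continuous extension to the completion of `A` of a filtered linear map from `A` to a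
tensor square. -/
def extend (f : A →ₗ[k] M ⊗[k] M) (hf : ∀ n, ∀ a ∈ I ^ n, f a ∈ tensorFil F n) :
    Cpl k I →ₗ[k] TSq F :=
  (LinearMap.pi fun n => ((Submodule.mapQ ((I ^ n).restrictScalars k) (tensorFil F n) f (hf n)).comp
    (Submodule.Quotient.restrictScalarsEquiv k (I ^ n)).symm.toLinearMap).comp
      (Cpl.proj k I n).toLinearMap).codRestrict (subTSq F) (by
        intro x m n h
        have h2 := Cpl.factor_proj h x
        obtain ⟨a, ha⟩ := Ideal.Quotient.mk_surjective (Cpl.proj k I n x)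
        simp only [LinearMap.pi_apply, LinearMap.comp_apply, AlgHom.toLinearMap_apply]
        rw [← h2, ← ha]
        rfl)

theorem extend_apply (f : A →ₗ[k] M ⊗[k] M) (hf : ∀ n, ∀ a ∈ I ^ n, f a ∈ tensorFil F n)
    (n : ℕ) (x : Cpl k I) (a : A) (ha : Cpl.proj k I n x = Ideal.Quotient.mk (I ^ n) a) :
    (extend f hf x).1 n = (tensorFil F n).mkQ (f a) := by
  change (Submodule.mapQ ((I ^ n).restrictScalars k) (tensorFil F n) f (hf n))
    ((Submodule.Quotient.restrictScalarsEquiv k (I ^ n)).symm (Cpl.proj k I n x)) = _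
  rw [ha]
  rfl

end TSq

end

section Multiplicative

variable {B : Type*} [Ring B] [Algebra k B] {F : ℕ → Submodule k B}

theorem mul_mem_tensorFil (hF : ∀ i j, ∀ x ∈ F i, ∀ y ∈ F j, x * y ∈ F (i + j)) {m n : ℕ}
    {z w : B ⊗[k] B} (hz : z ∈ tensorFil F m) (hw : w ∈ tensorFil F n) :
    z * w ∈ tensorFil F (m + n) := by
  suffices h : tensorFil F m ≤ (tensorFil F (m + n)).comap (LinearMap.mulRight k w) from h hz
  refine tensorFil_le fun i j hij x hx y hy => ?_
  suffices h : tensorFil F n ≤ (tensorFil F (m + n)).comap (LinearMap.mulLeft k (x ⊗ₜ[k] y)) from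
    h hw
  refine tensorFil_le fun i' j' hij' x' hx' y' hy' => ?_
  simp only [Submodule.mem_comap, LinearMap.mulLeft_apply, Algebra.TensorProduct.tmul_mul_tmul]
  exact tmul_mem_tensorFil (i := i + i') (j := j + j') (by omega) (hF _ _ _ hx _ hx')
    (hF _ _ _ hy _ hy')

theorem mem_tensorFil_zero (hF : ∀ x, x ∈ F 0) (z : B ⊗[k] B) : z ∈ tensorFil F 0 := by
  induction z with
  | zero => exact zero_mem _
  | add a b ha hb => exact add_mem ha hb
  | tmul x y => exact tmul_mem_tensorFil (i := 0) (j := 0) le_rfl (hF x) (hF y)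

end Multiplicative

end TensorSquare

/-! ### The group algebra of the free group, and the algebra `W` -/

section Discrete

variable (k : Type*) [CommRing k]

/-- The group algebra of the free group on two generators. -/
abbrev V : Type _ := MonoidAlgebra k (FreeGroup (Fin 2))

/-- The powers `X i ^ a` of the generators, as elements of the group algebra. -/
def Xp (i : Fin 2) (a : ℤ) : V k := MonoidAlgebra.of k _ (FreeGroup.of i ^ a)

/-- The generators of the free group. -/
def X (i : Fin 2) : V k := Xp k i 1

/-- The augmentation ideal. -/
def augI : Ideal (V k) := RingHom.ker (Bialgebra.counitAlgHom k (V k))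

instance : (augI k).IsTwoSided := by unfold augI; infer_instance

variable {k}

theorem Xp_add (i : Fin 2) (a b : ℤ) : Xp k i (a + b) = Xp k i a * Xp k i b := by
  rw [Xp, zpow_add, map_mul]; rfl

@[simp] theorem Xp_zero (i : Fin 2) : Xp k i 0 = 1 := by
  rw [Xp, zpow_zero, map_one]

theorem counit_of (g : FreeGroup (Fin 2)) :
    Bialgebra.counitAlgHom k (V k) (MonoidAlgebra.of k _ g) = 1 := by
  simp [MonoidAlgebra.of_apply]

theorem mem_augI {v : V k} : v ∈ augI k ↔ Bialgebra.counitAlgHom k (V k) v = 0 := Iff.rfl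

theorem of_sub_one_mem (g : FreeGroup (Fin 2)) : MonoidAlgebra.of k _ g - 1 ∈ augI k := by
  rw [mem_augI, map_sub, counit_of, map_one, sub_self]

/-- A linear condition on `v - ε(v)` can be checked on group elements. -/
theorem sub_counit_induction {L : Type*} [AddCommGroup L] [Module k L] (f : V k →ₗ[k] L)
    (P : Submodule k L) (h : ∀ g, f (MonoidAlgebra.of k _ g - 1) ∈ P) {v : V k}
    (hv : v ∈ augI k) : f v ∈ P := by
  suffices H : ∀ w : V k, f (w - algebraMap k (V k) (Bialgebra.counitAlgHom k (V k) w)) ∈ P by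
    have := H v
    rwa [mem_augI.1 hv, map_zero, sub_zero] at this
  intro w
  induction w using MonoidAlgebra.induction_linear with
  | zero => simp
  | add x y hx hy =>
    rw [map_add, map_add, add_sub_add_comm, map_add]
    exact add_mem hx hy
  | single m r =>
    have h1 : MonoidAlgebra.single m r = r • MonoidAlgebra.of k (FreeGroup (Fin 2)) m := by
      simp [MonoidAlgebra.of_apply]
    rw [h1, map_smul, counit_of, smul_eq_mul, mul_one, Algebra.algebraMap_eq_smul_one,
      ← smul_sub, map_smul]
    exact P.smul_mem r (h m)

variable (k)

/-- The subalgebra `W = k 1 ⊕ V (X₁ - 1)` of `V`. -/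
def subW : Subalgebra k (V k) where
  carrier := {w | ∃ (c : k) (v : V k), w = algebraMap k (V k) c + v * (X k 1 - 1)}
  mul_mem' := by
    rintro _ _ ⟨c, v, rfl⟩ ⟨d, u, rfl⟩
    refine ⟨c * d, c • u + v * (X k 1 - 1) * u + d • v, ?_⟩
    generalize X k 1 - 1 = t
    simp only [Algebra.algebraMap_eq_smul_one, add_mul, mul_add, smul_mul_assoc, one_mul,
      mul_smul_comm, mul_one, mul_assoc]
    module
  add_mem' := by
    rintro _ _ ⟨c, v, rfl⟩ ⟨d, u, rfl⟩
    exact ⟨c + d, v + u, by rw [map_add, add_mul]; abel⟩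
  algebraMap_mem' c := ⟨c, 0, by simp⟩

variable {k}

theorem mul_X_sub_one_mem (v : V k) : v * (X k 1 - 1) ∈ subW k := ⟨0, v, by simp⟩

variable (k)

/-- The algebra `W = k 1 ⊕ V (X₁ - 1)`. -/
def W : Type _ := subW k

instance : Ring (W k) := inferInstanceAs (Ring (subW k))

instance : Algebra k (W k) := inferInstanceAs (Algebra k (subW k))

/-- The inclusion of `W` in `V`. -/
def inclW : W k →ₐ[k] V k := (subW k).val

variable {k}

/-- The element of `W` given by an element of `V`. -/
def mkW (v : V k) (h : v ∈ subW k) : W k := ⟨v, h⟩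

@[simp] theorem inclW_mkW (v : V k) (h : v ∈ subW k) : inclW k (mkW v h) = v := rfl

theorem inclW_mem (w : W k) : inclW k w ∈ subW k := w.2

theorem W_ext {w w' : W k} (h : inclW k w = inclW k w') : w = w' := Subtype.ext h

variable (k)

/-- The powers `X₁ ^ a`, as elements of `W`. -/
def WX (a : ℤ) : W k := mkW (Xp k 1 a) (by
  induction a using Int.induction_on with
  | zero => rw [Xp_zero]; exact one_mem _
  | succ n ih =>
    have : Xp k 1 (n + 1) = Xp k 1 n + Xp k 1 n * (X k 1 - 1) := by rw [Xp_add, X]; noncomm_ring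
    rw [this]
    exact add_mem ih (mul_X_sub_one_mem _)
  | pred n ih =>
    have : Xp k 1 (-n - 1) = Xp k 1 (-n) - Xp k 1 (-n - 1) * (X k 1 - 1) := by
      have h : Xp k 1 (-n - 1) * X k 1 = Xp k 1 (-n) := by
        rw [X, ← Xp_add]; congr 1; ring
      rw [mul_sub, h, mul_one]; abel
    rw [this]
    exact sub_mem ih (mul_X_sub_one_mem _))

/-- The elements `Yₙ⁺ = (X₀ - 1) ^ (n - 1) X₀ (1 - X₁)` of `W`, for `n > 0`. -/
def Yplus (n : ℕ) : W k :=
  mkW ((Xp k 0 1 - 1) ^ (n - 1) * Xp k 0 1 * (1 - Xp k 1 1)) (by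
    rw [show (1 : V k) - Xp k 1 1 = -(X k 1 - 1) by rw [neg_sub]; rfl, mul_neg]
    exact neg_mem (mul_X_sub_one_mem _))

/-- The elements `Yₙ⁻ = (X₀⁻¹ - 1) ^ (n - 1) X₀⁻¹ (1 - X₁⁻¹)` of `W`, for `n > 0`. -/
def Yminus (n : ℕ) : W k :=
  mkW ((Xp k 0 (-1) - 1) ^ (n - 1) * Xp k 0 (-1) * (1 - Xp k 1 (-1))) (by
    have h : (1 : V k) - Xp k 1 (-1) = Xp k 1 (-1) * (X k 1 - 1) := by
      rw [mul_sub, X, ← Xp_add]; simp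
    rw [h, ← mul_assoc]; exact mul_X_sub_one_mem _)

/-- The defining properties of the coproduct of `W`. -/
structure IsCoproductW (Δ : W k →ₐ[k] W k ⊗[k] W k) : Prop where
  map_X : Δ (WX k 1) = WX k 1 ⊗ₜ WX k 1
  map_X_inv : Δ (WX k (-1)) = WX k (-1) ⊗ₜ WX k (-1)
  map_Yplus : ∀ n : ℕ, 0 < n → Δ (Yplus k n) = Yplus k n ⊗ₜ 1 + 1 ⊗ₜ Yplus k n +
    ∑ i ∈ Finset.Ioo 0 n, Yplus k i ⊗ₜ Yplus k (n - i)
  map_Yminus : ∀ n : ℕ, 0 < n → Δ (Yminus k n) = Yminus k n ⊗ₜ 1 + 1 ⊗ₜ Yminus k n +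
    ∑ i ∈ Finset.Ioo 0 n, Yminus k i ⊗ₜ Yminus k (n - i)

end Discrete

/-! ### An auxiliary representation of the free group

It is used for proving that the coproduct of `W` exists and is compatible with the filtrations. -/

section Auxiliary

variable {k : Type*} [CommRing k] {Q : Type*} [Ring Q] [Algebra k Q] (x : Qˣ) (y : ℤ → Q)

/-- The map `(q, f) ↦ q + ∑ yₐ fₐ`. -/
def evN : (Q × (ℤ →₀ Q)) →ₗ[k] Q :=
  LinearMap.coprod LinearMap.id (Finsupp.lsum k fun a => LinearMap.mulLeft k (y a))

theorem evN_single (a : ℤ) (q : Q) : evN (k := k) y (0, Finsupp.single a q) = y a * q := by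
  simp [evN]

theorem evN_fst (q : Q) : evN (k := k) y (q, 0) = q := by simp [evN]

/-- The operator by which `X₀` acts. -/
def opS : (Q × (ℤ →₀ Q)) ≃ₗ[k] (Q × (ℤ →₀ Q)) :=
  LinearEquiv.prodCongr (LinearEquiv.refl k Q) (Finsupp.domLCongr (Equiv.addRight (1 : ℤ)))

theorem opS_single (a : ℤ) (q : Q) : opS (k := k) (0, Finsupp.single a q) =
    (0, Finsupp.single (a + 1) q) := by
  simp [opS]

theorem opS_fst (q : Q) : opS (k := k) (q, (0 : ℤ →₀ Q)) = (q, 0) := by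
  simp [opS]

/-- The inclusion of the summand of index zero. -/
def delta0 : Q →ₗ[k] (Q × (ℤ →₀ Q)) := (LinearMap.inr k Q (ℤ →₀ Q)).comp (Finsupp.lsingle 0)

theorem delta0_apply (q : Q) : delta0 (k := k) q = (0, Finsupp.single 0 q) := rfl

variable {x y} (hy : y 0 = x - 1)

theorem evN_delta0
    (hy : y 0 = x - 1) (q : Q) : evN (k := k) y (delta0 (k := k) q) = x * q - q := by
  rw [delta0_apply, evN_single, hy, sub_mul, one_mul]

/-- The operator by which `X₁` acts. -/
def opR (hy : y 0 = x - 1) : (Q × (ℤ →₀ Q)) ≃ₗ[k] (Q × (ℤ →₀ Q)) :=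
  LinearEquiv.ofLinearMap (LinearMap.id + delta0.comp (evN y))
    (LinearMap.id - (delta0.comp (LinearMap.mulLeft k ((x⁻¹ : Qˣ) : Q))).comp (evN y))
    (by
      refine LinearMap.ext fun v => ?_
      simp only [LinearMap.comp_apply, LinearMap.add_apply, LinearMap.sub_apply,
        LinearMap.id_apply, LinearMap.mulLeft_apply, map_sub, evN_delta0 hy,
        Units.mul_inv_cancel_left]
      abel)
    (by
      refine LinearMap.ext fun v => ?_
      simp only [LinearMap.comp_apply, LinearMap.add_apply, LinearMap.sub_apply,
        LinearMap.id_apply, LinearMap.mulLeft_apply, map_add, evN_delta0 hy,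
        Units.inv_mul_cancel_left, map_sub]
      abel)

theorem opR_apply (v : Q × (ℤ →₀ Q)) :
    opR (k := k) hy v = v + delta0 (k := k) (evN (k := k) y v) := rfl

theorem opR_symm_apply (v : Q × (ℤ →₀ Q)) : (opR (k := k) hy).symm v =
    v - delta0 (k := k) ((x⁻¹ : Qˣ) * evN (k := k) y v) := rfl

/-- The action of the group algebra. -/
def rho (hy : y 0 = x - 1) : V k →ₐ[k] Module.End k (Q × (ℤ →₀ Q)) :=
  MonoidAlgebra.lift k _ _ (LinearEquiv.automorphismGroup.toLinearMapMonoidHom.comp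
    (FreeGroup.lift ![opS, opR hy]))

theorem rho_of (g : FreeGroup (Fin 2)) (v : Q × (ℤ →₀ Q)) :
    rho (k := k) hy (MonoidAlgebra.of k _ g) v = (FreeGroup.lift ![opS, opR (k := k) hy]) g v := by
  rw [rho, MonoidAlgebra.lift_of]; rfl

theorem rho_X0 (v : Q × (ℤ →₀ Q)) : rho (k := k) hy (X k 0) v = opS (k := k) v := by
  rw [X, Xp, zpow_one, rho_of, FreeGroup.lift_apply_of]; rfl

theorem rho_X1 (v : Q × (ℤ →₀ Q)) :
    rho (k := k) hy (X k 1) v = v + delta0 (k := k) (evN (k := k) y v) := by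
  rw [X, Xp, zpow_one, rho_of, FreeGroup.lift_apply_of]; rfl

theorem rho_sub_one (u : V k) (v : Q × (ℤ →₀ Q)) :
    rho (k := k) hy (u - 1) v = rho (k := k) hy u v - v := by
  rw [map_sub, map_one, LinearMap.sub_apply, Module.End.one_apply]

theorem rho_X1_sub_one (v : Q × (ℤ →₀ Q)) :
    rho (k := k) hy (X k 1 - 1) v = delta0 (k := k) (evN (k := k) y v) := by
  rw [map_sub, map_one, LinearMap.sub_apply, rho_X1, Module.End.one_apply, add_sub_cancel_left]

theorem rho_Xp0 (a b : ℤ) (q : Q) : rho (k := k) hy (Xp k 0 a) (0, Finsupp.single b q) =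
    (0, Finsupp.single (b + a) q) := by
  have h1 : ∀ b : ℤ, rho (k := k) hy (Xp k 0 1) (0, Finsupp.single b q) =
      (0, Finsupp.single (b + 1) q) := fun b => by rw [← X, rho_X0, opS_single]
  have h2 : ∀ b : ℤ, rho (k := k) hy (Xp k 0 (-1)) (0, Finsupp.single b q) =
      (0, Finsupp.single (b - 1) q) := fun b => by
    have h := h1 (b - 1)
    rw [sub_add_cancel] at h
    rw [← h, ← Module.End.mul_apply, ← map_mul, ← Xp_add]
    simp
  induction a using Int.induction_on generalizing b with
  | zero => simp
  | succ n ih => rw [Xp_add, map_mul, Module.End.mul_apply, h1, ih]; congr 2; ring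
  | pred n ih =>
    rw [sub_eq_add_neg, Xp_add, map_mul, Module.End.mul_apply, h2, ih]; congr 2; ring

/-- The linear map `V → Q`, such that `1 ↦ 1`, `v (X₀ - 1) ↦ 0` and
`X₀ ^ a (X₁ - 1) v ↦ yₐ D(v)`. -/
def D (hy : y 0 = x - 1) : V k →ₗ[k] Q :=
  (evN y).comp ((LinearMap.applyₗ (R := k) ((1 : Q), (0 : ℤ →₀ Q))).comp (rho hy).toLinearMap)

theorem D_apply (v : V k) : D (k := k) hy v = evN (k := k) y (rho (k := k) hy v (1, 0)) := rfl

theorem D_one : D (k := k) hy 1 = 1 := by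
  rw [D_apply, map_one, Module.End.one_apply, evN_fst]

theorem D_mul_X0_sub_one (v : V k) : D (k := k) hy (v * (X k 0 - 1)) = 0 := by
  rw [D_apply, map_mul, Module.End.mul_apply, map_sub, map_one, LinearMap.sub_apply, rho_X0,
    Module.End.one_apply, opS_fst, sub_self, map_zero, map_zero]

/-- The right multiplication by an element of `Q`. -/
def mulR (k : Type*) [CommRing k] [Algebra k Q] (q : Q) : (Q × (ℤ →₀ Q)) →ₗ[k] (Q × (ℤ →₀ Q)) :=
  LinearMap.prodMap (LinearMap.mulRight k q) (Finsupp.mapRange.linearMap (LinearMap.mulRight k q))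

theorem mulR_single (q : Q) (a : ℤ) (p : Q) :
    mulR k q (0, Finsupp.single a p) = (0, Finsupp.single a (p * q)) := by
  rw [mulR, LinearMap.prodMap_apply, map_zero, Finsupp.mapRange.linearMap_apply,
    Finsupp.mapRange_single, LinearMap.mulRight_apply]

theorem evN_mulR (q : Q) (v : Q × (ℤ →₀ Q)) :
    evN (k := k) y (mulR k q v) = evN (k := k) y v * q := by
  suffices h : (evN (k := k) y).comp (mulR k q) = (LinearMap.mulRight k q).comp (evN (k := k) y)
    from LinearMap.congr_fun h v
  refine LinearMap.prod_ext (LinearMap.ext fun p => ?_)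
    (Finsupp.lhom_ext fun a p => ?_)
  · simp [evN, mulR]
  · simp only [LinearMap.comp_apply, LinearMap.inr_apply, mulR_single, evN_single,
      LinearMap.mulRight_apply, mul_assoc]

theorem delta0_mul (q p : Q) : delta0 (k := k) (p * q) = mulR k q (delta0 (k := k) p) := by
  rw [delta0_apply, delta0_apply, mulR_single]

theorem opS_mulR (q : Q) (v : Q × (ℤ →₀ Q)) :
    opS (k := k) (mulR k q v) = mulR k q (opS (k := k) v) := by
  suffices h : (opS (k := k)).toLinearMap.comp (mulR k q) =
      (mulR k q).comp (opS (k := k) (Q := Q)).toLinearMap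
    from LinearMap.congr_fun h v
  refine LinearMap.prod_ext (LinearMap.ext fun p => ?_)
    (Finsupp.lhom_ext fun a p => ?_)
  · simp [opS, mulR]
  · simp only [LinearMap.comp_apply, LinearMap.inr_apply, mulR_single, LinearEquiv.coe_coe,
      opS_single]

theorem rho_mulR (u : V k) (q : Q) (v : Q × (ℤ →₀ Q)) :
    rho (k := k) hy u (mulR k q v) = mulR k q (rho (k := k) hy u v) := by
  induction u using MonoidAlgebra.induction_linear with
  | zero => simp
  | add a b ha hb => rw [map_add, LinearMap.add_apply, LinearMap.add_apply, ha, hb, map_add]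
  | single m r =>
    have h1 : MonoidAlgebra.single m r = r • MonoidAlgebra.of k (FreeGroup (Fin 2)) m := by
      simp [MonoidAlgebra.of_apply]
    rw [h1, map_smul, LinearMap.smul_apply, LinearMap.smul_apply, map_smul]
    congr 1
    rw [rho_of, rho_of]
    clear h1
    have inv : ∀ e : (Q × (ℤ →₀ Q)) ≃ₗ[k] (Q × (ℤ →₀ Q)),
        (∀ v, e (mulR k q v) = mulR k q (e v)) →
        ∀ v, e⁻¹ (mulR k q v) = mulR k q (e⁻¹ v) := fun e he v => by
      apply e.injective
      rw [he]
      change e (e.symm _) = mulR k q (e (e.symm _))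
      rw [e.apply_symm_apply, e.apply_symm_apply]
    have gen : ∀ i v, (![opS, opR (k := k) hy] : Fin 2 → _) i (mulR k q v) =
        mulR k q ((![opS, opR (k := k) hy] : Fin 2 → _) i v) := fun i => by
      fin_cases i
      · exact opS_mulR q
      · intro v
        change opR (k := k) hy _ = mulR k q (opR (k := k) hy _)
        rw [opR_apply, opR_apply, evN_mulR, delta0_mul, map_add]
    induction m using FreeGroup.induction_on generalizing v with
    | C1 => simp
    | of i => rw [FreeGroup.lift_apply_of]; exact gen i v
    | inv_of i _ => rw [map_inv, FreeGroup.lift_apply_of]; exact inv _ (gen i) v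
    | mul a b ha hb => rw [map_mul, LinearEquiv.mul_apply, LinearEquiv.mul_apply, hb, ha]

theorem D_mul_X1_sub_one_mul (v u : V k) :
    D (k := k) hy (v * (X k 1 - 1) * u) = D (k := k) hy (v * (X k 1 - 1)) * D (k := k) hy u := by
  rw [D_apply, D_apply (v := v * (X k 1 - 1)), map_mul, map_mul, Module.End.mul_apply,
    Module.End.mul_apply, Module.End.mul_apply, rho_X1_sub_one, rho_X1_sub_one, ← D_apply,
    evN_fst, ← evN_mulR, ← rho_mulR, ← delta0_mul, one_mul]

theorem D_Xp0 (a : ℤ) : D (k := k) hy (Xp k 0 a * (X k 1 - 1)) = y a := by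
  rw [D_apply, map_mul, Module.End.mul_apply, rho_X1_sub_one, evN_fst, delta0_apply, rho_Xp0,
    evN_single, zero_add, mul_one]

theorem D_mul_of_mem {w : V k} (hw : w ∈ subW k) (u : V k) :
    D (k := k) hy (w * u) = D (k := k) hy w * D (k := k) hy u := by
  obtain ⟨c, v, rfl⟩ := hw
  rw [add_mul, map_add, map_add, D_mul_X1_sub_one_mul, add_mul, Algebra.algebraMap_eq_smul_one,
    smul_mul_assoc, map_smul, map_smul, one_mul, D_one, smul_mul_assoc, one_mul]

/-- The restriction of `D` to `W`, an algebra morphism. -/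
def DW (hy : y 0 = x - 1) : W k →ₐ[k] Q :=
  AlgHom.ofLinearMap ((D hy).comp (inclW k).toLinearMap) (D_one hy)
    (fun w w' => D_mul_of_mem hy (inclW_mem w) (inclW k w'))

theorem DW_apply (w : W k) : DW (k := k) hy w = D (k := k) hy (inclW k w) := rfl

/-- A filtration of the auxiliary representation. -/
def filN (T : ℕ → Submodule k Q) (hy : y 0 = x - 1) (i : ℕ) : Submodule k (Q × (ℤ →₀ Q)) :=
  Submodule.span k ({v | ∃ q ∈ T i, v = (q, 0)} ∪
    {v | ∃ (a : ℤ) (j l : ℕ), i ≤ j + l + 1 ∧ ∃ q ∈ T l,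
      v = rho (k := k) hy (Xp k 0 a * (X k 0 - 1) ^ j) (delta0 (k := k) q)})

section Filtration

variable {T : ℕ → Submodule k Q}

theorem fst_mem_filN {i : ℕ} {q : Q} (hq : q ∈ T i) : ((q, 0) : Q × (ℤ →₀ Q)) ∈ filN T hy i :=
  Submodule.subset_span (Or.inl ⟨q, hq, rfl⟩)

theorem rho_mem_filN {i : ℕ} (a : ℤ) {j l : ℕ} (h : i ≤ j + l + 1) {q : Q} (hq : q ∈ T l) :
    rho (k := k) hy (Xp k 0 a * (X k 0 - 1) ^ j) (delta0 (k := k) q) ∈ filN T hy i :=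
  Submodule.subset_span (Or.inr ⟨a, j, l, h, q, hq, rfl⟩)

theorem delta0_mem_filN {i : ℕ} {q : Q} (hq : q ∈ T i) :
    delta0 (k := k) q ∈ filN T hy (i + 1) := by
  have := rho_mem_filN (k := k) hy (i := i + 1) 0 (j := 0) (l := i) (by omega) hq
  simpa using this

theorem filN_le {i : ℕ} {P : Submodule k (Q × (ℤ →₀ Q))} (h1 : ∀ q ∈ T i, (q, 0) ∈ P)
    (h2 : ∀ (a : ℤ) (j l : ℕ), i ≤ j + l + 1 → ∀ q ∈ T l,
      rho (k := k) hy (Xp k 0 a * (X k 0 - 1) ^ j) (delta0 (k := k) q) ∈ P) :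
    filN T hy i ≤ P := by
  refine Submodule.span_le.2 ?_
  rintro v (⟨q, hq, rfl⟩ | ⟨a, j, l, hi, q, hq, rfl⟩)
  · exact h1 q hq
  · exact h2 a j l hi q hq

theorem filN_anti
    (hT : Antitone T) : Antitone (filN T hy) := fun _ _ h =>
  filN_le hy (fun _ hq => fst_mem_filN hy (hT h hq))
    (fun a _ _ hi _ hq => rho_mem_filN hy a (h.trans hi) hq)

variable {z : ℕ → ℤ → Q}

theorem evN_rho
    (hz0 : ∀ a, z 0 a = y a)
    (hz : ∀ j a, z (j + 1) a = z j (a + 1) - z j a) (a : ℤ) (j : ℕ) (q : Q) : evN (k := k) y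
    (rho (k := k) hy (Xp k 0 a * (X k 0 - 1) ^ j) (delta0 (k := k) q)) = z j a * q := by
  induction j generalizing a with
  | zero => rw [pow_zero, mul_one, delta0_apply, rho_Xp0, evN_single, hz0, zero_add]
  | succ j ih =>
    have h : Xp k 0 a * (X k 0 - 1) ^ (j + 1) =
        Xp k 0 (a + 1) * (X k 0 - 1) ^ j - Xp k 0 a * (X k 0 - 1) ^ j := by
      rw [Xp_add, pow_succ', ← X]; noncomm_ring
    rw [h, map_sub, LinearMap.sub_apply, map_sub, ih, ih, hz, sub_mul]

theorem evN_mem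
    (hT : Antitone T)
    (hmul : ∀ i j, ∀ p ∈ T i, ∀ q ∈ T j, p * q ∈ T (i + j))
    (hz0 : ∀ a, z 0 a = y a)
    (hz : ∀ j a, z (j + 1) a = z j (a + 1) - z j a)
    (hzT : ∀ j a, z j a ∈ T (j + 1)) {i : ℕ} {v : Q × (ℤ →₀ Q)} (hv : v ∈ filN T hy i) : evN (k := k) y v ∈ T i := by
  suffices h : filN T hy i ≤ (T i).comap (evN y) from h hv
  refine filN_le hy (fun q hq => ?_) (fun a j l hi q hq => ?_)
  · rw [Submodule.mem_comap, evN_fst]; exact hq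
  · rw [Submodule.mem_comap, evN_rho hy hz0 hz]
    exact hT (by omega) (hmul _ _ _ (hzT j a) _ hq)

theorem rho_sub_mem
    (hT : Antitone T)
    (hmul : ∀ i j, ∀ p ∈ T i, ∀ q ∈ T j, p * q ∈ T (i + j))
    (hzero : ∀ q, q ∈ T 0)
    (hz0 : ∀ a, z 0 a = y a)
    (hz : ∀ j a, z (j + 1) a = z j (a + 1) - z j a)
    (hzT : ∀ j a, z j a ∈ T (j + 1)) (g : FreeGroup (Fin 2)) : ∀ i, ∀ v ∈ filN T hy i,
    rho (k := k) hy (MonoidAlgebra.of k _ g) v - v ∈ filN T hy (i + 1) := by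
  induction g using FreeGroup.induction_on with
  | C1 =>
    intro i v _
    rw [map_one, map_one, Module.End.one_apply, sub_self]
    exact zero_mem _
  | of b =>
    intro i v hv
    have hb : MonoidAlgebra.of k _ (FreeGroup.of b) = X k b := by rw [X, Xp, zpow_one]
    rw [hb]
    fin_cases b
    · change rho (k := k) hy (X k 0) v - v ∈ _
      rw [← rho_sub_one]
      suffices h : filN T hy i ≤ (filN T hy (i + 1)).comap (rho hy (X k 0 - 1)) from h hv
      refine filN_le hy (fun q hq => ?_) (fun a j l hi q hq => ?_)
      · rw [Submodule.mem_comap, rho_sub_one, rho_X0, opS_fst, sub_self]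
        exact zero_mem _
      · rw [Submodule.mem_comap, ← Module.End.mul_apply, ← map_mul]
        have h : (X k 0 - 1) * (Xp k 0 a * (X k 0 - 1) ^ j) =
            Xp k 0 a * (X k 0 - 1) ^ (j + 1) := by
          rw [pow_succ', ← mul_assoc, ← mul_assoc]
          congr 1
          rw [sub_mul, mul_sub, X, ← Xp_add, ← Xp_add, add_comm, one_mul, mul_one]
        rw [h]
        exact rho_mem_filN hy a (by omega) hq
    · change rho (k := k) hy (X k 1) v - v ∈ _
      rw [rho_X1, add_sub_cancel_left]
      exact delta0_mem_filN hy (evN_mem hy hT hmul hz0 hz hzT hv)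
  | inv_of b _ =>
    intro i v hv
    fin_cases b
    · have hb : MonoidAlgebra.of k _ (FreeGroup.of (0 : Fin 2))⁻¹ = Xp k 0 (-1) := by
        rw [Xp, zpow_neg, zpow_one]
      change rho (k := k) hy (MonoidAlgebra.of k _ (FreeGroup.of (0 : Fin 2))⁻¹) v - v ∈ _
      rw [hb]
      rw [← rho_sub_one]
      suffices h : filN T hy i ≤ (filN T hy (i + 1)).comap (rho hy (Xp k 0 (-1) - 1)) from h hv
      refine filN_le hy (fun q hq => ?_) (fun a j l hi q hq => ?_)
      · have h1 : rho (k := k) hy (Xp k 0 (-1)) (q, 0) = (q, 0) := by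
          conv_lhs => rw [← opS_fst (k := k) q, ← rho_X0 (k := k) hy, X, ← Module.End.mul_apply,
            ← map_mul, ← Xp_add]
          simp
        rw [Submodule.mem_comap, rho_sub_one, h1, sub_self]
        exact zero_mem _
      · rw [Submodule.mem_comap, ← Module.End.mul_apply, ← map_mul]
        have h : (Xp k 0 (-1) - 1) * (Xp k 0 a * (X k 0 - 1) ^ j) =
            -(Xp k 0 (a - 1) * (X k 0 - 1) ^ (j + 1)) := by
          rw [pow_succ', ← mul_assoc, ← mul_assoc, ← neg_mul]
          congr 1
          rw [sub_mul, mul_sub, X, ← Xp_add, ← Xp_add, sub_add_cancel, one_mul, mul_one,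
            neg_sub, neg_add_eq_sub]
        rw [h, map_neg, LinearMap.neg_apply]
        exact neg_mem (rho_mem_filN hy (a - 1) (by omega) hq)
    · change rho (k := k) hy (MonoidAlgebra.of k _ (FreeGroup.of (1 : Fin 2))⁻¹) v - v ∈ _
      rw [rho_of, map_inv, FreeGroup.lift_apply_of]
      change (opR (k := k) hy).symm v - v ∈ _
      rw [opR_symm_apply, sub_sub_cancel_left]
      refine neg_mem (delta0_mem_filN hy ?_)
      have := hmul 0 i _ (hzero ((x⁻¹ : Qˣ) : Q)) _ (evN_mem hy hT hmul hz0 hz hzT hv)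
      rwa [zero_add] at this
  | mul a b ha hb =>
    intro i v hv
    have h1 := hb i v hv
    have h2 : rho (k := k) hy (MonoidAlgebra.of k _ b) v ∈ filN T hy i := by
      have := add_mem (filN_anti hy hT (Nat.le_succ i) h1) hv
      rwa [sub_add_cancel] at this
    have h3 := add_mem (ha i _ h2) h1
    rw [sub_add_sub_cancel] at h3
    rwa [map_mul, map_mul, Module.End.mul_apply]

theorem rho_pow_mem
    (hT : Antitone T)
    (hmul : ∀ i j, ∀ p ∈ T i, ∀ q ∈ T j, p * q ∈ T (i + j))
    (hzero : ∀ q, q ∈ T 0)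
    (hz0 : ∀ a, z 0 a = y a)
    (hz : ∀ j a, z (j + 1) a = z j (a + 1) - z j a)
    (hzT : ∀ j a, z j a ∈ T (j + 1)) (n : ℕ) : ∀ u ∈ augI k ^ n, ∀ i, ∀ v ∈ filN T hy i,
    rho (k := k) hy u v ∈ filN T hy (i + n) := by
  have one : ∀ u ∈ augI k, ∀ i, ∀ v ∈ filN T hy i, rho (k := k) hy u v ∈ filN T hy (i + 1) := by
    intro u hu i v hv
    refine sub_counit_induction (((LinearMap.applyₗ (R := k) v).comp (rho hy).toLinearMap))
      (filN T hy (i + 1)) (fun g => ?_) hu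
    have := rho_sub_mem hy hT hmul hzero hz0 hz hzT g i v hv
    simpa [map_sub] using this
  induction n with
  | zero =>
    intro u _ i v hv
    have h : u = (u - algebraMap k (V k) (Bialgebra.counitAlgHom k (V k) u)) +
      algebraMap k (V k) (Bialgebra.counitAlgHom k (V k) u) := by abel
    rw [h, map_add, LinearMap.add_apply, AlgHom.commutes, Module.algebraMap_end_apply]
    refine add_mem (filN_anti hy hT (Nat.le_succ i) (one _ ?_ i v hv)) (Submodule.smul_mem _ _ hv)
    rw [mem_augI, map_sub, AlgHom.commutes, Algebra.algebraMap_self, RingHom.id_apply, sub_self]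
  | succ n ih =>
    intro u hu i v hv
    rw [Ideal.IsTwoSided.pow_add, Submodule.pow_one] at hu
    refine Submodule.mul_induction_on hu (fun a ha b hb => ?_) (fun a b ha hb => ?_)
    · rw [map_mul, Module.End.mul_apply, show i + (n + 1) = (i + 1) + n by ring]
      exact ih a ha _ _ (one b hb i v hv)
    · rw [map_add, LinearMap.add_apply]; exact add_mem ha hb

theorem D_pow_mem
    (hT : Antitone T)
    (hmul : ∀ i j, ∀ p ∈ T i, ∀ q ∈ T j, p * q ∈ T (i + j))
    (hzero : ∀ q, q ∈ T 0)
    (hz0 : ∀ a, z 0 a = y a)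
    (hz : ∀ j a, z (j + 1) a = z j (a + 1) - z j a)
    (hzT : ∀ j a, z j a ∈ T (j + 1)) (n : ℕ) (u : V k) (hu : u ∈ augI k ^ n) : D (k := k) hy u ∈ T n := by
  have h := rho_pow_mem hy hT hmul hzero hz0 hz hzT n u hu 0 (1, 0) (fst_mem_filN hy (hzero 1))
  rw [zero_add] at h
  exact evN_mem hy hT hmul hz0 hz hzT h

end Filtration

end Auxiliary

/-! ### The coproducts of `W` and of `M` -/

section Coproducts

variable (k : Type*) [CommRing k]

/-- The elements `X₀ ^ a (X₀ - 1) ^ j (X₁ - 1)` of `W`. -/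
def Yd (j : ℕ) (a : ℤ) : W k :=
  mkW (Xp k 0 a * (X k 0 - 1) ^ j * (X k 1 - 1)) (mul_X_sub_one_mem _)

/-- The elements `X₀ ^ a (X₀⁻¹ - 1) ^ j (X₁ - 1)` of `W`. -/
def Yb (j : ℕ) (a : ℤ) : W k :=
  mkW (Xp k 0 a * (Xp k 0 (-1) - 1) ^ j * (X k 1 - 1)) (mul_X_sub_one_mem _)

variable {k}

theorem Yd_succ (j : ℕ) (a : ℤ) : Yd k (j + 1) a = Yd k j (a + 1) - Yd k j a := by
  refine W_ext ?_
  change Xp k 0 a * (X k 0 - 1) ^ (j + 1) * (X k 1 - 1) =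
    Xp k 0 (a + 1) * (X k 0 - 1) ^ j * (X k 1 - 1) - Xp k 0 a * (X k 0 - 1) ^ j * (X k 1 - 1)
  rw [← sub_mul, ← sub_mul, Xp_add, ← X, pow_succ', ← mul_assoc]
  congr 1
  rw [mul_sub, mul_one, sub_mul]

theorem Yb_succ (j : ℕ) (a : ℤ) : Yb k (j + 1) a = Yb k j (a - 1) - Yb k j a := by
  refine W_ext ?_
  change Xp k 0 a * (Xp k 0 (-1) - 1) ^ (j + 1) * (X k 1 - 1) =
    Xp k 0 (a - 1) * (Xp k 0 (-1) - 1) ^ j * (X k 1 - 1) -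
      Xp k 0 a * (Xp k 0 (-1) - 1) ^ j * (X k 1 - 1)
  rw [← sub_mul, ← sub_mul, sub_eq_add_neg a, Xp_add, pow_succ', ← mul_assoc]
  congr 1
  rw [mul_sub, mul_one, sub_mul]

theorem Yd_zero_eq_Yb (a : ℤ) : Yd k 0 a = Yb k 0 a := rfl

theorem Yd_zero_zero : Yd k 0 0 = WX k 1 - 1 := by
  refine W_ext ?_
  change Xp k 0 0 * (X k 0 - 1) ^ 0 * (X k 1 - 1) = Xp k 1 1 - 1
  rw [Xp_zero, pow_zero, one_mul, one_mul, X]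

theorem WX_mul (a b : ℤ) : WX k a * WX k b = WX k (a + b) := W_ext (Xp_add 1 a b).symm

theorem WX_zero : WX k 0 = 1 := W_ext (Xp_zero 1)

theorem Yplus_eq (n : ℕ) : Yplus k n = -Yd k (n - 1) 1 := by
  refine W_ext ?_
  change (Xp k 0 1 - 1) ^ (n - 1) * Xp k 0 1 * (1 - Xp k 1 1) =
    -(Xp k 0 1 * (X k 0 - 1) ^ (n - 1) * (X k 1 - 1))
  rw [← mul_neg, neg_sub, X, X]
  congr 1
  exact (((Commute.refl (Xp k 0 1)).sub_left (Commute.one_left _)).pow_left _).eq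

theorem Yminus_eq (n : ℕ) : Yminus k n = Yb k (n - 1) (-1) * WX k (-1) := by
  refine W_ext ?_
  change (Xp k 0 (-1) - 1) ^ (n - 1) * Xp k 0 (-1) * (1 - Xp k 1 (-1)) =
    Xp k 0 (-1) * (Xp k 0 (-1) - 1) ^ (n - 1) * (X k 1 - 1) * Xp k 1 (-1)
  rw [mul_assoc _ (X k 1 - 1), sub_mul, X, ← Xp_add, one_mul, add_neg_cancel, Xp_zero]
  congr 1
  exact (((Commute.refl (Xp k 0 (-1))).sub_left (Commute.one_left _)).pow_left _).eq

theorem Yb_eq (n : ℕ) : Yb k (n - 1) (-1) = Yminus k n * WX k 1 := by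
  rw [Yminus_eq n, mul_assoc, WX_mul, neg_add_cancel, WX_zero, mul_one]

/-- A subalgebra of `W` which contains `X₁ ^ ±1` and the `X₀ ^ a (X₁ - 1)` is equal to `W`. -/
theorem eq_top_of_mem (E : Subalgebra k (W k)) (h2 : WX k (-1) ∈ E)
    (hY : ∀ a, Yd k 0 a ∈ E) : E = ⊤ := by
  let B : Submodule k (V k) := Submodule.span k
    {v | ∃ (a : ℤ) (e : W k), e ∈ E ∧ v = Xp k 0 a * (X k 1 - 1) * inclW k e}
  have hBE : ∀ b ∈ B, ∃ e ∈ E, b = inclW k e := by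
    intro b hb
    suffices h : B ≤ (Subalgebra.toSubmodule (E.map (inclW k))) by
      obtain ⟨e, he, rfl⟩ := h hb
      exact ⟨e, he, rfl⟩
    refine Submodule.span_le.2 ?_
    rintro _ ⟨a, e, he, rfl⟩
    exact ⟨Yd k 0 a * e, E.mul_mem (hY a) he, by simp [Yd]⟩
  have gen0 : ∀ c : ℤ, ∀ b ∈ B, Xp k 0 c * b ∈ B := by
    intro c b hb
    suffices h : B ≤ B.comap (LinearMap.mulLeft k (Xp k 0 c)) from h hb
    refine Submodule.span_le.2 ?_
    rintro _ ⟨a, e, he, rfl⟩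
    refine Submodule.subset_span ⟨c + a, e, he, ?_⟩
    rw [LinearMap.mulLeft_apply, ← mul_assoc, ← mul_assoc, Xp_add]
  have gen1 : ∀ e ∈ E, (X k 1 - 1) * inclW k e ∈ B := fun e he =>
    Submodule.subset_span ⟨0, e, he, by rw [Xp_zero, one_mul]⟩
  have stable : ∀ g : FreeGroup (Fin 2), ∀ b ∈ B, MonoidAlgebra.of k _ g * b ∈ B := by
    intro g
    induction g using FreeGroup.induction_on with
    | C1 => intro b hb; rwa [map_one, one_mul]
    | of i =>
      intro b hb
      fin_cases i
      · have := gen0 1 b hb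
        rwa [Xp, zpow_one] at this
      · obtain ⟨e, he, rfl⟩ := hBE b hb
        have := add_mem (gen1 e he) hb
        rw [sub_mul, one_mul, sub_add_cancel, X, Xp, zpow_one] at this
        exact this
    | inv_of i _ =>
      intro b hb
      fin_cases i
      · have := gen0 (-1) b hb
        rwa [Xp, zpow_neg, zpow_one] at this
      · obtain ⟨e, he, rfl⟩ := hBE b hb
        have := sub_mem hb (gen1 _ (E.mul_mem h2 he))
        have h3 : (X k 1 - 1) * inclW k (WX k (-1) * e) =
            inclW k e - Xp k 1 (-1) * inclW k e := by
          change (X k 1 - 1) * (Xp k 1 (-1) * inclW k e) = _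
          rw [← mul_assoc, sub_mul, X, ← Xp_add, one_mul, add_neg_cancel, Xp_zero, sub_mul,
            one_mul]
        rw [h3, sub_sub_cancel, Xp, zpow_neg, zpow_one] at this
        exact this
    | mul a b ha hb =>
      intro c hc
      rw [map_mul, mul_assoc]
      exact ha _ (hb _ hc)
  have all : ∀ v : V k, v * (X k 1 - 1) ∈ B := by
    intro v
    induction v using MonoidAlgebra.induction_linear with
    | zero => rw [zero_mul]; exact zero_mem _
    | add x y hx hy => rw [add_mul]; exact add_mem hx hy
    | single m r =>
      have h1 : MonoidAlgebra.single m r = r • MonoidAlgebra.of k (FreeGroup (Fin 2)) m := by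
        simp [MonoidAlgebra.of_apply]
      rw [h1, smul_mul_assoc]
      refine B.smul_mem r (stable m _ ?_)
      have := gen1 1 (one_mem E)
      rwa [map_one, mul_one] at this
  rw [eq_top_iff]
  rintro ⟨_, c, v, rfl⟩ _
  obtain ⟨e, he, hv⟩ := hBE _ (all v)
  have : (⟨algebraMap k (V k) c + v * (X k 1 - 1), c, v, rfl⟩ : W k) =
      algebraMap k (W k) c + e :=
    W_ext (congrArg (fun u => algebraMap k (V k) c + u) hv)
  rw [this]
  exact E.add_mem (E.algebraMap_mem c) he

theorem IsCoproductW.unique {Δ Δ' : W k →ₐ[k] W k ⊗[k] W k} (h : IsCoproductW k Δ)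
    (h' : IsCoproductW k Δ') : Δ = Δ' := by
  have h1 : WX k 1 ∈ AlgHom.equalizer Δ Δ' := by
    rw [AlgHom.mem_equalizer, h.map_X, h'.map_X]
  have h2 : WX k (-1) ∈ AlgHom.equalizer Δ Δ' := by
    rw [AlgHom.mem_equalizer, h.map_X_inv, h'.map_X_inv]
  have hp : ∀ a j : ℕ, Yd k j (a + 1) ∈ AlgHom.equalizer Δ Δ' := by
    intro a
    induction a with
    | zero =>
      intro j
      have := Yplus_eq (k := k) (j + 1)
      rw [Nat.add_sub_cancel] at this
      rw [Nat.cast_zero, zero_add, ← neg_neg (Yd k j 1), ← this]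
      refine neg_mem ?_
      rw [AlgHom.mem_equalizer, h.map_Yplus _ (Nat.succ_pos j), h'.map_Yplus _ (Nat.succ_pos j)]
    | succ a ih =>
      intro j
      have := add_mem (ih (j + 1)) (ih j)
      rwa [Yd_succ, sub_add_cancel] at this
  have hm : ∀ a j : ℕ, Yb k j (-a - 1) ∈ AlgHom.equalizer Δ Δ' := by
    intro a
    induction a with
    | zero =>
      intro j
      have := Yb_eq (k := k) (j + 1)
      rw [Nat.add_sub_cancel] at this
      rw [Nat.cast_zero, neg_zero, zero_sub, this]
      refine mul_mem ?_ h1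
      rw [AlgHom.mem_equalizer, h.map_Yminus _ (Nat.succ_pos j), h'.map_Yminus _ (Nat.succ_pos j)]
    | succ a ih =>
      intro j
      have := add_mem (ih (j + 1)) (ih j)
      rw [Yb_succ, sub_add_cancel] at this
      have e : -((a + 1 : ℕ) : ℤ) - 1 = -(a : ℤ) - 1 - 1 := by push_cast; ring
      rwa [e]
  have htop := eq_top_of_mem (AlgHom.equalizer Δ Δ') h2 (fun a => by
    rcases lt_trichotomy a 0 with ha | rfl | ha
    · obtain ⟨b, rfl⟩ : ∃ b : ℕ, a = -b - 1 := ⟨(-a - 1).toNat, by omega⟩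
      exact hm b 0
    · rw [Yd_zero_zero]; exact sub_mem h1 (one_mem _)
    · obtain ⟨b, rfl⟩ : ∃ b : ℕ, a = b + 1 := ⟨(a - 1).toNat, by omega⟩
      exact hp b 0)
  refine AlgHom.ext fun w => ?_
  have : w ∈ AlgHom.equalizer Δ Δ' := by rw [htop]; trivial
  exact this

/-- The sum `∑_{0 < b < a} Y_b ⊗ Z_{a - b}`, extended to all integers `a` by the usual summation
convention. -/
def CC (Z : ℤ → W k) (a : ℤ) : W k ⊗[k] W k :=
  ∑ b ∈ Finset.Ioo 0 a, Yd k 0 b ⊗ₜ Z (a - b) - ∑ b ∈ Finset.Icc a 0, Yd k 0 b ⊗ₜ Z (a - b)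

theorem CC_succ (Z : ℤ → W k) (a : ℤ) :
    CC Z (a + 1) = Yd k 0 a ⊗ₜ Z 1 + CC (fun b => Z (b + 1)) a := by
  have e : ∀ b : ℤ, a + 1 - b = a - b + 1 := fun b => by ring
  have e0 : a - a + 1 = 1 := by ring
  simp only [CC, e]
  rcases lt_trichotomy a 0 with ha | rfl | ha
  · have h1 : Finset.Ioo 0 (a + 1) = ∅ := Finset.Ioo_eq_empty (by omega)
    have h2 : Finset.Ioo 0 a = ∅ := Finset.Ioo_eq_empty (by omega)
    have h3 : Finset.Icc a 0 = insert a (Finset.Icc (a + 1) 0) := by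
      ext b; simp only [Finset.mem_Icc, Finset.mem_insert]; omega
    rw [h1, h2, h3, Finset.sum_insert (by simp), e0]
    simp only [Finset.sum_empty]
    abel
  · have h1 : Finset.Ioo (0 : ℤ) (0 + 1) = ∅ := by ext b; simp only [Finset.mem_Ioo]; simp; omega
    have h2 : Finset.Icc (0 + 1 : ℤ) 0 = ∅ := by simp
    rw [h1, h2]
    simp
  · have h1 : Finset.Ioo 0 (a + 1) = insert a (Finset.Ioo 0 a) := by
      ext b; simp only [Finset.mem_Ioo, Finset.mem_insert]; omega
    have h2 : Finset.Icc (a + 1) 0 = ∅ := Finset.Icc_eq_empty (by omega)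
    have h3 : Finset.Icc a 0 = ∅ := Finset.Icc_eq_empty (by omega)
    rw [h1, h2, h3, Finset.sum_insert (by simp), e0]
    simp only [Finset.sum_empty]
    abel

theorem CC_sub (Z Z' : ℤ → W k) (a : ℤ) : CC (fun b => Z b - Z' b) a = CC Z a - CC Z' a := by
  simp only [CC, TensorProduct.tmul_sub, Finset.sum_sub_distrib]
  abel

/-- The coproducts of the `Yd`. -/
def yd (j : ℕ) (a : ℤ) : W k ⊗[k] W k :=
  Yd k j a ⊗ₜ 1 + 1 ⊗ₜ Yd k j a - ∑ i ∈ Finset.range j, Yd k (j - 1 - i) a ⊗ₜ Yd k i 1 -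
    CC (Yd k j) a

/-- The coproducts of the `Yb`. -/
def yb (j : ℕ) (a : ℤ) : W k ⊗[k] W k :=
  Yb k j a ⊗ₜ 1 + 1 ⊗ₜ Yb k j a + ∑ i ∈ Finset.range j, Yb k (j - 1 - i) (a - 1) ⊗ₜ Yb k i 0 -
    CC (Yb k j) a

theorem yd_succ (j : ℕ) (a : ℤ) : yd (k := k) (j + 1) a = yd j (a + 1) - yd j a := by
  have h1 : CC (Yd k (j + 1)) a = CC (Yd k j) (a + 1) - Yd k 0 a ⊗ₜ Yd k j 1 - CC (Yd k j) a := by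
    rw [CC_succ, add_sub_cancel_left, ← CC_sub]
    congr 1
    exact funext fun b => Yd_succ j b
  have h2 : ∑ i ∈ Finset.range (j + 1), Yd k (j + 1 - 1 - i) a ⊗ₜ[k] Yd k i 1 =
      ∑ i ∈ Finset.range j, Yd k (j - 1 - i) (a + 1) ⊗ₜ[k] Yd k i 1 -
        ∑ i ∈ Finset.range j, Yd k (j - 1 - i) a ⊗ₜ[k] Yd k i 1 + Yd k 0 a ⊗ₜ Yd k j 1 := by
    rw [Finset.sum_range_succ, ← Finset.sum_sub_distrib, Nat.add_sub_cancel, Nat.sub_self]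
    congr 1
    refine Finset.sum_congr rfl fun i hi => ?_
    rw [← TensorProduct.sub_tmul, ← Yd_succ]
    congr 2
    have := Finset.mem_range.1 hi
    omega
  rw [yd, yd, yd, h1, h2, Yd_succ, TensorProduct.sub_tmul, TensorProduct.tmul_sub]
  abel

theorem yb_succ (j : ℕ) (a : ℤ) : yb (k := k) (j + 1) a = yb j (a - 1) - yb j a := by
  have h1 : CC (Yb k (j + 1)) a = CC (Yb k j) (a - 1) + Yb k 0 (a - 1) ⊗ₜ Yb k j 0 -
      CC (Yb k j) a := by
    have h := CC_succ (fun b => Yb k j (b - 1)) (a - 1)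
    simp only [sub_add_cancel, add_sub_cancel_right, sub_self] at h
    rw [add_comm (CC (Yb k j) (a - 1))]
    refine Eq.trans ?_ (congrArg (fun u => u - CC (Yb k j) a) h)
    rw [← CC_sub]
    congr 1
    exact funext fun b => Yb_succ j b
  have h2 : ∑ i ∈ Finset.range (j + 1), Yb k (j + 1 - 1 - i) (a - 1) ⊗ₜ[k] Yb k i 0 =
      ∑ i ∈ Finset.range j, Yb k (j - 1 - i) (a - 1 - 1) ⊗ₜ[k] Yb k i 0 -
        ∑ i ∈ Finset.range j, Yb k (j - 1 - i) (a - 1) ⊗ₜ[k] Yb k i 0 +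
          Yb k 0 (a - 1) ⊗ₜ Yb k j 0 := by
    rw [Finset.sum_range_succ, ← Finset.sum_sub_distrib, Nat.add_sub_cancel, Nat.sub_self]
    congr 1
    refine Finset.sum_congr rfl fun i hi => ?_
    rw [← TensorProduct.sub_tmul, ← Yb_succ]
    congr 2
    have := Finset.mem_range.1 hi
    omega
  rw [yb, yb, yb, h1, h2, Yb_succ, TensorProduct.sub_tmul, TensorProduct.tmul_sub]
  abel

variable (k) in
/-- The element `X₁ ⊗ X₁`. -/
def xx : (W k ⊗[k] W k)ˣ where
  val := WX k 1 ⊗ₜ WX k 1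
  inv := WX k (-1) ⊗ₜ WX k (-1)
  val_inv := by
    rw [Algebra.TensorProduct.tmul_mul_tmul, WX_mul, add_neg_cancel, WX_zero]; rfl
  inv_val := by
    rw [Algebra.TensorProduct.tmul_mul_tmul, WX_mul, neg_add_cancel, WX_zero]; rfl

theorem yd_zero_zero : yd (k := k) 0 0 = (xx k : W k ⊗[k] W k) - 1 := by
  have h : CC (Yd k 0) 0 = -(Yd k 0 0 ⊗ₜ Yd k 0 0) := by simp [CC]
  change _ = WX k 1 ⊗ₜ WX k 1 - 1
  rw [yd, h, Finset.sum_range_zero, Yd_zero_zero, Algebra.TensorProduct.one_def]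
  simp only [TensorProduct.sub_tmul, TensorProduct.tmul_sub]
  abel

theorem D_Yd (j : ℕ) (a : ℤ) :
    D (k := k) (yd_zero_zero (k := k)) (inclW k (Yd k j a)) = yd j a := by
  induction j generalizing a with
  | zero =>
    have := D_Xp0 (k := k) (yd_zero_zero (k := k)) a
    rwa [← mul_one (Xp k 0 a), ← pow_zero (X k 0 - 1)] at this
  | succ j ih => rw [Yd_succ, map_sub, map_sub, ih, ih, yd_succ]

theorem D_Yb (j : ℕ) (a : ℤ) :
    D (k := k) (yd_zero_zero (k := k)) (inclW k (Yb k j a)) = yb j a := by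
  induction j generalizing a with
  | zero =>
    rw [← Yd_zero_eq_Yb, D_Yd]
    simp only [yd, yb, Finset.sum_range_zero, sub_zero, add_zero]
    rfl
  | succ j ih => rw [Yb_succ, map_sub, map_sub, ih, ih, yb_succ]

theorem isCoproductW_DW : IsCoproductW k (DW (yd_zero_zero (k := k))) := by
  have hX : DW (yd_zero_zero (k := k)) (WX k 1) = WX k 1 ⊗ₜ WX k 1 := by
    have h : WX k 1 = Yd k 0 0 + 1 := by rw [Yd_zero_zero, sub_add_cancel]
    rw [h, map_add, map_one, DW_apply, D_Yd, yd_zero_zero, sub_add_cancel, ← h]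
    rfl
  have hX' : DW (yd_zero_zero (k := k)) (WX k (-1)) = WX k (-1) ⊗ₜ WX k (-1) := by
    refine left_inv_eq_right_inv (a := WX k 1 ⊗ₜ WX k 1) ?_ (xx k).val_inv
    rw [← hX, ← map_mul, WX_mul, neg_add_cancel, WX_zero, map_one]
  refine ⟨hX, hX', fun n hn => ?_, fun n hn => ?_⟩
  · obtain ⟨j, rfl⟩ : ∃ j, n = j + 1 := ⟨n - 1, by omega⟩
    have hC : CC (Yd k j) 1 = 0 := by
      have h1 : Finset.Ioo (0 : ℤ) 1 = ∅ := by ext b; simp only [Finset.mem_Ioo]; simp; omega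
      have h2 : Finset.Icc (1 : ℤ) 0 = ∅ := by simp
      simp only [CC, h1, h2, Finset.sum_empty, sub_zero]
    have hs : ∑ i ∈ Finset.Ioo 0 (j + 1), Yplus k i ⊗ₜ[k] Yplus k (j + 1 - i) =
        ∑ i ∈ Finset.range j, Yd k (j - 1 - i) 1 ⊗ₜ[k] Yd k i 1 := by
      rw [← Finset.sum_range_reflect]
      refine Finset.sum_nbij' (fun i => i - 1) (fun i => i + 1) ?_ ?_ ?_ ?_ ?_
      · intro i hi; simp only [Finset.mem_Ioo, Finset.mem_range] at *; omega
      · intro i hi; simp only [Finset.mem_Ioo, Finset.mem_range] at *; omega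
      · intro i hi; simp only [Finset.mem_Ioo] at *; omega
      · intro i hi; simp
      · intro i hi
        simp only [Finset.mem_Ioo] at hi
        rw [Yplus_eq i, Yplus_eq, TensorProduct.neg_tmul,
          TensorProduct.tmul_neg, neg_neg]
        rw [show j - 1 - (j - 1 - (i - 1)) = i - 1 by omega,
          show j - 1 - (i - 1) = j + 1 - i - 1 by omega]
    rw [hs, Yplus_eq, Nat.add_sub_cancel, map_neg, DW_apply, D_Yd, yd, hC,
      TensorProduct.neg_tmul, TensorProduct.tmul_neg]
    abel
  · obtain ⟨j, rfl⟩ : ∃ j, n = j + 1 := ⟨n - 1, by omega⟩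
    have hC : CC (Yb k j) (-1) = -(Yb k 0 (-1) ⊗ₜ Yb k j 0) - Yb k 0 0 ⊗ₜ Yb k j (-1) := by
      have h1 : Finset.Ioo (0 : ℤ) (-1) = ∅ := Finset.Ioo_eq_empty (by omega)
      have h2 : Finset.Icc (-1 : ℤ) 0 = {-1, 0} := by decide
      simp only [CC, h1, h2, Finset.sum_empty, Yd_zero_eq_Yb]
      rw [Finset.sum_pair (by decide), sub_neg_eq_add, neg_add_cancel, sub_zero]
      abel
    have hsum : ∑ i ∈ Finset.range j, Yb k (j - 1 - i) (-1 - 1) ⊗ₜ[k] Yb k i 0 +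
        Yb k 0 (-1) ⊗ₜ Yb k j 0 = Yb k j (-1) ⊗ₜ Yb k 0 0 +
          ∑ i ∈ Finset.range j, Yb k (j - 1 - i) (-1) ⊗ₜ[k] Yb k i (-1) := by
      have e1 : ∀ i ∈ Finset.range j, Yb k (j - 1 - i) (-1 - 1) ⊗ₜ[k] Yb k i 0 =
          Yb k (j - i) (-1) ⊗ₜ Yb k i 0 + Yb k (j - 1 - i) (-1) ⊗ₜ Yb k i 0 := by
        intro i hi
        have h : j - i = j - 1 - i + 1 := by have := Finset.mem_range.1 hi; omega
        rw [h, Yb_succ, TensorProduct.sub_tmul, sub_add_cancel]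
      have e2 : ∀ i ∈ Finset.range j, Yb k (j - 1 - i) (-1) ⊗ₜ[k] Yb k i (-1) =
          Yb k (j - (i + 1)) (-1) ⊗ₜ Yb k (i + 1) 0 + Yb k (j - 1 - i) (-1) ⊗ₜ Yb k i 0 := by
        intro i hi
        have h : j - (i + 1) = j - 1 - i := by omega
        rw [h, Yb_succ, TensorProduct.tmul_sub, zero_sub, sub_add_cancel]
      have e3 := Finset.sum_range_succ (fun i => Yb k (j - i) (-1) ⊗ₜ[k] Yb k i 0) j
      rw [Finset.sum_range_succ'] at e3
      simp only [Nat.sub_self, Nat.sub_zero] at e3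
      rw [Finset.sum_congr rfl e1, Finset.sum_congr rfl e2, Finset.sum_add_distrib,
        Finset.sum_add_distrib, add_right_comm, ← e3]
      abel
    have hs : ∑ i ∈ Finset.Ioo 0 (j + 1), Yminus k i ⊗ₜ[k] Yminus k (j + 1 - i) =
        (∑ i ∈ Finset.range j, Yb k (j - 1 - i) (-1) ⊗ₜ[k] Yb k i (-1)) *
          (WX k (-1) ⊗ₜ WX k (-1)) := by
      rw [← Finset.sum_range_reflect, Finset.sum_mul]
      refine Finset.sum_nbij' (fun i => i - 1) (fun i => i + 1) ?_ ?_ ?_ ?_ ?_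
      · intro i hi; simp only [Finset.mem_Ioo, Finset.mem_range] at *; omega
      · intro i hi; simp only [Finset.mem_Ioo, Finset.mem_range] at *; omega
      · intro i hi; simp only [Finset.mem_Ioo] at *; omega
      · intro i hi; simp
      · intro i hi
        simp only [Finset.mem_Ioo] at hi
        rw [Yminus_eq i, Yminus_eq, Algebra.TensorProduct.tmul_mul_tmul]
        congr 3 <;> omega
    have hone : (1 : W k) = WX k 1 * WX k (-1) := by rw [WX_mul, add_neg_cancel, WX_zero]
    have hone' : WX k 1 = 1 + Yb k 0 0 := by
      rw [← Yd_zero_eq_Yb, Yd_zero_zero, add_sub_cancel]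
    have ht1 : Yminus k (j + 1) ⊗ₜ[k] (1 : W k) =
        (Yb k j (-1) ⊗ₜ WX k 1) * (WX k (-1) ⊗ₜ WX k (-1)) := by
      rw [Algebra.TensorProduct.tmul_mul_tmul, ← hone, Yminus_eq, Nat.add_sub_cancel]
    have ht2 : (1 : W k) ⊗ₜ[k] Yminus k (j + 1) =
        (WX k 1 ⊗ₜ Yb k j (-1)) * (WX k (-1) ⊗ₜ WX k (-1)) := by
      rw [Algebra.TensorProduct.tmul_mul_tmul, ← hone, Yminus_eq, Nat.add_sub_cancel]
    rw [hs, ht1, ht2, ← add_mul, ← add_mul, Yminus_eq, Nat.add_sub_cancel, map_mul, hX',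
      DW_apply, D_Yb]
    congr 1
    rw [yb, hC, hone', TensorProduct.tmul_add, TensorProduct.add_tmul, sub_sub_eq_add_sub,
      sub_neg_eq_add] 
    have := hsum
    generalize ∑ i ∈ Finset.range j, Yb k (j - 1 - i) (-1 - 1) ⊗ₜ[k] Yb k i 0 = s1 at *
    generalize ∑ i ∈ Finset.range j, Yb k (j - 1 - i) (-1) ⊗ₜ[k] Yb k i (-1) = s2 at *
    rw [eq_sub_of_add_eq hsum]
    abel

variable (k)

theorem existsUnique_coproductW : ∃! Δ : W k →ₐ[k] W k ⊗[k] W k, IsCoproductW k Δ :=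
  ⟨_, isCoproductW_DW, fun _ h => h.unique isCoproductW_DW⟩

/-- The coproduct of `W`: the algebra morphism such that `X₁ ^ ±1 ↦ X₁ ^ ±1 ⊗ X₁ ^ ±1` and
`Yₙ ^ ± ↦ Yₙ ^ ± ⊗ 1 + 1 ⊗ Yₙ ^ ± + ∑_{n' + n'' = n} Yₙ' ^ ± ⊗ Yₙ'' ^ ±`. -/
def deltaW : W k →ₐ[k] W k ⊗[k] W k := (existsUnique_coproductW k).choose

theorem deltaW_spec : IsCoproductW k (deltaW k) := (existsUnique_coproductW k).choose_spec.1

theorem deltaW_eq : deltaW k = DW (yd_zero_zero (k := k)) :=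
  (deltaW_spec k).unique isCoproductW_DW

/-- The left `V`-module `M = V / V (X₀ - 1)`. -/
abbrev M : Type _ := V k ⧸ Ideal.span {X k 0 - 1}

/-- The projection from `V` to `M`. -/
def toM : V k →ₗ[k] M k := (Ideal.span {X k 0 - 1}).mkQ.restrictScalars k

/-- The map `W → M`, `w ↦ w · 1`. -/
def actOne : W k →ₗ[k] M k := (toM k).comp (inclW k).toLinearMap

/-- The unit `X₁` of `W`. -/
def WXu : (W k)ˣ where
  val := WX k 1
  inv := WX k (-1)
  val_inv := by rw [WX_mul, add_neg_cancel, WX_zero]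
  inv_val := by rw [WX_mul, neg_add_cancel, WX_zero]

theorem toM_eq_zero {v : V k} : toM k v = 0 ↔ ∃ u, u * (X k 0 - 1) = v := by
  rw [← Ideal.mem_span_singleton', ← Submodule.Quotient.mk_eq_zero]; rfl

theorem D_eq_of_toM_eq {Q : Type*} [Ring Q] [Algebra k Q] {x : Qˣ} {y : ℤ → Q} (hy : y 0 = x - 1)
    {u v : V k} (h : toM k u = toM k v) : D (k := k) hy u = D (k := k) hy v := by
  rw [← sub_eq_zero, ← map_sub, toM_eq_zero] at h
  obtain ⟨w, hw⟩ := h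
  rw [← sub_eq_zero, ← map_sub, ← hw, D_mul_X0_sub_one]

theorem actOne_bijective : Function.Bijective (actOne k) := by
  constructor
  · have hid : DW (k := k) (x := WXu k) (y := Yd k 0) Yd_zero_zero = AlgHom.id k (W k) := by
      have hY : ∀ a, DW (k := k) (x := WXu k) (y := Yd k 0) Yd_zero_zero (Yd k 0 a) = Yd k 0 a := by
        intro a
        have := D_Xp0 (k := k) (x := WXu k) (y := Yd k 0) Yd_zero_zero a
        rwa [← mul_one (Xp k 0 a), ← pow_zero (X k 0 - 1)] at this
      have h1 : DW (k := k) (x := WXu k) (y := Yd k 0) Yd_zero_zero (WX k 1) = WX k 1 := by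
        have h : WX k 1 = Yd k 0 0 + 1 := by rw [Yd_zero_zero, sub_add_cancel]
        rw [h, map_add, map_one, hY]
      have htop := eq_top_of_mem (AlgHom.equalizer
        (DW (k := k) (x := WXu k) (y := Yd k 0) Yd_zero_zero) (AlgHom.id k (W k))) (by
          refine left_inv_eq_right_inv (a := WX k 1) ?_ (WXu k).val_inv
          exact (congrArg (_ * ·) h1.symm).trans
            (by rw [← map_mul, WX_mul, neg_add_cancel, WX_zero, map_one])) hY
      refine AlgHom.ext fun w => ?_
      have : w ∈ AlgHom.equalizer (DW (k := k) (x := WXu k) (y := Yd k 0) Yd_zero_zero)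
        (AlgHom.id k (W k)) := by rw [htop]; trivial
      exact this
    intro w w' h
    have := D_eq_of_toM_eq k (x := WXu k) (y := Yd k 0) Yd_zero_zero h
    have e : ∀ u : W k, D (k := k) (x := WXu k) (y := Yd k 0) Yd_zero_zero (inclW k u) = u :=
      fun u => AlgHom.congr_fun hid u
    exact (e w).symm.trans (this.trans (e w'))
  · have key : ∀ g : FreeGroup (Fin 2), ∃ a b : V k,
        MonoidAlgebra.of k _ g - 1 = a * (X k 0 - 1) + b * (X k 1 - 1) := by
      have gen : ∀ i : Fin 2, ∃ a b : V k,
          MonoidAlgebra.of k _ (FreeGroup.of i) - 1 = a * (X k 0 - 1) + b * (X k 1 - 1) := by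
        intro i
        have hi : MonoidAlgebra.of k _ (FreeGroup.of i) = X k i := by rw [X, Xp, zpow_one]
        rw [hi]
        fin_cases i
        · exact ⟨1, 0, by simp⟩
        · exact ⟨0, 1, by simp⟩
      intro g
      induction g using FreeGroup.induction_on with
      | C1 => exact ⟨0, 0, by rw [map_one, sub_self, zero_mul, zero_mul, add_zero]⟩
      | of i => exact gen i
      | inv_of i _ =>
        obtain ⟨a, b, h⟩ := gen i
        refine ⟨-(MonoidAlgebra.of k _ (FreeGroup.of i)⁻¹ * a),
          -(MonoidAlgebra.of k _ (FreeGroup.of i)⁻¹ * b), ?_⟩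
        rw [neg_mul, neg_mul, mul_assoc, mul_assoc, ← neg_add, ← mul_add, ← h, mul_sub, ← map_mul,
          inv_mul_cancel, map_one, mul_one, neg_sub]
      | mul p q hp hq =>
        obtain ⟨a, b, h⟩ := hp
        obtain ⟨a', b', h'⟩ := hq
        refine ⟨MonoidAlgebra.of k _ p * a' + a, MonoidAlgebra.of k _ p * b' + b, ?_⟩
        have : MonoidAlgebra.of k _ (p * q) - 1 = MonoidAlgebra.of k _ p *
          (MonoidAlgebra.of k _ q - 1) + (MonoidAlgebra.of k (FreeGroup (Fin 2)) p - 1) := by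
          rw [map_mul, mul_sub, mul_one, sub_add_sub_cancel]
        rw [this, h, h']
        simp only [mul_add, add_mul, mul_assoc]
        abel
    intro m
    obtain ⟨v, rfl⟩ := Submodule.mkQ_surjective _ m
    change ∃ w, actOne k w = toM k v
    suffices h : toM k v ∈ LinearMap.range (actOne k) from h
    have h := sub_counit_induction (toM k) (LinearMap.range (actOne k)) (fun g => by
      obtain ⟨a, b, h⟩ := key g
      refine ⟨mkW (b * (X k 1 - 1)) (mul_X_sub_one_mem b), ?_⟩
      rw [h, map_add, (toM_eq_zero k).2 ⟨a, rfl⟩, zero_add]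
      rfl) (v := v - algebraMap k (V k) (Bialgebra.counitAlgHom k (V k) v)) (by
        rw [mem_augI, map_sub, AlgHom.commutes, Algebra.algebraMap_self, RingHom.id_apply,
          sub_self])
    rw [map_sub] at h
    have h2 : toM k (algebraMap k (V k) (Bialgebra.counitAlgHom k (V k) v)) ∈
      LinearMap.range (actOne k) := ⟨algebraMap k (W k) _, rfl⟩
    simpa using add_mem h h2

/-- The coproduct of `M`, given by `w · 1 ↦ Δ(w) · (1 ⊗ 1)` for `w` in `W`. -/
def deltaM : M k →ₗ[k] M k ⊗[k] M k :=
  ((TensorProduct.map (actOne k) (actOne k)).comp (deltaW k).toLinearMap).comp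
    (LinearEquiv.ofBijective (actOne k) (actOne_bijective k)).symm.toLinearMap

theorem deltaM_actOne (w : W k) :
    deltaM k (actOne k w) = TensorProduct.map (actOne k) (actOne k) (deltaW k w) := by
  have h : (LinearEquiv.ofBijective (actOne k) (actOne_bijective k)).symm (actOne k w) = w := by
    rw [LinearEquiv.symm_apply_eq]; rfl
  change TensorProduct.map (actOne k) (actOne k) (deltaW k
    ((LinearEquiv.ofBijective (actOne k) (actOne_bijective k)).symm (actOne k w))) = _
  rw [h]

/-- The filtration of `M` induced by the powers of the augmentation ideal. -/
def filM (n : ℕ) : Submodule k (M k) := ((augI k ^ n).restrictScalars k).map (toM k)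

theorem deltaM_mem (n : ℕ) (v : V k) (hv : v ∈ augI k ^ n) :
    deltaM k (toM k v) ∈ tensorFil (filM k) n := by
  let F : ℕ → Submodule k (W k) := fun n =>
    ((augI k ^ n).restrictScalars k).comap (inclW k).toLinearMap
  have hF : Antitone F := fun a b h => Submodule.comap_mono
    (fun x hx => Ideal.pow_le_pow_right h hx)
  have hFmul : ∀ i j, ∀ x ∈ F i, ∀ y ∈ F j, x * y ∈ F (i + j) := by
    intro i j x hx y hy
    change inclW k x * inclW k y ∈ augI k ^ (i + j)
    rw [Ideal.IsTwoSided.pow_add]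
    exact Ideal.mul_mem_mul hx hy
  have hF0 : ∀ x, x ∈ F 0 := by
    intro x
    change inclW k x ∈ augI k ^ 0
    rw [Submodule.pow_zero, Ideal.one_eq_top]
    trivial
  have hX : ∀ i, X k i - 1 ∈ augI k := fun i => by
    rw [X, Xp]; exact of_sub_one_mem _
  have hYd : ∀ j a, Yd k j a ∈ F (j + 1) := by
    intro j a
    change Xp k 0 a * (X k 0 - 1) ^ j * (X k 1 - 1) ∈ augI k ^ (j + 1)
    rw [Ideal.IsTwoSided.pow_add, Submodule.pow_one]
    exact Ideal.mul_mem_mul (Ideal.mul_mem_left _ _ (Ideal.pow_mem_pow (hX 0) j)) (hX 1)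
  have hyd : ∀ j a, yd (k := k) j a ∈ tensorFil F (j + 1) := by
    intro j a
    have hC : ∀ (s : Finset ℤ), ∑ b ∈ s, Yd k 0 b ⊗ₜ[k] Yd k j (a - b) ∈ tensorFil F (j + 1) :=
      fun s => sum_mem fun b _ => tmul_mem_tensorFil (i := 1) (j := j + 1) (by omega)
        (hYd 0 b) (hYd j _)
    refine sub_mem (sub_mem (add_mem ?_ ?_) (sum_mem fun i hi => ?_)) (sub_mem (hC _) (hC _))
    · exact tmul_mem_tensorFil (i := j + 1) (j := 0) (by omega) (hYd j a) (hF0 1)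
    · exact tmul_mem_tensorFil (i := 0) (j := j + 1) (by omega) (hF0 1) (hYd j a)
    · refine tmul_mem_tensorFil (i := j - 1 - i + 1) (j := i + 1) ?_ (hYd _ a) (hYd _ 1)
      have := Finset.mem_range.1 hi
      omega
  have hD := D_pow_mem (yd_zero_zero (k := k)) (tensorFil_anti F)
    (fun i j p hp q hq => mul_mem_tensorFil hFmul hp hq) (mem_tensorFil_zero hF0)
    (fun _ => rfl) yd_succ hyd n v hv
  obtain ⟨w, hw⟩ := (actOne_bijective k).2 (toM k v)
  have hw2 : D (k := k) (yd_zero_zero (k := k)) (inclW k w) = D (yd_zero_zero (k := k)) v :=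
    D_eq_of_toM_eq k (yd_zero_zero (k := k)) hw
  rw [← hw, deltaM_actOne, deltaW_eq, DW_apply, hw2]
  refine map_mem_tensorFil (fun i x hx => ?_) hD
  exact ⟨inclW k x, hx, rfl⟩

end Coproducts

/-! ### The group of the pairs `(μ, g)` -/

section Group

variable (k : Type*) [CommRing k]

/-- The completion `lim V / I ^ n` of the group algebra. -/
abbrev Vhat : Type _ := Cpl k (augI k)

/-- The filtration of the completed group algebra. -/
def filV (n : ℕ) : Submodule k (Vhat k) := (Cpl.fil k (augI k) n).restrictScalars k

/-- The generators of the free group, as elements of the completed group algebra. -/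
def Xhat (i : Fin 2) : Vhat k := Cpl.of k (augI k) (X k i)

theorem Xhat_sub_one_mem (i : Fin 2) : Xhat k i - 1 ∈ Cpl.fil k (augI k) 1 := by
  rw [Xhat, ← map_one (Cpl.of k (augI k)), ← map_sub]
  refine Cpl.of_mem_fil ?_
  rw [Submodule.pow_one]
  exact of_sub_one_mem _

/-- The map `V → V̂ ⊗ V̂` given by the coproduct of the group algebra, for which the elements of the
free group are group-like. -/
def comulV : V k →ₗ[k] Vhat k ⊗[k] Vhat k :=
  (TensorProduct.map (Cpl.of k (augI k)).toLinearMap (Cpl.of k (augI k)).toLinearMap).comp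
    (Bialgebra.comulAlgHom k (V k)).toLinearMap

theorem comul_mem (n : ℕ) : ∀ v ∈ augI k ^ n, Bialgebra.comulAlgHom k (V k) v ∈
    tensorFil (fun i => (augI k ^ i).restrictScalars k) n := by
  have hmul : ∀ i j, ∀ x ∈ (augI k ^ i).restrictScalars k, ∀ y ∈ (augI k ^ j).restrictScalars k,
      x * y ∈ (augI k ^ (i + j)).restrictScalars k := by
    intro i j x hx y hy
    rw [Submodule.restrictScalars_mem] at *
    rw [Ideal.IsTwoSided.pow_add]
    exact Ideal.mul_mem_mul hx hy
  have h0 : ∀ x, x ∈ (augI k ^ 0).restrictScalars k := by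
    intro x
    rw [Submodule.restrictScalars_mem, Submodule.pow_zero, Ideal.one_eq_top]
    trivial
  have one : ∀ v ∈ augI k, Bialgebra.comulAlgHom k (V k) v ∈
      tensorFil (fun i => (augI k ^ i).restrictScalars k) 1 := by
    intro v hv
    refine sub_counit_induction (Bialgebra.comulAlgHom k (V k)).toLinearMap _ (fun g => ?_) hv
    have hg : Bialgebra.comulAlgHom k (V k) (MonoidAlgebra.of k _ g) =
        MonoidAlgebra.of k _ g ⊗ₜ MonoidAlgebra.of k _ g := by
      simp [MonoidAlgebra.of_apply]
    have h1 : MonoidAlgebra.of k _ g - 1 ∈ (augI k ^ 1).restrictScalars k := by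
      rw [Submodule.restrictScalars_mem, Submodule.pow_one]
      exact of_sub_one_mem g
    have h2 : (Bialgebra.comulAlgHom k (V k)).toLinearMap (MonoidAlgebra.of k _ g - 1) =
        (MonoidAlgebra.of k _ g - 1) ⊗ₜ[k] MonoidAlgebra.of k _ g +
          1 ⊗ₜ[k] (MonoidAlgebra.of k _ g - 1) := by
      rw [AlgHom.toLinearMap_apply, map_sub, map_one, hg, TensorProduct.sub_tmul,
        TensorProduct.tmul_sub, Algebra.TensorProduct.one_def]
      abel
    rw [h2]
    exact add_mem (tmul_mem_tensorFil (i := 1) (j := 0) le_rfl h1 (h0 _))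
      (tmul_mem_tensorFil (i := 0) (j := 1) le_rfl (h0 _) h1)
  induction n with
  | zero => exact fun v _ => mem_tensorFil_zero h0 _
  | succ n ih =>
    intro v hv
    rw [Ideal.IsTwoSided.pow_add, Submodule.pow_one] at hv
    refine Submodule.mul_induction_on hv (fun a ha b hb => ?_) (fun a b ha hb => ?_)
    · rw [map_mul]; exact mul_mem_tensorFil hmul (ih a ha) (one b hb)
    · rw [map_add]; exact add_mem ha hb

theorem comulV_mem (n : ℕ) (v : V k) (hv : v ∈ augI k ^ n) :
    comulV k v ∈ tensorFil (filV k) n := by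
  have h : ∀ n, ∀ x ∈ (augI k ^ n).restrictScalars k,
      (Cpl.of k (augI k)).toLinearMap x ∈ filV k n := fun _ _ hx => Cpl.of_mem_fil hx
  exact map_mem_tensorFil h (comul_mem k n v hv)

/-- The coproduct of the completed group algebra. -/
def deltaV : Vhat k →ₗ[k] TSq (filV k) := TSq.extend (comulV k) (comulV_mem k)

variable {k}

/-- An element is group-like if its counit is `1` and its coproduct is `g ⊗ g`. -/
def IsGrouplike (g : Vhat k) : Prop :=
  g - 1 ∈ Cpl.fil k (augI k) 1 ∧ deltaV k g = TSq.of (filV k) (g ⊗ₜ g)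

variable (k)

/-- The set `k ^ × × G(V̂)`, where `G(V̂)` is the set of group-like elements of `V̂`; these elements
are invertible. -/
def GB : Type _ := {p : kˣ × (Vhat k)ˣ // IsGrouplike (p.2 : Vhat k)}

variable {k}

theorem lift_sub_one_mem {B : Type*} [Ring B] [Algebra k B] {J : Ideal B} [J.IsTwoSided]
    (u : Fin 2 → (Cpl k J)ˣ) (hu : ∀ i, (u i : Cpl k J) - 1 ∈ Cpl.fil k J 1)
    (g : FreeGroup (Fin 2)) : ((FreeGroup.lift u g : (Cpl k J)ˣ) : Cpl k J) - 1 ∈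
      Cpl.fil k J 1 := by
  induction g using FreeGroup.induction_on with
  | C1 => rw [map_one, Units.val_one, sub_self]; exact zero_mem _
  | of i => rw [FreeGroup.lift_apply_of]; exact hu i
  | inv_of i _ =>
    rw [map_inv, FreeGroup.lift_apply_of]
    have h : (((u i)⁻¹ : (Cpl k J)ˣ) : Cpl k J) - 1 =
        -((((u i)⁻¹ : (Cpl k J)ˣ) : Cpl k J) * ((u i : Cpl k J) - 1)) := by
      rw [mul_sub, Units.inv_mul, mul_one, neg_sub]
    rw [h]
    exact neg_mem (Ideal.mul_mem_left _ _ (hu i))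
  | mul a b ha hb =>
    have h : ((FreeGroup.lift u (a * b) : (Cpl k J)ˣ) : Cpl k J) - 1 =
        ((FreeGroup.lift u a : (Cpl k J)ˣ) : Cpl k J) *
          (((FreeGroup.lift u b : (Cpl k J)ˣ) : Cpl k J) - 1) +
          (((FreeGroup.lift u a : (Cpl k J)ˣ) : Cpl k J) - 1) := by
      rw [map_mul, Units.val_mul, mul_sub, mul_one, sub_add_sub_cancel]
    rw [h]
    exact add_mem (Ideal.mul_mem_left _ _ hb) ha

/-- The continuous algebra morphism with source `V̂` such that `X i ↦ u i`. -/
def substV {B : Type*} [Ring B] [Algebra k B] {J : Ideal B} [J.IsTwoSided]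
    (u : Fin 2 → (Cpl k J)ˣ) (hu : ∀ i, (u i : Cpl k J) - 1 ∈ Cpl.fil k J 1) :
    Vhat k →ₐ[k] Cpl k J :=
  Cpl.extend (MonoidAlgebra.lift k _ _ ((Units.coeHom (Cpl k J)).comp (FreeGroup.lift u))) (by
    intro v hv
    have h := sub_counit_induction (AlgHom.toLinearMap (MonoidAlgebra.lift k _ _
      ((Units.coeHom (Cpl k J)).comp (FreeGroup.lift u))))
      ((Cpl.fil k J 1).restrictScalars k) (fun g => ?_) hv
    · exact h
    rw [Submodule.restrictScalars_mem, AlgHom.toLinearMap_apply, map_sub, map_one, MonoidAlgebra.lift_of]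
    exact lift_sub_one_mem u hu g)

theorem substV_Xhat {B : Type*} [Ring B] [Algebra k B] {J : Ideal B} [J.IsTwoSided]
    (u : Fin 2 → (Cpl k J)ˣ) (hu : ∀ i, (u i : Cpl k J) - 1 ∈ Cpl.fil k J 1) (i : Fin 2) :
    substV u hu (Xhat k i) = u i := by
  refine (Cpl.extend_of _ _ (X k i)).trans ?_
  rw [X, Xp, zpow_one, MonoidAlgebra.lift_of, MonoidHom.comp_apply, FreeGroup.lift_apply_of]
  rfl

variable [Algebra ℚ k]

theorem expC_sub_one_mem {A : Type*} [Ring A] [Algebra k A] {I : Ideal A} [I.IsTwoSided]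
    (x : Cpl k I) (hx : x ∈ Cpl.fil k I 1) : (expC x hx : Cpl k I) - 1 ∈ Cpl.fil k I 1 := by
  have h : (expC x hx : Cpl k I) - 1 = psEval x hx (PowerSeries.exp k - 1) := by
    rw [map_sub, map_one]; rfl
  rw [h]
  exact psEval_mem_fil _ _ _ (by simp)

/-- The images `g X₀ ^ μ g⁻¹` and `X₁ ^ μ` of `X₀` and `X₁`. -/
def autGen (μ : k) (g : (Vhat k)ˣ) : Fin 2 → (Vhat k)ˣ :=
  ![g * powC (Xhat k 0) (Xhat_sub_one_mem k 0) μ * g⁻¹,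
    powC (Xhat k 1) (Xhat_sub_one_mem k 1) μ]

theorem autGen_sub_one_mem (μ : k) (g : (Vhat k)ˣ) (i : Fin 2) :
    (autGen μ g i : Vhat k) - 1 ∈ Cpl.fil k (augI k) 1 := by
  fin_cases i
  · change (g : Vhat k) * (powC (Xhat k 0) (Xhat_sub_one_mem k 0) μ : Vhat k) *
      ((g⁻¹ : (Vhat k)ˣ) : Vhat k) - 1 ∈ _
    have h : (g : Vhat k) * (powC (Xhat k 0) (Xhat_sub_one_mem k 0) μ : Vhat k) *
        ((g⁻¹ : (Vhat k)ˣ) : Vhat k) - 1 =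
        (g : Vhat k) * ((powC (Xhat k 0) (Xhat_sub_one_mem k 0) μ : Vhat k) - 1) *
          ((g⁻¹ : (Vhat k)ˣ) : Vhat k) := by
      rw [mul_sub, sub_mul, mul_one, Units.mul_inv]
    rw [h]
    exact Ideal.mul_mem_right _ _ (Ideal.mul_mem_left _ _ (expC_sub_one_mem _ _))
  · exact expC_sub_one_mem _ _

/-- The continuous algebra endomorphism of `V̂` such that `X₀ ↦ g X₀ ^ μ g⁻¹`, `X₁ ↦ X₁ ^ μ`. -/
def aut1 (p : kˣ × (Vhat k)ˣ) : Vhat k →ₐ[k] Vhat k :=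
  substV (autGen (p.1 : k) p.2) (autGen_sub_one_mem (p.1 : k) p.2)

/-- The linear endomorphism `v ↦ aut1 (v) g` of `V̂`. -/
def aut10 (p : kˣ × (Vhat k)ˣ) : Vhat k →ₗ[k] Vhat k :=
  (LinearMap.mulRight k (p.2 : Vhat k)).comp (aut1 p).toLinearMap

/-- The product `(μ, g) ⊛ (μ', g') = (μ μ', aut10 (g'))`. -/
def circ (p q : kˣ × (Vhat k)ˣ) : kˣ × (Vhat k)ˣ :=
  (p.1 * q.1, Units.map (aut1 p : Vhat k →* Vhat k) q.2 * p.2)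

theorem circ_snd (p q : kˣ × (Vhat k)ˣ) : ((circ p q).2 : Vhat k) = aut10 p q.2 := rfl

end Group

/-! ### Expansion in the words in `log X₀` and `log X₁` -/

section Words

variable (k : Type*) [CommRing k]

/-- The algebra of noncommutative polynomials in two letters `e₀`, `e₁`. -/
abbrev NC : Type _ := MonoidAlgebra k (FreeMonoid (Fin 2))

/-- The letters. -/
def letter (i : Fin 2) : NC k := MonoidAlgebra.of k _ (FreeMonoid.of i)

/-- The ideal of the noncommutative polynomials without constant term. -/
def augNC : Ideal (NC k) :=
  RingHom.ker (MonoidAlgebra.lift k k (FreeMonoid (Fin 2)) (FreeMonoid.lift fun _ => (0 : k)))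

instance : (augNC k).IsTwoSided := by unfold augNC; infer_instance

variable {k}

theorem letter_mem (i : Fin 2) : letter k i ∈ augNC k := by
  rw [augNC, RingHom.mem_ker, letter, MonoidAlgebra.lift_of, FreeMonoid.lift_eval_of]

theorem coeff_one_of_mem {f : NC k} (hf : f ∈ augNC k) : f.coeff 1 = 0 := by
  suffices h : ∀ f : NC k, MonoidAlgebra.lift k k (FreeMonoid (Fin 2))
      (FreeMonoid.lift fun _ => (0 : k)) f = f.coeff 1 by
    rw [← h]; exact hf
  intro f
  induction f using MonoidAlgebra.induction_linear with
  | zero => simp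
  | add a b ha hb => rw [map_add, ha, hb]; rfl
  | single w r =>
    rw [MonoidAlgebra.lift_single]
    induction w using FreeMonoid.casesOn with
    | one => simp
    | of_mul x xs => simp

theorem coeff_eq_zero {n : ℕ} {f : NC k} (hf : f ∈ augNC k ^ n) (w : FreeMonoid (Fin 2))
    (hw : w.length < n) : f.coeff w = 0 := by
  classical
  induction n generalizing f w with
  | zero => omega
  | succ n ih =>
    rw [Ideal.IsTwoSided.pow_add, Submodule.pow_one] at hf
    refine Submodule.mul_induction_on hf (fun a ha b hb => ?_) (fun a b ha hb => ?_)
    · rw [MonoidAlgebra.coeff_mul]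
      refine Finset.sum_eq_zero fun u _ => Finset.sum_eq_zero fun v _ => ?_
      dsimp only
      split_ifs with h
      · rcases Nat.lt_or_ge u.length n with hu | hu
        · rw [ih ha u hu, zero_mul]
        · have hv : v = 1 := by
            rw [← FreeMonoid.length_eq_zero]
            rw [← h, FreeMonoid.length_mul] at hw
            omega
          rw [hv, coeff_one_of_mem hb, mul_zero]
      · rfl
    · rw [MonoidAlgebra.coeff_add, Finsupp.add_apply, ha, hb, add_zero]

/-- The coefficient of a word in a noncommutative formal power series. -/
def coeffNC (w : FreeMonoid (Fin 2)) : Cpl k (augNC k) →ₗ[k] k :=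
  ((Submodule.liftQ ((augNC k ^ (w.length + 1)).restrictScalars k)
    ((Finsupp.lapply w).comp (MonoidAlgebra.coeffLinearEquiv k).toLinearMap)
    (fun _ hf => coeff_eq_zero hf w (Nat.lt_succ_self _))).comp
      (Submodule.Quotient.restrictScalarsEquiv k (augNC k ^ (w.length + 1))).symm.toLinearMap).comp
        (Cpl.proj k (augNC k) (w.length + 1)).toLinearMap

theorem coeffNC_of (w : FreeMonoid (Fin 2)) (f : NC k) :
    coeffNC w (Cpl.of k (augNC k) f) = f.coeff w := rfl

theorem letter_mem_fil (i : Fin 2) : Cpl.of k (augNC k) (letter k i) ∈ Cpl.fil k (augNC k) 1 :=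
  Cpl.of_mem_fil (by rw [Submodule.pow_one]; exact letter_mem i)

variable [Algebra ℚ k]

variable (k)

/-- The algebra morphism from `V̂` to the algebra of noncommutative formal power series such that
`X i ↦ exp (e i)`, that is, `log (X i) ↦ e i`. -/
def expand : Vhat k →ₐ[k] Cpl k (augNC k) :=
  substV (fun i => expC (Cpl.of k (augNC k) (letter k i)) (letter_mem_fil i))
    (fun _ => expC_sub_one_mem _ _)

variable {k}

/-- The coefficient `(g | w)` of the word `w` in `log X₀`, `log X₁` in the expansion of `g`. The
entries `0`, `1` of the list stand for the letters `log X₀`, `log X₁`. -/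
def coeffWord (g : Vhat k) (w : List (Fin 2)) : k := coeffNC (FreeMonoid.ofList w) (expand k g)

/-- The series `∑_{n ≥ 1} (-1) ^ (n + 1) (g | (log X₀) ^ (n - 1) log X₁) t ^ n / n`. -/
def logGamma (g : Vhat k) : k⟦X⟧ := PowerSeries.mk fun n =>
  if n = 0 then 0 else
    ((-1) ^ (n + 1) / n : ℚ) • coeffWord g (List.replicate (n - 1) 0 ++ [1])

theorem hasSubst_logGamma (g : Vhat k) : PowerSeries.HasSubst (logGamma g) :=
  PowerSeries.HasSubst.of_constantCoeff_zero' (by simp [logGamma])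

/-- The invertible series `exp (∑_{n ≥ 1} (-1) ^ (n + 1) (g | (log X₀) ^ (n - 1) log X₁) t ^ n / n)`. -/
def Gamma (g : Vhat k) : k⟦X⟧ˣ :=
  Units.map (PowerSeries.substAlgHom (R := k) (hasSubst_logGamma g) : k⟦X⟧ →* k⟦X⟧) (expUnit k)

theorem Gamma_val (g : Vhat k) :
    (Gamma g : k⟦X⟧) = (PowerSeries.exp k).subst (logGamma g) := by
  rw [← PowerSeries.coe_substAlgHom (hasSubst_logGamma g)]; rfl

/-- The element obtained by substituting `- log X₁` in the inverse of the series `Gamma g`. -/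
def cocycle (g : Vhat k) : Vhat k :=
  psEval (-logC (Xhat k 1) (Xhat_sub_one_mem k 1)) (neg_mem (logC_mem _ _))
    ((Gamma g)⁻¹ : k⟦X⟧ˣ)

end Words

/-! ### The completed module and its coproduct -/

section Module

variable (k : Type*) [CommRing k]

/-- The left `V̂`-module `M̂ = V̂ / V̂ (X₀ - 1)`. -/
abbrev Mhat : Type _ := Vhat k ⧸ Ideal.span {Xhat k 0 - 1}

/-- The projection from `V̂` to `M̂`, that is, `v ↦ v · 1`. -/
def toMhat : Vhat k →ₗ[k] Mhat k := (Ideal.span {Xhat k 0 - 1}).mkQ.restrictScalars k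

theorem toMhat_smul (v w : Vhat k) : v • toMhat k w = toMhat k (v * w) := rfl

theorem toMhat_eq_zero {v : Vhat k} : toMhat k v = 0 ↔ ∃ u, u * (Xhat k 0 - 1) = v := by
  rw [← Ideal.mem_span_singleton', ← Submodule.Quotient.mk_eq_zero]; rfl

/-- The linear map on `M̂` induced by a linear map on `V̂`. -/
def descend {L : Type*} [AddCommGroup L] [Module k L] (f : Vhat k →ₗ[k] L)
    (hf : ∀ u, f (u * (Xhat k 0 - 1)) = 0) : Mhat k →ₗ[k] L :=
  (Submodule.liftQ ((Ideal.span {Xhat k 0 - 1}).restrictScalars k) f (by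
    intro v hv
    obtain ⟨u, rfl⟩ := Ideal.mem_span_singleton'.1 hv
    exact hf u)).comp
      (Submodule.Quotient.restrictScalarsEquiv k (Ideal.span {Xhat k 0 - 1})).symm.toLinearMap

theorem descend_toMhat {L : Type*} [AddCommGroup L] [Module k L] (f : Vhat k →ₗ[k] L)
    (hf : ∀ u, f (u * (Xhat k 0 - 1)) = 0) (v : Vhat k) :
    descend k f hf (toMhat k v) = f v := rfl

/-- The filtration of `M̂`. -/
def filMhat (n : ℕ) : Submodule k (Mhat k) := (filV k n).map (toMhat k)

/-- The canonical map from `M` to `M̂`. -/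
def ofM : M k →ₗ[k] Mhat k :=
  (Submodule.liftQ ((Ideal.span {X k 0 - 1}).restrictScalars k)
    ((toMhat k).comp (Cpl.of k (augI k)).toLinearMap) (by
      intro v hv
      obtain ⟨u, rfl⟩ := Ideal.mem_span_singleton'.1 hv
      refine (toMhat_eq_zero k).2 ⟨Cpl.of k (augI k) u, ?_⟩
      rw [AlgHom.toLinearMap_apply, map_mul, map_sub, map_one]
      rfl)).comp
      (Submodule.Quotient.restrictScalarsEquiv k (Ideal.span {X k 0 - 1})).symm.toLinearMap

theorem ofM_toM (v : V k) : ofM k (toM k v) = toMhat k (Cpl.of k (augI k) v) := rfl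

/-- The coproduct of `M`, composed with the maps from `V` to `M` and from `M` to `M̂`. -/
def deltaVM : V k →ₗ[k] Mhat k ⊗[k] Mhat k :=
  ((TensorProduct.map (ofM k) (ofM k)).comp (deltaM k)).comp (toM k)

theorem deltaVM_mem (n : ℕ) (v : V k) (hv : v ∈ augI k ^ n) :
    deltaVM k v ∈ tensorFil (filMhat k) n := by
  have h : ∀ n, ∀ x ∈ filM k n, ofM k x ∈ filMhat k n := by
    rintro n _ ⟨v, hv, rfl⟩
    exact ⟨Cpl.of k (augI k) v, Cpl.of_mem_fil hv, rfl⟩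
  exact map_mem_tensorFil h (deltaM_mem k n v hv)

/-- The coproduct of `M̂`, with values in the completed tensor square: the continuous extension of
the coproduct of `M`. -/
def deltaMhat : Mhat k →ₗ[k] TSq (filMhat k) :=
  descend k (TSq.extend (deltaVM k) (deltaVM_mem k)) (fun u => by
    refine Subtype.ext (funext fun n => ?_)
    obtain ⟨a, ha⟩ := Ideal.Quotient.mk_surjective (Cpl.proj k (augI k) n u)
    have h : Cpl.proj k (augI k) n (u * (Xhat k 0 - 1)) =
        Ideal.Quotient.mk (augI k ^ n) (a * (X k 0 - 1)) := by
      rw [map_mul, map_mul, ha, map_sub, map_sub, map_one, map_one]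
      rfl
    rw [TSq.extend_apply _ _ n _ _ h]
    have h0 : deltaVM k (a * (X k 0 - 1)) = 0 := by
      change TensorProduct.map (ofM k) (ofM k) (deltaM k (toM k (a * (X k 0 - 1)))) = 0
      rw [(toM_eq_zero k).2 ⟨a, rfl⟩, map_zero, map_zero]
    rw [h0, map_zero]
    rfl)

theorem deltaMhat_ofM (m : M k) : deltaMhat k (ofM k m) =
    TSq.of (filMhat k) (TensorProduct.map (ofM k) (ofM k) (deltaM k m)) := by
  obtain ⟨v, rfl⟩ := Submodule.mkQ_surjective _ m
  exact Subtype.ext (funext fun n => TSq.extend_apply (deltaVM k) (deltaVM_mem k) n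
    (Cpl.of k (augI k) v) v rfl)

variable {k} [Algebra ℚ k]

/-- The linear endomorphism `v · 1 ↦ aut10 (v) · 1` of `M̂`. -/
def autM (p : kˣ × (Vhat k)ˣ) : Mhat k →ₗ[k] Mhat k :=
  descend k ((toMhat k).comp (aut10 p)) (by
    intro u
    obtain ⟨c, hc⟩ := powC_sub_one (Xhat k 0) (Xhat_sub_one_mem k 0) (p.1 : k)
    refine (toMhat_eq_zero k).2 ⟨aut1 p u * p.2 * c, ?_⟩
    have h0 : aut1 p (Xhat k 0) = (p.2 : Vhat k) *
        (powC (Xhat k 0) (Xhat_sub_one_mem k 0) (p.1 : k) : Vhat k) *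
          ((p.2⁻¹ : (Vhat k)ˣ) : Vhat k) := substV_Xhat _ _ 0
    change _ = aut1 p (u * (Xhat k 0 - 1)) * p.2
    rw [mul_assoc, ← hc, map_mul, map_sub, map_one, h0, mul_assoc, mul_assoc, sub_mul, one_mul,
      Units.inv_mul_cancel_right, mul_sub, mul_one])

theorem autM_toMhat (p : kˣ × (Vhat k)ˣ) (v : Vhat k) :
    autM p (toMhat k v) = toMhat k (aut10 p v) := rfl

/-- The composition of `autM` with the action of the cocycle. -/
def gammaAutM (p : kˣ × (Vhat k)ˣ) : Mhat k →ₗ[k] Mhat k :=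
  (Algebra.lsmul k k (Mhat k) (cocycle (p.2 : Vhat k))).comp (autM p)

theorem gammaAutM_toMhat (p : kˣ × (Vhat k)ˣ) (v : Vhat k) :
    gammaAutM p (toMhat k v) = toMhat k (cocycle (p.2 : Vhat k) * (aut1 p v * p.2)) := rfl

theorem aut1_mem (p : kˣ × (Vhat k)ˣ) {n : ℕ} {v : Vhat k} (hv : v ∈ Cpl.fil k (augI k) n) :
    aut1 p v ∈ Cpl.fil k (augI k) n := by
  unfold aut1 substV
  exact Cpl.extend_mem_fil _ _ hv

theorem gammaAutM_mem (p : kˣ × (Vhat k)ˣ) (n : ℕ) :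
    ∀ x ∈ filMhat k n, gammaAutM p x ∈ filMhat k n := by
  rintro _ ⟨v, hv, rfl⟩
  refine ⟨cocycle (p.2 : Vhat k) * (aut1 p v * p.2), ?_, rfl⟩
  exact Ideal.mul_mem_left _ _ (Ideal.mul_mem_right _ _ (aut1_mem p hv))

end Module

/-! ### The subsets of the group -/

section Subsets

variable (k : Type*) [CommRing k] [Algebra ℚ k]

/-- The set of the `(μ, g)` such that `(g | log X₀) = (g | log X₁) = 0` and
`μ ^ 2 = 1 + 24 (g | log X₀ log X₁)`. -/
def GBquad : Set (GB k) :=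
  {p | coeffWord (p.1.2 : Vhat k) [0] = 0 ∧ coeffWord (p.1.2 : Vhat k) [1] = 0 ∧
    (p.1.1 : k) ^ 2 = 1 + 24 * coeffWord (p.1.2 : Vhat k) [0, 1]}

/-- The stabilizer of the coproduct of `M̂`. -/
def StabDeltaM : Set (GB k) :=
  {p | (TSq.map (gammaAutM p.1) (gammaAutM_mem p.1)).comp (deltaMhat k) =
    (deltaMhat k).comp (gammaAutM p.1)}

/-- The set `DMR`, the intersection of the two preceding ones. -/
def DMRB : Set (GB k) := GBquad k ∩ StabDeltaM k

end Subsets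

end BettiDMR

end

/-! Group law. Everything rests on the identity `aut1 (p ⊛ q) = aut1 p ∘ aut1 q`, which can be
tested on `X₀` and `X₁` because filtered algebra endomorphisms of `V̂` are determined there;
associativity is then formal (`aut1_circ`, `circ_assoc`). The product preserves group-like elements
because `aut1 p` sends `X₀`, `X₁` to group-like elements: a power of a group-like element is again
group-like, its logarithm being primitive (`IsGrouplike.powC`, `IsGrouplike.map`). For inverses one
factors `(μ, g) = (1, g) ⊛ (μ, 1)`. The second factor has inverse `(μ⁻¹, 1)`. For the first, `aut1
(1, g)` is unipotent for the filtration, since `g X₀ g⁻¹ - X₀` lies in `F²`; hence it is bijective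
and reflects group-likeness, and the preimage of `g⁻¹` supplies the inverse (`aut1_unipotent`,
`isGrouplike_of_map`, `exists_circ_eq_one`).

Subgroup. The maps `autM` compose well on the whole group, but the twist by `Γ_g⁻¹(-log X₁)` does so
only if the coefficients `(g | (log X₀)ⁿ⁻¹ log X₁)` behave additively. These coefficients, with
those of `(log X₀)ⁿ`, are the entries of a triangular 2×2 representation `wordMat` over `k⟦X⟧`,
given by `log X₀ ↦ diag(X, 0)` and `log X₁ ↦ X E₀₁`. If `g` is group-like and `(g | log X₀) = 0`,
all `(g | (log X₀)ⁿ)` with `n ≥ 1` vanish, so `wordMat g` is upper unitriangular. Such matrices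
commute, so conjugation by `g` is invisible on the matrices of such elements and `aut1 (μ, g)` acts
on them through the rescaling `X ↦ μ X`. Therefore `log Γ` of `(μ, g) ⊛ (μ', g')` is `log Γ_g(t) +
log Γ_g'(μ t)` (`wordMat_circ`, `logGamma_circ`).

As `aut1 (μ, g)` multiplies `log X₁` by `μ`, this is the cocycle relation for the twisting factor
(`cocycle_circ`), so the twisted maps compose (`gammaAutM_circ`) and the stabilizer condition passes
to products and inverses. In degrees 1 and 2 the same additivity preserves the conditions of
`GBquad`: `(μ μ')² = μ² (1 + 24 c') = 1 + 24 (c + μ² c')`. -/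

noncomputable section

namespace BettiDMR

/-! ### Exponential, logarithm and powers in completed algebras -/

section ExpLog

variable {k : Type*} [CommRing k]

/-- Two algebra morphisms with source `k⟦X⟧` which agree on `X` are equal if the target is separated
for the powers of the image of `X`. -/
theorem powerSeries_algHom_ext {A : Type*} [Ring A] [Algebra k A] {φ ψ : k⟦X⟧ →ₐ[k] A}
    (hX : φ PowerSeries.X = ψ PowerSeries.X)
    (h : ∀ y : A, (∀ n : ℕ, ∃ u, y = φ PowerSeries.X ^ n * u) → y = 0) : φ = ψ := by
  have hp : ∀ p : Polynomial k, φ (p : k⟦X⟧) = ψ (p : k⟦X⟧) := fun p => by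
    have : φ.comp (Polynomial.coeToPowerSeries.algHom k) =
        ψ.comp (Polynomial.coeToPowerSeries.algHom k) :=
      Polynomial.algHom_ext (by simpa using hX)
    simpa using AlgHom.congr_fun this p
  refine AlgHom.ext fun f => sub_eq_zero.1 (h _ fun n => ?_)
  -- The two maps agree on the polynomial `trunc n f`, so only the remainder, a multiple of `X ^ n`,
  -- contributes to the difference.
  obtain ⟨q, hq⟩ : (PowerSeries.X : k⟦X⟧) ^ n ∣ f - (PowerSeries.trunc n f : k⟦X⟧) := by
    refine PowerSeries.X_pow_dvd_iff.2 fun m hm => ?_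
    rw [map_sub, Polynomial.coeff_coe, PowerSeries.coeff_trunc, if_pos hm, sub_self]
  refine ⟨φ q - ψ q, ?_⟩
  rw [eq_add_of_sub_eq hq, map_add, map_add, hp, add_sub_add_right_eq_sub, map_mul, map_mul,
    map_pow, map_pow, ← hX, mul_sub]

theorem powerSeries_algHom_ext_of_pow_eq_zero {A : Type*} [Ring A] [Algebra k A]
    {φ ψ : k⟦X⟧ →ₐ[k] A} (hX : φ PowerSeries.X = ψ PowerSeries.X) {n : ℕ}
    (hn : φ PowerSeries.X ^ n = 0) : φ = ψ :=
  powerSeries_algHom_ext hX fun y hy => by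
    obtain ⟨u, rfl⟩ := hy n
    rw [hn, zero_mul]

theorem eq_zero_of_mem_fil {A : Type*} [Ring A] [Algebra k A] {I : Ideal A} [I.IsTwoSided]
    {x : Cpl k I} (h : ∀ n, x ∈ Cpl.fil k I n) : x = 0 :=
  Cpl.ext fun n => by rw [map_zero]; exact h n

variable {A : Type*} [Ring A] [Algebra k A] {I : Ideal A} [I.IsTwoSided]

/-- Continuity of `φ` is automatic: multiples of `X ^ n` go to multiples of `x ^ n`, which lie in
`Fⁿ`. This uniqueness yields the compatibility of evaluation with algebra maps, substitution and
rescaling. -/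
theorem algHom_eq_psEval {x : Cpl k I} (hx : x ∈ Cpl.fil k I 1) {φ : k⟦X⟧ →ₐ[k] Cpl k I}
    (h : φ PowerSeries.X = x) : φ = psEval x hx :=
  powerSeries_algHom_ext (by rw [h, psEval_X]) fun y hy => eq_zero_of_mem_fil fun n => by
    obtain ⟨u, rfl⟩ := hy n
    rw [h]
    exact Ideal.mul_mem_right _ _ (Cpl.pow_mem_fil hx n)

theorem map_psEval {B : Type*} [Ring B] [Algebra k B] {J : Ideal B} [J.IsTwoSided]
    (θ : Cpl k I →ₐ[k] Cpl k J) {x : Cpl k I} (hx : x ∈ Cpl.fil k I 1)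
    (hx' : θ x ∈ Cpl.fil k J 1) (f : k⟦X⟧) : θ (psEval x hx f) = psEval (θ x) hx' f :=
  AlgHom.congr_fun (algHom_eq_psEval hx' (φ := θ.comp (psEval x hx))
    (by rw [AlgHom.comp_apply, psEval_X])) f

theorem psEval_subst {x : Cpl k I} (hx : x ∈ Cpl.fil k I 1) {h : k⟦X⟧}
    (hh : PowerSeries.constantCoeff h = 0) (f : k⟦X⟧) :
    psEval x hx (f.subst h) = psEval (psEval x hx h) (psEval_mem_fil x hx h hh) f := by
  have hs : PowerSeries.HasSubst h := PowerSeries.HasSubst.of_constantCoeff_zero' hh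
  have := AlgHom.congr_fun (algHom_eq_psEval (psEval_mem_fil x hx h hh)
    (φ := (psEval x hx).comp (PowerSeries.substAlgHom (R := k) hs))
    (by rw [AlgHom.comp_apply, PowerSeries.substAlgHom_X hs])) f
  rwa [AlgHom.comp_apply, PowerSeries.coe_substAlgHom] at this

theorem psEval_rescale {x : Cpl k I} (hx : x ∈ Cpl.fil k I 1) {μ : k}
    (hx' : μ • x ∈ Cpl.fil k I 1) (f : k⟦X⟧) :
    psEval x hx (PowerSeries.rescale μ f) = psEval (μ • x) hx' f := by
  rw [PowerSeries.rescale_eq_subst, psEval_subst hx (by simp)]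
  congr 2
  rw [map_smul, psEval_X]

theorem nilEval_X {a : A} {n : ℕ} (ha : a ^ n = 0) : nilEval (k := k) a n ha PowerSeries.X = a := by
  rw [nilEval_apply]
  simp only [PowerSeries.coeff_X, ite_smul, one_smul, zero_smul, Finset.sum_ite_eq',
    Finset.mem_range, pow_one]
  split_ifs with h
  · rfl
  · exact (pow_one a).symm.trans (pow_eq_zero_of_le (not_lt.1 h) ha) |>.symm

/-- Lets one evaluate series in targets that are not completions, such as quotients of `V̂ ⊗ V̂` or
matrix algebras, as long as the image of `x` is nilpotent. -/
theorem map_psEval_eq_nilEval {B : Type*} [Ring B] [Algebra k B] (θ : Cpl k I →ₐ[k] B)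
    {x : Cpl k I} (hx : x ∈ Cpl.fil k I 1) {n : ℕ} (hn : θ x ^ n = 0) (f : k⟦X⟧) :
    θ (psEval x hx f) = nilEval (θ x) n hn f :=
  AlgHom.congr_fun (powerSeries_algHom_ext_of_pow_eq_zero
    (φ := θ.comp (psEval x hx)) (ψ := nilEval (θ x) n hn) (n := n)
    (by rw [AlgHom.comp_apply, psEval_X, nilEval_X]) (by rwa [AlgHom.comp_apply, psEval_X])) f

variable [Algebra ℚ k]

/-- Both sides have constant term `0` and derivative `1`; over a `ℚ`-algebra these two data
determine a series. -/
theorem log_subst_exp_sub_one :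
    (PowerSeries.log k).subst (PowerSeries.exp k - 1) = (PowerSeries.X : k⟦X⟧) := by
  have : IsAddTorsionFree k := IsAddTorsionFree.of_module_rat k
  have hs := PowerSeries.HasSubst.exp_sub_one (A := k)
  refine PowerSeries.derivative.ext ?_ ?_
  · rw [PowerSeries.derivative_subst hs, PowerSeries.deriv_log, map_sub,
      PowerSeries.derivative_exp, PowerSeries.derivative_one, sub_zero, PowerSeries.derivative_X]
    -- The derivative of `log (1 + X)` is the geometric series inverse to `1 + X`; substituting `exp
    -- - 1` for `X` makes it inverse to `exp`, which is the other factor of the chain rule.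
    have h1 : (PowerSeries.mk fun n => algebraMap ℚ k ((-1) ^ n)) * (1 + PowerSeries.X) = 1 := by
      ext n
      rw [mul_add, mul_one, map_add]
      cases n with
      | zero => simp
      | succ n => simp [PowerSeries.coeff_succ_mul_X, pow_succ, PowerSeries.coeff_one]
    have h2 := congrArg (PowerSeries.subst (PowerSeries.exp k - 1)) h1
    rw [PowerSeries.subst_mul hs, PowerSeries.subst_add hs, PowerSeries.subst_X hs,
      ← PowerSeries.coe_substAlgHom hs, map_one, add_sub_cancel] at h2
    rw [← PowerSeries.coe_substAlgHom hs]
    exact h2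
  · refine (PowerSeries.constantCoeff_subst_eq_zero (τ := Unit) ?_ _
      PowerSeries.constantCoeff_log).trans PowerSeries.constantCoeff_X.symm
    change PowerSeries.constantCoeff _ = 0
    simp

/-- The series `exp - 1` has linear coefficient `1`, hence a compositional inverse `Q` on the right;
`log` is an inverse on the left, so the two coincide. -/
theorem exp_subst_log : (PowerSeries.exp k).subst (PowerSeries.log k) =
    (1 + PowerSeries.X : k⟦X⟧) := by
  have hs := PowerSeries.HasSubst.exp_sub_one (A := k)
  have h0 : PowerSeries.constantCoeff (PowerSeries.exp k - 1) = 0 := by simp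
  have h1 : IsUnit (PowerSeries.coeff 1 (PowerSeries.exp k - 1)) := by
    simp [PowerSeries.coeff_one]
  set Q := (PowerSeries.exp k - 1).substInvOfIsUnit h1 with hQdef
  have hQ : PowerSeries.HasSubst Q := PowerSeries.HasSubst.substInvOfIsUnit _ h1
  have e1 : (PowerSeries.exp k - 1).subst Q = PowerSeries.X :=
    PowerSeries.subst_substInvOfIsUnit_right _ h0 h1
  have e2 : Q = PowerSeries.log k := by
    have := PowerSeries.subst_comp_subst_apply hs hQ (PowerSeries.log k)
    rw [log_subst_exp_sub_one, e1, PowerSeries.X_subst, PowerSeries.subst_X hQ] at this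
    exact this
  rw [← e2, ← e1, PowerSeries.subst_sub hQ, ← PowerSeries.coe_substAlgHom hQ, map_one,
    add_sub_cancel]

theorem logC_expC (x : Cpl k I) (hx : x ∈ Cpl.fil k I 1)
    (h : (expC x hx : Cpl k I) - 1 ∈ Cpl.fil k I 1) : logC (expC x hx : Cpl k I) h = x := by
  have h0 : PowerSeries.constantCoeff (PowerSeries.exp k - 1) = 0 := by simp
  have h1 := psEval_subst hx h0 (PowerSeries.log k)
  rw [log_subst_exp_sub_one, psEval_X] at h1
  refine Eq.trans ?_ h1.symm
  rw [logC]
  congr 2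
  rw [map_sub, map_one]
  rfl

theorem expC_logC (a : Cpl k I) (ha : a - 1 ∈ Cpl.fil k I 1)
    (h : logC a ha ∈ Cpl.fil k I 1) : (expC (logC a ha) h : Cpl k I) = a := by
  have h1 := psEval_subst ha PowerSeries.constantCoeff_log (PowerSeries.exp k)
  rw [exp_subst_log, map_add, map_one, psEval_X, add_sub_cancel] at h1
  exact h1.symm

theorem powC_one (a : Cpl k I) (ha : a - 1 ∈ Cpl.fil k I 1) : (powC a ha 1 : Cpl k I) = a := by
  simp only [powC, one_smul]
  exact expC_logC a ha _

theorem powC_powC (a : Cpl k I) (ha : a - 1 ∈ Cpl.fil k I 1) (μ ν : k)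
    (h : (powC a ha μ : Cpl k I) - 1 ∈ Cpl.fil k I 1) :
    powC (powC a ha μ : Cpl k I) h ν = powC a ha (μ * ν) := by
  have e : logC (powC a ha μ : Cpl k I) h = μ • logC a ha := logC_expC _ _ _
  simp only [powC] at e ⊢
  congr 1
  rw [e, smul_smul, mul_comm]

theorem map_logC {B : Type*} [Ring B] [Algebra k B] {J : Ideal B} [J.IsTwoSided]
    (θ : Cpl k I →ₐ[k] Cpl k J) {a : Cpl k I} (ha : a - 1 ∈ Cpl.fil k I 1)
    (ha' : θ a - 1 ∈ Cpl.fil k J 1) : θ (logC a ha) = logC (θ a) ha' := by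
  have h : θ (a - 1) = θ a - 1 := by rw [map_sub, map_one]
  rw [logC, map_psEval θ ha (by rwa [h])]
  simp only [h]
  rfl

theorem map_expC {B : Type*} [Ring B] [Algebra k B] {J : Ideal B} [J.IsTwoSided]
    (θ : Cpl k I →ₐ[k] Cpl k J) {x : Cpl k I} (hx : x ∈ Cpl.fil k I 1)
    (hx' : θ x ∈ Cpl.fil k J 1) : θ (expC x hx) = expC (θ x) hx' :=
  map_psEval θ hx hx' _

theorem map_powC {B : Type*} [Ring B] [Algebra k B] {J : Ideal B} [J.IsTwoSided]
    (θ : Cpl k I →ₐ[k] Cpl k J) {a : Cpl k I} (ha : a - 1 ∈ Cpl.fil k I 1) {b : Cpl k J}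
    (hb : b - 1 ∈ Cpl.fil k J 1) (h : θ a = b) (μ : k) :
    θ (powC a ha μ) = powC b hb μ := by
  subst h
  have h1 : θ (μ • logC a ha) = μ • logC (θ a) hb := by rw [map_smul, map_logC θ ha hb]
  rw [powC, map_expC θ _ (by rw [h1]; exact Submodule.smul_of_tower_mem _ _ (logC_mem _ _))]
  simp only [h1]
  rfl

theorem nilEval_exp_add {a b : A} (hab : Commute a b) {l m n : ℕ} (ha : a ^ l = 0) (hb : b ^ m = 0)
    (h : (a + b) ^ n = 0) : nilEval (k := k) (a + b) n h (PowerSeries.exp k) =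
      nilEval a l ha (PowerSeries.exp k) * nilEval b m hb (PowerSeries.exp k) := by
  -- Restricting scalars to `ℚ` identifies the evaluated series with `IsNilpotent.exp`, for which
  -- the addition formula is available.
  let _ : Module ℚ A := Module.compHom A (algebraMap ℚ k)
  have e : ∀ (c : A) (n : ℕ) (hc : c ^ n = 0),
      nilEval (k := k) c n hc (PowerSeries.exp k) = IsNilpotent.exp c := by
    intro c n hc
    rw [IsNilpotent.exp_eq_sum hc, nilEval_apply]
    refine Finset.sum_congr rfl fun i _ => ?_
    rw [PowerSeries.coeff_exp, one_div]
    rfl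
  rw [e, e, e, IsNilpotent.exp_add_of_commute hab ⟨l, ha⟩ ⟨m, hb⟩]

/-- The logarithm recovers the argument: `f ↦ f(exp a - 1)` is an algebra map determined by `exp a`,
and it sends `log` to `a`. -/
theorem nilEval_exp_injective {a b : A} {m n : ℕ} (ha : a ^ m = 0) (hb : b ^ n = 0)
    (h : nilEval (k := k) a m ha (PowerSeries.exp k) = nilEval b n hb (PowerSeries.exp k)) :
    a = b := by
  have hs := PowerSeries.HasSubst.exp_sub_one (A := k)
  have h1 := powerSeries_algHom_ext_of_pow_eq_zero (n := m)
    (φ := (nilEval (k := k) a m ha).comp (PowerSeries.substAlgHom (R := k) hs))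
    (ψ := (nilEval (k := k) b n hb).comp (PowerSeries.substAlgHom (R := k) hs))
    (by
      rw [AlgHom.comp_apply, AlgHom.comp_apply, PowerSeries.substAlgHom_X hs, map_sub, map_sub, h,
        map_one, map_one])
    (by
      rw [AlgHom.comp_apply, PowerSeries.substAlgHom_X hs]
      obtain ⟨e, he⟩ := PowerSeries.X_dvd_iff.2
        (show PowerSeries.constantCoeff (PowerSeries.exp k - 1) = 0 by simp)
      rw [← map_pow, he, mul_pow, map_mul, map_pow, nilEval_X, ha, zero_mul])
  have h2 := AlgHom.congr_fun h1 (PowerSeries.log k)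
  rwa [AlgHom.comp_apply, AlgHom.comp_apply, PowerSeries.coe_substAlgHom, log_subst_exp_sub_one,
    nilEval_X, nilEval_X] at h2

theorem expC_add {x y : Cpl k I} (hx : x ∈ Cpl.fil k I 1) (hy : y ∈ Cpl.fil k I 1)
    (h : Commute x y) : expC (x + y) (add_mem hx hy) = expC x hx * expC y hy := by
  refine Units.ext (Cpl.ext fun n => ?_)
  rw [Units.val_mul, map_mul]
  have hxy := proj_pow_eq_zero (add_mem hx hy) n
  have h2 := nilEval_exp_add (k := k) (h.map (Cpl.proj k I n)) (proj_pow_eq_zero hx n)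
    (proj_pow_eq_zero hy n) (by rw [← map_add]; exact hxy)
  rw [nilEval_apply, nilEval_apply, nilEval_apply, ← map_add] at h2
  exact h2

end ExpLog

/-! ### Group-like elements of `V̂` -/

section Grouplike

variable {k : Type*} [CommRing k]

/-- Group elements go to units, so the universal property of the free group applies to the induced
homomorphisms into `Aˣ`, and inverses of generators need no separate check. -/
theorem algHom_eq_of_generators {A : Type*} [Ring A] [Algebra k A] {α β : V k →ₐ[k] A}
    (hX : ∀ i, α (X k i) = β (X k i)) : α = β := by
  have h : MonoidHom.toHomUnits ((α : V k →* A).comp (MonoidAlgebra.of k (FreeGroup (Fin 2)))) =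
      MonoidHom.toHomUnits ((β : V k →* A).comp (MonoidAlgebra.of k (FreeGroup (Fin 2)))) := by
    refine FreeGroup.ext_hom _ _ fun i => Units.ext ?_
    have := hX i
    rw [X, Xp, zpow_one] at this
    exact this
  refine MonoidAlgebra.algHom_ext (fun g => ?_) (Subsingleton.elim _ _)
  exact congrArg Units.val (DFunLike.congr_fun h g)

theorem exists_sub_of_mem_fil {A : Type*} [Ring A] [Algebra k A] {I : Ideal A} [I.IsTwoSided]
    {m : ℕ} {x : Cpl k I} (hx : x ∈ Cpl.fil k I m) {n : ℕ} (h : m ≤ n) :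
    ∃ a ∈ I ^ m, x - Cpl.of k I a ∈ Cpl.fil k I n := by
  obtain ⟨a, ha, e⟩ := Cpl.exists_rep h hx
  exact ⟨a, ha, by rw [Cpl.mem_fil, map_sub, e, Cpl.proj_of, sub_self]⟩

theorem exists_sub_mem_fil {A : Type*} [Ring A] [Algebra k A] {I : Ideal A} [I.IsTwoSided]
    (x : Cpl k I) (n : ℕ) : ∃ a, x - Cpl.of k I a ∈ Cpl.fil k I n := by
  obtain ⟨a, _, h⟩ := exists_sub_of_mem_fil (Cpl.mem_fil_zero x) (Nat.zero_le n)
  exact ⟨a, h⟩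

/-- Two algebra morphisms with source `V̂` which agree on `X₀` and `X₁` are equal under a condition
of continuity. -/
theorem algHom_ext_of_Xhat {A : Type*} [Ring A] [Algebra k A] {α β : Vhat k →ₐ[k] A}
    (hX : ∀ i, α (Xhat k i) = β (Xhat k i))
    (h : ∀ y : A, (∀ n, ∃ u ∈ Cpl.fil k (augI k) n, y = α u - β u) → y = 0) : α = β := by
  refine AlgHom.ext fun x => sub_eq_zero.1 (h _ fun n => ?_)
  obtain ⟨a, ha⟩ := exists_sub_mem_fil x n
  refine ⟨_, ha, ?_⟩
  have := AlgHom.congr_fun (algHom_eq_of_generators (α := α.comp (Cpl.of k (augI k)))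
    (β := β.comp (Cpl.of k (augI k))) hX) a
  rw [AlgHom.comp_apply, AlgHom.comp_apply] at this
  rw [map_sub, map_sub, this, sub_sub_sub_cancel_right]

theorem algHom_ext_of_filtered {B : Type*} [Ring B] [Algebra k B] {J : Ideal B} [J.IsTwoSided]
    {α β : Vhat k →ₐ[k] Cpl k J} (hX : ∀ i, α (Xhat k i) = β (Xhat k i))
    (hα : ∀ n, ∀ x ∈ Cpl.fil k (augI k) n, α x ∈ Cpl.fil k J n)
    (hβ : ∀ n, ∀ x ∈ Cpl.fil k (augI k) n, β x ∈ Cpl.fil k J n) : α = β :=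
  algHom_ext_of_Xhat hX fun y hy => eq_zero_of_mem_fil fun n => by
    obtain ⟨u, hu, rfl⟩ := hy n
    exact sub_mem (hα n u hu) (hβ n u hu)

theorem algHom_ext_of_eq_zero {A : Type*} [Ring A] [Algebra k A] {α β : Vhat k →ₐ[k] A}
    (hX : ∀ i, α (Xhat k i) = β (Xhat k i)) (n : ℕ)
    (hα : ∀ x ∈ Cpl.fil k (augI k) n, α x = 0) (hβ : ∀ x ∈ Cpl.fil k (augI k) n, β x = 0) :
    α = β :=
  algHom_ext_of_Xhat hX fun y hy => by
    obtain ⟨u, hu, rfl⟩ := hy n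
    rw [hα u hu, hβ u hu, sub_zero]

variable (k)

theorem filV_mul (i j : ℕ) : ∀ x ∈ filV k i, ∀ y ∈ filV k j, x * y ∈ filV k (i + j) :=
  fun _ hx _ hy => Cpl.mul_mem_fil hx hy

theorem mem_filV_zero (x : Vhat k) : x ∈ filV k 0 := Cpl.mem_fil_zero x

theorem mem_tensorFil_filV_zero (z : Vhat k ⊗[k] Vhat k) : z ∈ tensorFil (filV k) 0 :=
  mem_tensorFil_zero (mem_filV_zero k) z

/-- The filtration of `V̂ ⊗ V̂`, by two-sided ideals. -/
def tensorIdeal (n : ℕ) : Ideal (Vhat k ⊗[k] Vhat k) where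
  carrier := tensorFil (filV k) n
  add_mem' := add_mem
  zero_mem' := zero_mem _
  smul_mem' z w hw := by
    have := mul_mem_tensorFil (filV_mul k) (mem_tensorFil_filV_zero k z) hw
    rwa [zero_add] at this

instance (n : ℕ) : (tensorIdeal k n).IsTwoSided where
  mul_mem_of_left {z} w hz := by
    have := mul_mem_tensorFil (filV_mul k) hz (mem_tensorFil_filV_zero k w)
    rwa [add_zero] at this

variable {k}

theorem mem_tensorIdeal {n : ℕ} {z : Vhat k ⊗[k] Vhat k} :
    z ∈ tensorIdeal k n ↔ z ∈ tensorFil (filV k) n := Iff.rfl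

theorem mk_tensorIdeal_eq_zero {n : ℕ} {z : Vhat k ⊗[k] Vhat k} (hz : z ∈ tensorFil (filV k) n) :
    Ideal.Quotient.mkₐ k (tensorIdeal k n) z = 0 :=
  Ideal.Quotient.eq_zero_iff_mem.2 hz

variable (k)

/-- The coproduct of `V`, as an algebra morphism with values in `V̂ ⊗ V̂`. -/
def comulAlg : V k →ₐ[k] Vhat k ⊗[k] Vhat k :=
  (Algebra.TensorProduct.map (Cpl.of k (augI k)) (Cpl.of k (augI k))).comp
    (Bialgebra.comulAlgHom k (V k))

/-- The coproduct of `V̂`, modulo the `n`-th step of the filtration. -/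
def comulLevel (n : ℕ) : Vhat k →ₐ[k] (Vhat k ⊗[k] Vhat k) ⧸ tensorIdeal k n :=
  (Ideal.Quotient.liftₐ (augI k ^ n) ((Ideal.Quotient.mkₐ k (tensorIdeal k n)).comp (comulAlg k))
    (fun a ha => mk_tensorIdeal_eq_zero (comulV_mem k n a ha))).comp (Cpl.proj k (augI k) n)

/-- The map `x ↦ x ⊗ 1`, modulo the `n`-th step of the filtration. -/
def leftLevel (n : ℕ) : Vhat k →ₐ[k] (Vhat k ⊗[k] Vhat k) ⧸ tensorIdeal k n :=
  (Ideal.Quotient.mkₐ k (tensorIdeal k n)).comp Algebra.TensorProduct.includeLeft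

/-- The map `x ↦ 1 ⊗ x`, modulo the `n`-th step of the filtration. -/
def rightLevel (n : ℕ) : Vhat k →ₐ[k] (Vhat k ⊗[k] Vhat k) ⧸ tensorIdeal k n :=
  (Ideal.Quotient.mkₐ k (tensorIdeal k n)).comp Algebra.TensorProduct.includeRight

variable {k}

theorem comulLevel_of_rep {n : ℕ} {x : Vhat k} {a : V k}
    (h : Cpl.proj k (augI k) n x = Ideal.Quotient.mk (augI k ^ n) a) :
    comulLevel k n x = Ideal.Quotient.mk (tensorIdeal k n) (comulV k a) := by
  rw [comulLevel, AlgHom.comp_apply, h]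
  rfl

theorem comulLevel_of (n : ℕ) (a : V k) : comulLevel k n (Cpl.of k (augI k) a) =
    Ideal.Quotient.mk (tensorIdeal k n) (comulV k a) := comulLevel_of_rep rfl

theorem comulLevel_eq_zero {n : ℕ} {x : Vhat k} (hx : x ∈ Cpl.fil k (augI k) n) :
    comulLevel k n x = 0 := by
  rw [comulLevel, AlgHom.comp_apply, Cpl.mem_fil.1 hx, map_zero]

theorem leftLevel_eq_zero {n : ℕ} {x : Vhat k} (hx : x ∈ Cpl.fil k (augI k) n) :
    leftLevel k n x = 0 :=
  mk_tensorIdeal_eq_zero (tmul_mem_tensorFil (i := n) (j := 0) le_rfl hx (Cpl.mem_fil_zero _))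

theorem rightLevel_eq_zero {n : ℕ} {x : Vhat k} (hx : x ∈ Cpl.fil k (augI k) n) :
    rightLevel k n x = 0 :=
  mk_tensorIdeal_eq_zero (tmul_mem_tensorFil (i := 0) (j := n) (by omega) (Cpl.mem_fil_zero _) hx)

theorem leftLevel_mul_rightLevel (n : ℕ) (x y : Vhat k) :
    leftLevel k n x * rightLevel k n y = Ideal.Quotient.mk (tensorIdeal k n) (x ⊗ₜ y) := by
  have h : x ⊗ₜ[k] y = (x ⊗ₜ 1) * (1 ⊗ₜ y) := by
    rw [Algebra.TensorProduct.tmul_mul_tmul, one_mul, mul_one]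
  rw [h, map_mul]
  rfl

theorem commute_leftLevel_rightLevel (n : ℕ) (x y : Vhat k) :
    Commute (leftLevel k n x) (rightLevel k n y) := by
  have h : Commute (x ⊗ₜ[k] (1 : Vhat k)) ((1 : Vhat k) ⊗ₜ[k] y) := by
    rw [Commute, SemiconjBy, Algebra.TensorProduct.tmul_mul_tmul,
      Algebra.TensorProduct.tmul_mul_tmul, one_mul, mul_one, one_mul, mul_one]
  exact h.map (Ideal.Quotient.mk (tensorIdeal k n))

/-- At each level the coproduct becomes an algebra morphism into a genuine quotient algebra of `V̂ ⊗
V̂`. Arguments about group-like elements can thus be multiplicative without a product on `TSq`. -/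
theorem isGrouplike_iff {g : Vhat k} : IsGrouplike g ↔ g - 1 ∈ Cpl.fil k (augI k) 1 ∧
    ∀ n, comulLevel k n g = leftLevel k n g * rightLevel k n g := by
  refine and_congr_right fun _ => ?_
  have key : ∀ n, comulLevel k n g = leftLevel k n g * rightLevel k n g ↔
      (deltaV k g).1 n = (TSq.of (filV k) (g ⊗ₜ g)).1 n := by
    intro n
    obtain ⟨a, ha⟩ := Ideal.Quotient.mk_surjective (Cpl.proj k (augI k) n g)
    rw [deltaV, TSq.extend_apply _ _ n g a ha.symm, comulLevel_of_rep ha.symm,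
      leftLevel_mul_rightLevel, Ideal.Quotient.eq, mem_tensorIdeal]
    exact (Submodule.Quotient.eq (tensorFil (filV k) n)).symm
  constructor
  · intro h n
    rw [key, h]
  · intro h
    exact Subtype.ext (funext fun n => (key n).1 (h n))

theorem isGrouplike_one : IsGrouplike (1 : Vhat k) :=
  isGrouplike_iff.2 ⟨by rw [sub_self]; exact zero_mem _, fun n => by
    rw [map_one, map_one, map_one, one_mul]⟩

theorem IsGrouplike.mul {g h : Vhat k} (hg : IsGrouplike g) (hh : IsGrouplike h) :
    IsGrouplike (g * h) := by
  rw [isGrouplike_iff] at *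
  refine ⟨?_, fun n => ?_⟩
  · have : g * h - 1 = g * (h - 1) + (g - 1) := by rw [mul_sub, mul_one, sub_add_sub_cancel]
    rw [this]
    exact add_mem (Ideal.mul_mem_left _ _ hh.1) hg.1
  · rw [map_mul, map_mul, map_mul, hg.2, hh.2, mul_assoc, mul_assoc,
      (commute_leftLevel_rightLevel n h g).symm.left_comm]

theorem IsGrouplike.inv {g : (Vhat k)ˣ} (hg : IsGrouplike (g : Vhat k)) :
    IsGrouplike ((g⁻¹ : (Vhat k)ˣ) : Vhat k) := by
  rw [isGrouplike_iff] at *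
  refine ⟨?_, fun n => ?_⟩
  · have h : ((g⁻¹ : (Vhat k)ˣ) : Vhat k) - 1 =
        -(((g⁻¹ : (Vhat k)ˣ) : Vhat k) * ((g : Vhat k) - 1)) := by
      rw [mul_sub, Units.inv_mul, mul_one, neg_sub]
    rw [h]
    exact neg_mem (Ideal.mul_mem_left _ _ hg.1)
  -- Both sides invert the coproduct of `g`: the left one by multiplicativity, the right one because
  -- that coproduct is `g ⊗ g`.
  · refine left_inv_eq_right_inv (a := comulLevel k n g) ?_ ?_
    · rw [← map_mul, Units.inv_mul, map_one]
    · rw [hg.2, (commute_leftLevel_rightLevel n _ _).symm.mul_mul_mul_comm, ← map_mul, ← map_mul,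
        Units.mul_inv, map_one, map_one, one_mul]

theorem isGrouplike_Xhat (i : Fin 2) : IsGrouplike (Xhat k i) := by
  refine isGrouplike_iff.2 ⟨Xhat_sub_one_mem k i, fun n => ?_⟩
  have h : comulV k (X k i) = Xhat k i ⊗ₜ Xhat k i := by
    rw [comulV, X, Xp, LinearMap.comp_apply]
    simp [MonoidAlgebra.of_apply, Xhat, X, Xp]
  rw [leftLevel_mul_rightLevel, ← h]
  exact comulLevel_of n _

/-- At each level `exp (Δ (log g)) = Δ g = g ⊗ g = exp (log g ⊗ 1 + 1 ⊗ log g)`, and `exp` is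
injective on nilpotent elements, so `log g` is primitive. Being primitive is stable under
multiplication by `μ`, and the exponential of a primitive element is group-like. -/
theorem IsGrouplike.powC [Algebra ℚ k] {g : Vhat k} (hg : IsGrouplike g) (μ : k) :
    IsGrouplike (BettiDMR.powC g hg.1 μ : Vhat k) := by
  have nil : ∀ (n : ℕ) (θ : Vhat k →ₐ[k] (Vhat k ⊗[k] Vhat k) ⧸ tensorIdeal k n)
      (_ : ∀ y ∈ Cpl.fil k (augI k) n, θ y = 0) (x : Vhat k) (_ : x ∈ Cpl.fil k (augI k) 1),
      θ x ^ n = 0 := fun n θ hθ x hx => by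
    rw [← map_pow]
    exact hθ _ (Cpl.pow_mem_fil hx n)
  have add : ∀ (n : ℕ) (x : Vhat k) (hx : x ∈ Cpl.fil k (augI k) 1) (m : ℕ)
      (hm : (leftLevel k n x + rightLevel k n x) ^ m = 0),
      nilEval (k := k) (leftLevel k n x + rightLevel k n x) m hm (PowerSeries.exp k) =
        leftLevel k n (expC x hx) * rightLevel k n (expC x hx) := fun n x hx m hm => by
    rw [nilEval_exp_add (commute_leftLevel_rightLevel n x x)
      (nil n _ (fun _ => leftLevel_eq_zero) x hx) (nil n _ (fun _ => rightLevel_eq_zero) x hx) hm,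
      ← map_psEval_eq_nilEval _ hx, ← map_psEval_eq_nilEval _ hx]
    rfl
  have nilAdd : ∀ (n : ℕ) (x : Vhat k) (_ : x ∈ Cpl.fil k (augI k) 1),
      IsNilpotent (leftLevel k n x + rightLevel k n x) := fun n x hx =>
    (commute_leftLevel_rightLevel n x x).isNilpotent_add
      ⟨n, nil n _ (fun _ => leftLevel_eq_zero) x hx⟩
      ⟨n, nil n _ (fun _ => rightLevel_eq_zero) x hx⟩
  refine isGrouplike_iff.2 ⟨expC_sub_one_mem _ _, fun n => ?_⟩
  set x := logC g hg.1 with hx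
  have hx1 : x ∈ Cpl.fil k (augI k) 1 := logC_mem g hg.1
  have hxμ : μ • x ∈ Cpl.fil k (augI k) 1 := Submodule.smul_of_tower_mem _ μ hx1
  -- Primitivity of `log g`. The exponent `m` killing the sum of the two commuting nilpotent
  -- elements may differ from `n`.
  have hlog : comulLevel k n x = leftLevel k n x + rightLevel k n x := by
    obtain ⟨m, hm⟩ := nilAdd n x hx1
    refine nilEval_exp_injective (k := k) (nil n _ (fun _ => comulLevel_eq_zero) x hx1) hm ?_
    rw [← map_psEval_eq_nilEval _ hx1, add n x hx1 m hm]
    change comulLevel k n (expC x hx1 : Vhat k) = _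
    rw [expC_logC]
    exact (isGrouplike_iff.1 hg).2 n
  obtain ⟨m, hm⟩ := nilAdd n _ hxμ
  have hlog' : comulLevel k n (μ • x) = leftLevel k n (μ • x) + rightLevel k n (μ • x) := by
    rw [map_smul, map_smul, map_smul, hlog, smul_add]
  refine Eq.trans ?_ (add n (μ • x) hxμ m hm)
  refine (map_psEval_eq_nilEval (comulLevel k n) hxμ
    (nil n _ (fun _ => comulLevel_eq_zero) _ hxμ) _).trans ?_
  refine AlgHom.congr_fun (powerSeries_algHom_ext_of_pow_eq_zero (n := n) ?_ ?_) _
  · rw [nilEval_X, nilEval_X, hlog']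
  · rw [nilEval_X]
    exact nil n _ (fun _ => comulLevel_eq_zero) _ hxμ

/-! ### Filtered endomorphisms of `V̂` and group-likeness -/

section Square

variable (θ : Vhat k →ₐ[k] Vhat k)
  (hθ : ∀ n, ∀ x ∈ Cpl.fil k (augI k) n, θ x ∈ Cpl.fil k (augI k) n)

/-- The tensor square of a filtered algebra endomorphism of `V̂`, modulo the `n`-th step of the
filtration. -/
def squareLevel (n : ℕ) : (Vhat k ⊗[k] Vhat k) ⧸ tensorIdeal k n →ₐ[k]
    (Vhat k ⊗[k] Vhat k) ⧸ tensorIdeal k n :=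
  Ideal.Quotient.liftₐ (tensorIdeal k n) ((Ideal.Quotient.mkₐ k (tensorIdeal k n)).comp
    (Algebra.TensorProduct.map θ θ)) (fun _ hz => mk_tensorIdeal_eq_zero
      (map_mem_tensorFil (F := filV k) (G := filV k) (f := θ.toLinearMap) hθ hz))

theorem squareLevel_leftLevel (n : ℕ) (x : Vhat k) :
    squareLevel θ hθ n (leftLevel k n x) = leftLevel k n (θ x) := by
  change Ideal.Quotient.mk (tensorIdeal k n) (Algebra.TensorProduct.map θ θ (x ⊗ₜ 1)) = _
  rw [Algebra.TensorProduct.map_tmul, map_one]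
  rfl

theorem squareLevel_rightLevel (n : ℕ) (x : Vhat k) :
    squareLevel θ hθ n (rightLevel k n x) = rightLevel k n (θ x) := by
  change Ideal.Quotient.mk (tensorIdeal k n) (Algebra.TensorProduct.map θ θ (1 ⊗ₜ x)) = _
  rw [Algebra.TensorProduct.map_tmul, map_one]
  rfl

variable {θ}

-- Both sides are algebra morphisms in `x` that vanish on `Fⁿ`, so agreement on `X₀` and `X₁`
-- suffices; there it says that `X i` and `θ (X i)` are group-like.
include hθ in
theorem squareLevel_comulLevel (hX : ∀ i, IsGrouplike (θ (Xhat k i))) (n : ℕ) (x : Vhat k) :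
    squareLevel θ hθ n (comulLevel k n x) = comulLevel k n (θ x) := by
  refine AlgHom.congr_fun (φ₁ := (squareLevel θ hθ n).comp (comulLevel k n))
    (φ₂ := (comulLevel k n).comp θ) (algHom_ext_of_eq_zero (fun i => ?_) n ?_ ?_) x
  · rw [AlgHom.comp_apply, AlgHom.comp_apply, (isGrouplike_iff.1 (hX i)).2,
      (isGrouplike_iff.1 (isGrouplike_Xhat i)).2, map_mul, squareLevel_leftLevel,
      squareLevel_rightLevel]
  · intro y hy
    rw [AlgHom.comp_apply, comulLevel_eq_zero hy, map_zero]
  · intro y hy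
    exact comulLevel_eq_zero (hθ n y hy)

include hθ in
theorem IsGrouplike.map (hX : ∀ i, IsGrouplike (θ (Xhat k i))) {g : Vhat k} (hg : IsGrouplike g) :
    IsGrouplike (θ g) := by
  refine isGrouplike_iff.2 ⟨?_, fun n => ?_⟩
  · rw [← map_one θ, ← map_sub]
    exact hθ 1 _ hg.1
  · rw [← squareLevel_comulLevel hθ hX, (isGrouplike_iff.1 hg).2, map_mul, squareLevel_leftLevel,
      squareLevel_rightLevel]

variable (hu : ∀ n, ∀ x ∈ Cpl.fil k (augI k) n, θ x - x ∈ Cpl.fil k (augI k) (n + 1))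

include hu in
theorem filtered_of_unipotent (n : ℕ) (x : Vhat k) (hx : x ∈ Cpl.fil k (augI k) n) :
    θ x ∈ Cpl.fil k (augI k) n := by
  have := add_mem (Cpl.fil_anti n.le_succ (hu n x hx)) hx
  rwa [sub_add_cancel] at this

-- A unipotent `θ` has a unipotent tensor square, because `θ x ⊗ θ y - x ⊗ y = (θ x - x) ⊗ θ y + x ⊗
-- (θ y - y)`.
include hu in
theorem map_sub_mem_tensorFil {n : ℕ} {z : Vhat k ⊗[k] Vhat k} (hz : z ∈ tensorFil (filV k) n) :
    Algebra.TensorProduct.map θ θ z - z ∈ tensorFil (filV k) (n + 1) := by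
  suffices h : tensorFil (filV k) n ≤ (tensorFil (filV k) (n + 1)).comap
      ((Algebra.TensorProduct.map θ θ).toLinearMap - LinearMap.id) from h hz
  refine tensorFil_le fun i j hij x hx y hy => ?_
  have e : ((Algebra.TensorProduct.map θ θ).toLinearMap -
      (LinearMap.id : Vhat k ⊗[k] Vhat k →ₗ[k] Vhat k ⊗[k] Vhat k)) (x ⊗ₜ[k] y) =
      (θ x - x) ⊗ₜ θ y + x ⊗ₜ (θ y - y) := by
    rw [LinearMap.sub_apply, AlgHom.toLinearMap_apply, Algebra.TensorProduct.map_tmul,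
      LinearMap.id_apply, TensorProduct.sub_tmul, TensorProduct.tmul_sub, sub_add_sub_cancel]
  rw [Submodule.mem_comap, e]
  exact add_mem (tmul_mem_tensorFil (i := i + 1) (j := j) (by omega) (hu i x hx)
    (filtered_of_unipotent hu j y hy))
    (tmul_mem_tensorFil (i := i) (j := j + 1) (by omega) hx (hu j y hy))

-- Since `θ ⊗ θ` is the identity on graded pieces, it reflects the filtration: from `z ∈ Fᵐ` one
-- gets `z = (θ ⊗ θ) z - ((θ ⊗ θ) z - z) ∈ Fᵐ⁺¹` as long as `m < n`.
include hu in
theorem mem_tensorFil_of_map_mem {n : ℕ} {z : Vhat k ⊗[k] Vhat k}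
    (hz : Algebra.TensorProduct.map θ θ z ∈ tensorFil (filV k) n) : z ∈ tensorFil (filV k) n := by
  have h : ∀ m ≤ n, z ∈ tensorFil (filV k) m := by
    intro m
    induction m with
    | zero => exact fun _ => mem_tensorFil_filV_zero k z
    | succ m ih =>
      intro hm
      have := sub_mem (tensorFil_anti (filV k) hm hz) (map_sub_mem_tensorFil hu (ih (by omega)))
      rwa [sub_sub_cancel] at this
  exact h n le_rfl

-- The defect `Δ g - g ⊗ g` is carried by `θ ⊗ θ` to the defect of `θ g`, which vanishes modulo
-- `Fⁿ`; as `θ ⊗ θ` reflects the filtration, the defect of `g` vanishes too.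
include hu in
theorem isGrouplike_of_map (hX : ∀ i, IsGrouplike (θ (Xhat k i))) {g : Vhat k}
    (hg : IsGrouplike (θ g)) : IsGrouplike g := by
  have hθ := filtered_of_unipotent hu
  refine isGrouplike_iff.2 ⟨?_, fun n => ?_⟩
  · have := sub_mem hg.1 (hu 0 g (Cpl.mem_fil_zero g))
    rwa [sub_sub_sub_cancel_left] at this
  · obtain ⟨z, hz⟩ := Ideal.Quotient.mk_surjective
      (comulLevel k n g - leftLevel k n g * rightLevel k n g)
    have h : squareLevel θ hθ n (Ideal.Quotient.mk (tensorIdeal k n) z) = 0 := by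
      rw [hz, map_sub, map_mul, squareLevel_comulLevel hθ hX, squareLevel_leftLevel,
        squareLevel_rightLevel, (isGrouplike_iff.1 hg).2, sub_self]
    have h2 := mem_tensorFil_of_map_mem hu (Ideal.Quotient.eq_zero_iff_mem.1 h)
    rw [← sub_eq_zero, ← hz]
    exact Ideal.Quotient.eq_zero_iff_mem.2 h2

end Square

/-- The completion is complete. -/
theorem exists_limit {A : Type*} [Ring A] [Algebra k A] {I : Ideal A} [I.IsTwoSided]
    (s : ℕ → Cpl k I) (hs : ∀ n, s (n + 1) - s n ∈ Cpl.fil k I n) :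
    ∃ x, ∀ n, x - s n ∈ Cpl.fil k I n := by
  have h : ∀ m n, m ≤ n → s n - s m ∈ Cpl.fil k I m := by
    intro m n hmn
    induction n, hmn using Nat.le_induction with
    | base => rw [sub_self]; exact zero_mem _
    | succ n hn ih =>
      rw [← sub_add_sub_cancel _ (s n)]
      exact add_mem (Cpl.fil_anti hn (hs n)) ih
  refine ⟨(⟨fun n => Cpl.proj k I n (s n), fun m n hmn => ?_⟩ : subCpl k I), fun n => ?_⟩
  · rw [Cpl.factor_proj hmn]
    exact sub_eq_zero.1 ((map_sub _ _ _).symm.trans (Cpl.mem_fil.1 (h m n hmn)))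
  · refine Cpl.mem_fil.2 ((map_sub _ _ _).trans (sub_eq_zero.2 ?_))
    rfl

/-- Successive approximation: replacing `x` by `x + r`, where `r = y - θ x` is the error, turns the
error into `r - θ r`, one step deeper in the filtration. Completeness provides the limit. -/
theorem surjective_of_unipotent {θ : Vhat k →ₐ[k] Vhat k}
    (hu : ∀ n, ∀ x ∈ Cpl.fil k (augI k) n, θ x - x ∈ Cpl.fil k (augI k) (n + 1)) :
    Function.Surjective θ := by
  intro y
  let s : ℕ → Vhat k := fun n => Nat.rec 0 (fun _ x => x + (y - θ x)) n
  have e : ∀ n, s (n + 1) = s n + (y - θ (s n)) := fun _ => rfl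
  have hs : ∀ n, y - θ (s n) ∈ Cpl.fil k (augI k) n := by
    intro n
    induction n with
    | zero => exact Cpl.mem_fil_zero _
    | succ n ih =>
      have := neg_mem (hu n _ ih)
      rw [e, map_add]
      convert this using 1
      abel
  obtain ⟨x, hx⟩ := exists_limit s (fun n => by rw [e, add_sub_cancel_left]; exact hs n)
  refine ⟨x, sub_eq_zero.1 (eq_zero_of_mem_fil fun n => ?_)⟩
  have := sub_mem (filtered_of_unipotent hu n _ (hx n)) (hs n)
  rw [map_sub] at this
  convert this using 1
  abel

end Grouplike

/-! ### The group structure on the pairs `(μ, g)` -/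

section GroupLaw

variable {k : Type*} [CommRing k]

/-- The conjugation by a unit, as an algebra endomorphism. -/
def conjAlgHom (k : Type*) [CommRing k] {A : Type*} [Ring A] [Algebra k A] (u : Aˣ) : A →ₐ[k] A :=
  AlgHom.ofLinearMap ((LinearMap.mulLeft k (u : A)).comp (LinearMap.mulRight k ((u⁻¹ : Aˣ) : A)))
    (by simp) (fun x y => by simp [mul_assoc])

theorem conjAlgHom_apply {A : Type*} [Ring A] [Algebra k A] (u : Aˣ) (a : A) :
    conjAlgHom k u a = u * a * ((u⁻¹ : Aˣ) : A) := (mul_assoc _ _ _).symm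

/-- An algebra endomorphism of `V̂` which is the identity on the first graded piece is unipotent. -/
theorem unipotent_of_generators {θ : Vhat k →ₐ[k] Vhat k}
    (hθ : ∀ n, ∀ x ∈ Cpl.fil k (augI k) n, θ x ∈ Cpl.fil k (augI k) n)
    (hX : ∀ i, θ (Xhat k i) - Xhat k i ∈ Cpl.fil k (augI k) 2) (n : ℕ) :
    ∀ x ∈ Cpl.fil k (augI k) n, θ x - x ∈ Cpl.fil k (augI k) (n + 1) := by
  -- The condition `θ a - a ∈ F²` is stable under products and inverses because `F²` is a two-sided
  -- ideal.
  have grp : ∀ g : FreeGroup (Fin 2), θ (Cpl.of k (augI k) (MonoidAlgebra.of k _ g)) -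
      Cpl.of k (augI k) (MonoidAlgebra.of k _ g) ∈ Cpl.fil k (augI k) 2 := by
    have gen : ∀ i, θ (Cpl.of k (augI k) (MonoidAlgebra.of k _ (FreeGroup.of i))) -
        Cpl.of k (augI k) (MonoidAlgebra.of k _ (FreeGroup.of i)) ∈ Cpl.fil k (augI k) 2 := by
      intro i
      have := hX i
      rwa [Xhat, X, Xp, zpow_one] at this
    intro g
    induction g using FreeGroup.induction_on with
    | C1 => rw [map_one, map_one, map_one, sub_self]; exact zero_mem _
    | of i => exact gen i
    | inv_of i _ =>
      set a := Cpl.of k (augI k) (MonoidAlgebra.of k _ (FreeGroup.of i)) with ha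
      set b := Cpl.of k (augI k) (MonoidAlgebra.of k _ (FreeGroup.of i)⁻¹) with hb
      have hab : a * b = 1 := by
        rw [ha, hb, ← map_mul, ← map_mul, mul_inv_cancel, map_one, map_one]
      have hba : b * a = 1 := by
        rw [ha, hb, ← map_mul, ← map_mul, inv_mul_cancel, map_one, map_one]
      have h : θ b - b = -(θ b * (θ a - a) * b) := by
        rw [mul_sub, ← map_mul, hba, map_one, sub_mul, one_mul, mul_assoc, hab, mul_one, neg_sub]
      rw [h]
      exact neg_mem (Ideal.mul_mem_right _ _ (Ideal.mul_mem_left _ _ (gen i)))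
    | mul g h hg hh =>
      rw [map_mul, map_mul, map_mul]
      set a := Cpl.of k (augI k) (MonoidAlgebra.of k _ g)
      set b := Cpl.of k (augI k) (MonoidAlgebra.of k _ h)
      have e : θ a * θ b - a * b = (θ a - a) * θ b + a * (θ b - b) := by
        rw [sub_mul, mul_sub, sub_add_sub_cancel]
      rw [e]
      exact add_mem (Ideal.mul_mem_right _ _ hg) (Ideal.mul_mem_left _ _ hh)
  have one : ∀ a ∈ augI k, θ (Cpl.of k (augI k) a) - Cpl.of k (augI k) a ∈
      Cpl.fil k (augI k) 2 := by
    intro a ha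
    refine sub_counit_induction ((θ.toLinearMap - LinearMap.id).comp
      (Cpl.of k (augI k)).toLinearMap) (filV k 2) (fun g => ?_) ha
    change θ (Cpl.of k (augI k) (MonoidAlgebra.of k _ g - 1)) -
      Cpl.of k (augI k) (MonoidAlgebra.of k _ g - 1) ∈ _
    rw [map_sub, map_one, map_sub, map_one, sub_sub_sub_cancel_right]
    exact grp g
  have pow : ∀ n, ∀ a ∈ augI k ^ n, θ (Cpl.of k (augI k) a) - Cpl.of k (augI k) a ∈
      Cpl.fil k (augI k) (n + 1) := by
    intro n
    induction n with
    | zero =>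
      intro a _
      -- Scalars are fixed by `θ`, so `a` may be replaced by `a - ε(a)`, which lies in the
      -- augmentation ideal.
      have h : θ (Cpl.of k (augI k) a) - Cpl.of k (augI k) a =
          θ (Cpl.of k (augI k) (a - algebraMap k (V k) (Bialgebra.counitAlgHom k (V k) a))) -
          Cpl.of k (augI k) (a - algebraMap k (V k) (Bialgebra.counitAlgHom k (V k) a)) := by
        rw [map_sub, map_sub, AlgHom.commutes, AlgHom.commutes, sub_sub_sub_cancel_right]
      rw [h]
      refine Cpl.fil_anti one_le_two (one _ ?_)
      rw [mem_augI, map_sub, AlgHom.commutes, Algebra.algebraMap_self, RingHom.id_apply, sub_self]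
    | succ n ih =>
      intro a ha
      rw [Ideal.IsTwoSided.pow_add, Submodule.pow_one] at ha
      refine Submodule.mul_induction_on ha (fun x hx y hy => ?_) (fun x y hx hy => ?_)
      -- Twisted Leibniz rule for `θ - id`: the terms lie in `Fⁿ⁺¹ F¹` and `Fⁿ F²`, both inside
      -- `Fⁿ⁺²`.
      · have e : θ (Cpl.of k (augI k) (x * y)) - Cpl.of k (augI k) (x * y) =
            (θ (Cpl.of k (augI k) x) - Cpl.of k (augI k) x) * θ (Cpl.of k (augI k) y) +
            Cpl.of k (augI k) x * (θ (Cpl.of k (augI k) y) - Cpl.of k (augI k) y) := by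
          rw [sub_mul, mul_sub, sub_add_sub_cancel, map_mul, map_mul]
        rw [e]
        refine add_mem (Cpl.mul_mem_fil (ih x hx) (hθ 1 _ (Cpl.of_mem_fil ?_)))
          (Cpl.mul_mem_fil (m := n) (n := 2) (Cpl.of_mem_fil hx) (one y hy))
        rwa [Submodule.pow_one]
      · rw [map_add, map_add, add_sub_add_comm]
        exact add_mem hx hy
  intro x hx
  obtain ⟨a, ha, h⟩ := exists_sub_of_mem_fil hx n.le_succ
  have e : θ x - x = θ (x - Cpl.of k (augI k) a) - (x - Cpl.of k (augI k) a) +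
      (θ (Cpl.of k (augI k) a) - Cpl.of k (augI k) a) := by
    rw [map_sub]; abel
  rw [e]
  exact add_mem (sub_mem (hθ _ _ h) h) (pow n a ha)

theorem commutator_sub_one {A : Type*} [Ring A] (a b : A) :
    (a - 1) * (b - 1) - (b - 1) * (a - 1) = a * b - b * a := by noncomm_ring

variable [Algebra ℚ k]

theorem aut1_Xhat_zero (p : kˣ × (Vhat k)ˣ) : aut1 p (Xhat k 0) = (p.2 : Vhat k) *
    (powC (Xhat k 0) (Xhat_sub_one_mem k 0) (p.1 : k) : Vhat k) * ((p.2⁻¹ : (Vhat k)ˣ) : Vhat k) :=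
  substV_Xhat _ _ 0

theorem aut1_Xhat_one (p : kˣ × (Vhat k)ˣ) : aut1 p (Xhat k 1) =
    (powC (Xhat k 1) (Xhat_sub_one_mem k 1) (p.1 : k) : Vhat k) :=
  substV_Xhat _ _ 1

/-- Powers commute with algebra maps, in particular with conjugation, and `(a ^ μ) ^ μ' = a ^ (μ
μ')`. With `p = (μ, g)` and `q = (μ', g')`, both sides therefore send `X₀` to the conjugate of `X₀ ^
(μ μ')` by `aut1 p (g') g`, and `X₁` to `X₁ ^ (μ μ')`. -/
theorem aut1_circ (p q : kˣ × (Vhat k)ˣ) : aut1 (circ p q) = (aut1 p).comp (aut1 q) := by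
  have hpow : ∀ i, (powC (Xhat k i) (Xhat_sub_one_mem k i) (p.1 : k) : Vhat k) - 1 ∈
    Cpl.fil k (augI k) 1 := fun i => expC_sub_one_mem _ _
  refine algHom_ext_of_filtered (fun i => ?_) (fun n x => aut1_mem _)
    (fun n x hx => aut1_mem p (aut1_mem q hx))
  rw [AlgHom.comp_apply]
  fin_cases i
  · change aut1 (circ p q) (Xhat k 0) = aut1 p (aut1 q (Xhat k 0))
    have h := aut1_Xhat_zero p
    rw [← conjAlgHom_apply (k := k)] at h
    have h1 : aut1 p (Xhat k 0) - 1 ∈ Cpl.fil k (augI k) 1 := by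
      rw [← map_one (aut1 p), ← map_sub]
      exact aut1_mem p (Xhat_sub_one_mem k 0)
    rw [aut1_Xhat_zero, aut1_Xhat_zero, map_mul, map_mul,
      map_powC (aut1 p) (Xhat_sub_one_mem k 0) h1 rfl,
      ← map_powC (conjAlgHom k p.2) (hpow 0) h1 h.symm, powC_powC, conjAlgHom_apply]
    have e : (((circ p q).2⁻¹ : (Vhat k)ˣ) : Vhat k) =
        ((p.2⁻¹ : (Vhat k)ˣ) : Vhat k) * aut1 p ((q.2⁻¹ : (Vhat k)ˣ) : Vhat k) := by
      rw [circ, mul_inv_rev, Units.val_mul, ← map_inv]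
      rfl
    have e' : ((circ p q).2 : Vhat k) = aut1 p (q.2 : Vhat k) * (p.2 : Vhat k) := rfl
    rw [e, e', show (((circ p q).1 : kˣ) : k) = p.1 * q.1 from rfl]
    simp only [mul_assoc]
  · change aut1 (circ p q) (Xhat k 1) = aut1 p (aut1 q (Xhat k 1))
    rw [aut1_Xhat_one, aut1_Xhat_one, map_powC (aut1 p) (Xhat_sub_one_mem k 1) (hpow 1)
      (aut1_Xhat_one p), powC_powC]
    rfl

theorem aut1_one : aut1 (1 : kˣ × (Vhat k)ˣ) = AlgHom.id k (Vhat k) := by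
  refine algHom_ext_of_filtered (fun i => ?_) (fun n x => aut1_mem _) (fun n x hx => hx)
  fin_cases i
  · refine (aut1_Xhat_zero 1).trans ?_
    change ((1 : (Vhat k)ˣ) : Vhat k) * (powC (Xhat k 0) _ (1 : k) : Vhat k) *
      (((1 : (Vhat k)ˣ)⁻¹ : (Vhat k)ˣ) : Vhat k) = Xhat k 0
    rw [powC_one, inv_one, Units.val_one, one_mul, mul_one]
  · exact (aut1_Xhat_one 1).trans (powC_one _ _)

theorem circ_assoc (p q r : kˣ × (Vhat k)ˣ) : circ (circ p q) r = circ p (circ q r) := by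
  refine Prod.ext (mul_assoc _ _ _) (Units.ext ?_)
  change aut1 (circ p q) (r.2 : Vhat k) * (aut1 p (q.2 : Vhat k) * (p.2 : Vhat k)) =
    aut1 p (aut1 q (r.2 : Vhat k) * (q.2 : Vhat k)) * (p.2 : Vhat k)
  rw [aut1_circ, AlgHom.comp_apply, map_mul, mul_assoc]

theorem circ_one (p : kˣ × (Vhat k)ˣ) : circ p 1 = p := by
  refine Prod.ext (mul_one _) ?_
  change Units.map _ 1 * p.2 = p.2
  rw [map_one, one_mul]

theorem one_circ (p : kˣ × (Vhat k)ˣ) : circ 1 p = p := by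
  refine Prod.ext (one_mul _) (Units.ext ?_)
  change aut1 1 (p.2 : Vhat k) * ((1 : (Vhat k)ˣ) : Vhat k) = _
  rw [aut1_one, Units.val_one, mul_one]
  rfl

theorem isGrouplike_aut1_Xhat {p : kˣ × (Vhat k)ˣ} (hp : IsGrouplike (p.2 : Vhat k)) (i : Fin 2) :
    IsGrouplike (aut1 p (Xhat k i)) := by
  fin_cases i
  · change IsGrouplike (aut1 p (Xhat k 0))
    rw [aut1_Xhat_zero]
    exact (hp.mul ((isGrouplike_Xhat 0).powC _)).mul hp.inv
  · change IsGrouplike (aut1 p (Xhat k 1))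
    rw [aut1_Xhat_one]
    exact (isGrouplike_Xhat 1).powC _

theorem isGrouplike_circ {p q : kˣ × (Vhat k)ˣ} (hp : IsGrouplike (p.2 : Vhat k))
    (hq : IsGrouplike (q.2 : Vhat k)) : IsGrouplike ((circ p q).2 : Vhat k) :=
  (hq.map (fun _ _ => aut1_mem p) (isGrouplike_aut1_Xhat hp)).mul hp

/-- With `μ = 1` the generator `X₁` is fixed, and `g X₀ g⁻¹ - X₀` is the commutator of `g - 1` and
`X₀ - 1` times `g⁻¹`, hence in `F²`. For general `μ` the graded action would be multiplication by
powers of `μ` instead of the identity. -/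
theorem aut1_unipotent {g : (Vhat k)ˣ} (hg : (g : Vhat k) - 1 ∈ Cpl.fil k (augI k) 1) (n : ℕ) :
    ∀ x ∈ Cpl.fil k (augI k) n, aut1 (1, g) x - x ∈ Cpl.fil k (augI k) (n + 1) := by
  refine unipotent_of_generators (fun n x => aut1_mem _) (fun i => ?_) n
  fin_cases i
  · change aut1 (1, g) (Xhat k 0) - Xhat k 0 ∈ _
    rw [aut1_Xhat_zero, Units.val_one, powC_one]
    have e : (g : Vhat k) * Xhat k 0 * ((g⁻¹ : (Vhat k)ˣ) : Vhat k) - Xhat k 0 =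
        (((g : Vhat k) - 1) * (Xhat k 0 - 1) - (Xhat k 0 - 1) * ((g : Vhat k) - 1)) *
          ((g⁻¹ : (Vhat k)ˣ) : Vhat k) := by
      rw [commutator_sub_one, sub_mul, Units.mul_inv_cancel_right]
    rw [e]
    have h0 := Xhat_sub_one_mem k 0
    exact Ideal.mul_mem_right _ _ (sub_mem (Cpl.mul_mem_fil (m := 1) (n := 1) hg h0)
      (Cpl.mul_mem_fil (m := 1) (n := 1) h0 hg))
  · change aut1 (1, g) (Xhat k 1) - Xhat k 1 ∈ _
    rw [aut1_Xhat_one, Units.val_one, powC_one, sub_self]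
    exact zero_mem _

/-- Splitting `(μ, g) = (1, g) ⊛ (μ, 1)` isolates the unipotent part. A right inverse of `(1, g)` is
`(1, u)` with `aut1 (1, g) u = g⁻¹`, and `u` is group-like because unipotent maps reflect this
property. -/
theorem exists_circ_eq_one {p : kˣ × (Vhat k)ˣ} (hp : IsGrouplike (p.2 : Vhat k)) :
    ∃ q : kˣ × (Vhat k)ˣ, IsGrouplike (q.2 : Vhat k) ∧ circ p q = 1 := by
  obtain ⟨μ, g⟩ := p
  have hu := aut1_unipotent hp.1
  obtain ⟨x, hx⟩ := surjective_of_unipotent hu ((g⁻¹ : (Vhat k)ˣ) : Vhat k)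
  obtain ⟨y, hy⟩ := surjective_of_unipotent hu (g : Vhat k)
  -- An element of the kernel lying in `Fⁿ` lies in `Fⁿ⁺¹`, and the filtration is separated.
  have inj : Function.Injective (aut1 ((1, g) : kˣ × (Vhat k)ˣ)) := by
    refine (injective_iff_map_eq_zero _).2 fun z hz => eq_zero_of_mem_fil fun n => ?_
    induction n with
    | zero => exact Cpl.mem_fil_zero z
    | succ n ih =>
      have := neg_mem (hu n z ih)
      rwa [hz, zero_sub, neg_neg] at this
  -- The preimages of `g⁻¹` and `g` are mutually inverse by injectivity.
  let u : (Vhat k)ˣ := ⟨x, y, inj (by rw [map_mul, hx, hy, Units.inv_mul, map_one]),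
    inj (by rw [map_mul, hx, hy, Units.mul_inv, map_one])⟩
  have hu1 : IsGrouplike (u : Vhat k) :=
    isGrouplike_of_map hu (isGrouplike_aut1_Xhat (p := (1, g)) hp) (by
      change IsGrouplike (aut1 (1, g) x)
      rw [hx]
      exact IsGrouplike.inv hp)
  have h1 : circ (1, g) (1, u) = (1 : kˣ × (Vhat k)ˣ) := by
    refine Prod.ext (one_mul _) (Units.ext ?_)
    change aut1 (1, g) x * (g : Vhat k) = 1
    rw [hx, Units.inv_mul]
  have h2 : circ (1, g) (μ, 1) = (μ, g) := by
    refine Prod.ext (one_mul _) (Units.ext ?_)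
    change aut1 (1, g) 1 * (g : Vhat k) = g
    rw [map_one, one_mul]
  have h3 : circ (μ, 1) (μ⁻¹, 1) = (1 : kˣ × (Vhat k)ˣ) := by
    refine Prod.ext (mul_inv_cancel _) (Units.ext ?_)
    change aut1 (μ, 1) 1 * (1 : Vhat k) = 1
    rw [map_one, one_mul]
  refine ⟨circ (μ⁻¹, 1) (1, u), isGrouplike_circ isGrouplike_one hu1, ?_⟩
  rw [← h2, circ_assoc, ← circ_assoc (μ, 1), h3, one_circ, h1]

/-- The group structure given by the product `circ`. -/
abbrev groupGB : Group (GB k) :=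
  letI : Mul (GB k) := ⟨fun x y => ⟨circ x.1 y.1, isGrouplike_circ x.2 y.2⟩⟩
  letI : Inv (GB k) := ⟨fun x => ⟨(exists_circ_eq_one x.2).choose,
    (exists_circ_eq_one x.2).choose_spec.1⟩⟩
  letI : One (GB k) := ⟨⟨1, isGrouplike_one⟩⟩
  Group.ofRightAxioms (fun x y z => Subtype.ext (circ_assoc x.1 y.1 z.1))
    (fun x => Subtype.ext (circ_one x.1))
    (fun x => Subtype.ext (exists_circ_eq_one x.2).choose_spec.2)

end GroupLaw

/-! ### A triangular representation of noncommutative power series -/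

section Triangular

variable {k : Type*} [CommRing k]

/-- The matrices by which the letters act. -/
def letterMat (k : Type*) [CommRing k] : Fin 2 → Matrix (Fin 2) (Fin 2) k⟦X⟧ :=
  ![!![PowerSeries.X, 0; 0, 0], !![0, PowerSeries.X; 0, 0]]

/-- The representation of noncommutative polynomials which records the coefficients of the words
`e₀ ^ n` and `e₀ ^ n e₁`. -/
def polyMat (k : Type*) [CommRing k] : NC k →ₐ[k] Matrix (Fin 2) (Fin 2) k⟦X⟧ :=
  MonoidAlgebra.lift k _ _ (FreeMonoid.lift (letterMat k))

/-- Induction on the first letter. Left multiplication by the matrix of `e₀` keeps the top row and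
kills the bottom one; that of `e₁` moves the bottom row to the top, and the bottom row is nonzero
only for the empty word. The factor `X` carried by each letter records the length. -/
theorem polyMat_word (w : List (Fin 2)) :
    (∀ n, PowerSeries.coeff n (polyMat k (MonoidAlgebra.of k _ (FreeMonoid.ofList w)) 0 0) =
      if w = List.replicate n 0 then 1 else 0) ∧
    (∀ n, PowerSeries.coeff n (polyMat k (MonoidAlgebra.of k _ (FreeMonoid.ofList w)) 0 1) =
      if n = 0 then 0 else if w = List.replicate (n - 1) 0 ++ [1] then 1 else 0) ∧
    polyMat k (MonoidAlgebra.of k _ (FreeMonoid.ofList w)) 1 0 = 0 ∧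
    polyMat k (MonoidAlgebra.of k _ (FreeMonoid.ofList w)) 1 1 = if w = [] then 1 else 0 := by
  induction w with
  | nil =>
    rw [FreeMonoid.ofList_nil, map_one, map_one]
    refine ⟨fun n => ?_, fun n => ?_, ?_, ?_⟩
    · have : [] = List.replicate n (0 : Fin 2) ↔ n = 0 := by
        rw [eq_comm, List.replicate_eq_nil_iff]
      simp only [this, Matrix.one_apply_eq, PowerSeries.coeff_one]
    · simp
    · simp
    · simp
  | cons x w h =>
    obtain ⟨h00, h01, h10, h11⟩ := h
    have e : polyMat k (MonoidAlgebra.of k _ (FreeMonoid.ofList (x :: w))) =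
        letterMat k x * polyMat k (MonoidAlgebra.of k _ (FreeMonoid.ofList w)) := by
      rw [FreeMonoid.ofList_cons, map_mul, map_mul, polyMat, MonoidAlgebra.lift_of,
        FreeMonoid.lift_eval_of]
    rw [e, if_neg (List.cons_ne_nil _ _)]
    fin_cases x
    · simp only [Fin.zero_eta, Fin.isValue, letterMat, Matrix.cons_val_zero, Matrix.mul_apply,
        Fin.sum_univ_two, Matrix.of_apply, Matrix.cons_val_one, zero_mul, add_zero, and_self,
        and_true]
      refine ⟨fun n => ?_, fun n => ?_⟩
      · cases n with
        | zero => simp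
        | succ n =>
          rw [PowerSeries.coeff_succ_X_mul, h00]
          simp [List.replicate_succ]
      · cases n with
        | zero => simp
        | succ n =>
          rw [PowerSeries.coeff_succ_X_mul, h01]
          cases n with
          | zero => simp
          | succ n => simp [List.replicate_succ]
    · simp only [Fin.mk_one, Fin.isValue, letterMat, Matrix.cons_val_zero, Matrix.mul_apply,
        Fin.sum_univ_two, Matrix.of_apply, Matrix.cons_val_one, zero_mul, add_zero, zero_add,
        and_self, and_true, h10, h11, mul_zero, map_zero]
      refine ⟨fun n => ?_, fun n => ?_⟩
      · cases n with
        | zero => simp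
        | succ n => simp [List.replicate_succ]
      · cases n with
        | zero => by_cases hw : w = [] <;> simp [hw]
        | succ n =>
          rw [PowerSeries.coeff_succ_X_mul]
          cases n with
          | zero => by_cases hw : w = [] <;> simp [hw]
          | succ n => by_cases hw : w = [] <;> simp [hw, PowerSeries.coeff_one, List.replicate_succ]

/-- The matrix of a noncommutative power series. -/
def seriesMatLin (k : Type*) [CommRing k] :
    Cpl k (augNC k) →ₗ[k] Matrix (Fin 2) (Fin 2) k⟦X⟧ where
  toFun F := !![PowerSeries.mk fun n => coeffNC (FreeMonoid.ofList (List.replicate n 0)) F,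
    PowerSeries.mk fun n => if n = 0 then 0 else
      coeffNC (FreeMonoid.ofList (List.replicate (n - 1) 0 ++ [1])) F;
    0, PowerSeries.C (coeffNC 1 F)]
  map_add' F G := by
    ext i j n
    fin_cases i <;> fin_cases j <;> simp
    split_ifs <;> simp
  map_smul' r F := by
    ext i j n
    fin_cases i <;> fin_cases j <;> simp [PowerSeries.coeff_C]

theorem seriesMatLin_of (f : NC k) :
    seriesMatLin k (Cpl.of k (augNC k) f) = polyMat k f := by
  have h : (seriesMatLin k).comp (Cpl.of k (augNC k)).toLinearMap = (polyMat k).toLinearMap := by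
    refine MonoidAlgebra.lhom_ext' fun w => LinearMap.ext_ring ?_
    obtain ⟨w, rfl⟩ := FreeMonoid.ofList.surjective w
    obtain ⟨h00, h01, h10, h11⟩ := polyMat_word (k := k) w
    change seriesMatLin k (Cpl.of k (augNC k) (MonoidAlgebra.of k _ (FreeMonoid.ofList w))) =
      polyMat k (MonoidAlgebra.of k _ (FreeMonoid.ofList w))
    have hc : ∀ v : List (Fin 2), coeffNC (FreeMonoid.ofList v)
        (Cpl.of k (augNC k) (MonoidAlgebra.of k _ (FreeMonoid.ofList w))) =
          if w = v then 1 else 0 := fun v => by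
      classical
      rw [coeffNC_of, MonoidAlgebra.of_apply, MonoidAlgebra.coeff_single, Finsupp.single_apply]
      simp only [FreeMonoid.ofList.injective.eq_iff]
    have hc1 := hc []
    rw [FreeMonoid.ofList_nil] at hc1
    generalize MonoidAlgebra.of k _ (FreeMonoid.ofList w) = m at *
    ext i j n
    fin_cases i <;> fin_cases j
    · simp [seriesMatLin, hc, h00]
    · simp [seriesMatLin, hc, h01, -FreeMonoid.ofList_append]
    · simp [seriesMatLin, h10]
    · simp only [seriesMatLin, LinearMap.coe_mk, AddHom.coe_mk, hc1]
      by_cases hw : w = [] <;> simp [h11, hw]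
  exact LinearMap.congr_fun h f

/-- The matrices with entries divisible by `X ^ n`. -/
def matFil (k : Type*) [CommRing k] (n : ℕ) : Ideal (Matrix (Fin 2) (Fin 2) k⟦X⟧) where
  carrier := {M | ∀ i j, (PowerSeries.X : k⟦X⟧) ^ n ∣ M i j}
  add_mem' hM hN i j := dvd_add (hM i j) (hN i j)
  zero_mem' i j := dvd_zero _
  smul_mem' M N hN i j := by
    rw [smul_eq_mul, Matrix.mul_apply]
    exact Finset.dvd_sum fun l _ => Dvd.dvd.mul_left (hN l j) _

instance (n : ℕ) : (matFil k n).IsTwoSided where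
  mul_mem_of_left {M} N hM i j := by
    rw [Matrix.mul_apply]
    exact Finset.dvd_sum fun l _ => Dvd.dvd.mul_right (hM i l) _

theorem eq_zero_of_mem_matFil {M : Matrix (Fin 2) (Fin 2) k⟦X⟧} (h : ∀ n, M ∈ matFil k n) :
    M = 0 := by
  ext i j n
  exact PowerSeries.X_pow_dvd_iff.1 (h (n + 1) i j) n n.lt_succ_self

theorem coeffNC_eq_zero {n : ℕ} {F : Cpl k (augNC k)} (hF : F ∈ Cpl.fil k (augNC k) n)
    {w : FreeMonoid (Fin 2)} (hw : w.length < n) : coeffNC w F = 0 := by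
  have h : Cpl.proj k (augNC k) (w.length + 1) F = 0 := Cpl.fil_anti (Nat.succ_le_of_lt hw) hF
  rw [coeffNC, LinearMap.comp_apply, AlgHom.toLinearMap_apply, h, map_zero]

/-- The coefficient of `X ^ m` in each entry is zero or the coefficient of a word of length `m`, so
all of them vanish for `m < n`. -/
theorem seriesMatLin_mem {n : ℕ} {F : Cpl k (augNC k)} (hF : F ∈ Cpl.fil k (augNC k) n) :
    seriesMatLin k F ∈ matFil k n := by
  intro i j
  refine PowerSeries.X_pow_dvd_iff.2 fun m hm => ?_
  fin_cases i <;> fin_cases j <;> simp [seriesMatLin]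
  · exact coeffNC_eq_zero hF (by simpa [FreeMonoid.length] using hm)
  · intro h0
    refine coeffNC_eq_zero hF ?_
    simp [FreeMonoid.length]
    omega
  · rw [PowerSeries.coeff_C]
    split_ifs
    · exact coeffNC_eq_zero hF (by simp; omega)
    · rfl

/-- The representation of noncommutative power series which records the coefficients of the words
`e₀ ^ n` and `e₀ ^ n e₁`. -/
def seriesMat (k : Type*) [CommRing k] : Cpl k (augNC k) →ₐ[k] Matrix (Fin 2) (Fin 2) k⟦X⟧ :=
  AlgHom.ofLinearMap (seriesMatLin k)
    (by rw [← map_one (Cpl.of k (augNC k)), seriesMatLin_of, map_one])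
    -- Multiplicativity holds for polynomials through `polyMat`; it extends by density, both
    -- products changing only within the `n`-th filtration step when `F` and `G` are replaced by
    -- polynomials.
    (fun F G => sub_eq_zero.1 (eq_zero_of_mem_matFil fun n => by
      obtain ⟨f, hf⟩ := exists_sub_mem_fil F n
      obtain ⟨g, hg⟩ := exists_sub_mem_fil G n
      set F' := Cpl.of k (augNC k) f with hF'
      set G' := Cpl.of k (augNC k) g with hG'
      have e0 : seriesMatLin k (F' * G') = seriesMatLin k F' * seriesMatLin k G' := by
        rw [hF', hG', ← map_mul, seriesMatLin_of, seriesMatLin_of, seriesMatLin_of, map_mul]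
      have e1 : F * G = (F - F') * G + F' * (G - G') + F' * G' := by
        rw [sub_mul, mul_sub, sub_add_sub_cancel, sub_add_cancel]
      have e2 : seriesMatLin k F * seriesMatLin k G =
          seriesMatLin k (F - F') * seriesMatLin k G + seriesMatLin k F' * seriesMatLin k (G - G') +
            seriesMatLin k F' * seriesMatLin k G' := by
        rw [map_sub, map_sub, sub_mul, mul_sub, sub_add_sub_cancel, sub_add_cancel]
      rw [e1, e2, map_add, e0, add_sub_add_right_eq_sub]
      exact sub_mem (seriesMatLin_mem (add_mem (Ideal.mul_mem_right _ _ hf)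
        (Ideal.mul_mem_left _ _ hg))) (add_mem (Ideal.mul_mem_right _ _ (seriesMatLin_mem hf))
          (Ideal.mul_mem_left _ _ (seriesMatLin_mem hg)))))

theorem seriesMat_mem {n : ℕ} {F : Cpl k (augNC k)} (hF : F ∈ Cpl.fil k (augNC k) n) :
    seriesMat k F ∈ matFil k n := seriesMatLin_mem hF

theorem seriesMat_letter (i : Fin 2) :
    seriesMat k (Cpl.of k (augNC k) (letter k i)) = letterMat k i := by
  refine (seriesMatLin_of _).trans ?_
  rw [polyMat, letter, MonoidAlgebra.lift_of, FreeMonoid.lift_eval_of]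

end Triangular

/-! ### Coefficients of `(log X₀) ^ n` and `(log X₀) ^ n log X₁` -/

section Depth

variable {k : Type*} [CommRing k]

/-- The rescaling of matrices of power series. -/
def rescaleMat (μ : k) : Matrix (Fin 2) (Fin 2) k⟦X⟧ →ₐ[k] Matrix (Fin 2) (Fin 2) k⟦X⟧ :=
  (PowerSeries.rescaleAlgHom μ).mapMatrix

theorem rescaleMat_apply (μ : k) (M : Matrix (Fin 2) (Fin 2) k⟦X⟧) (i j : Fin 2) :
    rescaleMat μ M i j = PowerSeries.rescale μ (M i j) := by
  rw [← PowerSeries.coe_rescaleAlgHom]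
  rfl

theorem rescaleMat_mem {μ : k} {n : ℕ} {M : Matrix (Fin 2) (Fin 2) k⟦X⟧} (hM : M ∈ matFil k n) :
    rescaleMat μ M ∈ matFil k n := fun i j => by
  rw [rescaleMat_apply, PowerSeries.X_pow_dvd_iff]
  intro m hm
  rw [PowerSeries.coeff_rescale, PowerSeries.X_pow_dvd_iff.1 (hM i j) m hm, mul_zero]

/-- The matrices of the letters are homogeneous of degree one in `X`; hence raising `X i` to the
power `μ` amounts to rescaling matrices, as `wordMat_powC` states. -/
theorem rescaleMat_letterMat (μ : k) (i : Fin 2) :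
    rescaleMat μ (letterMat k i) = μ • letterMat k i := by
  ext a b n
  rw [rescaleMat_apply]
  fin_cases i <;> fin_cases a <;> fin_cases b <;>
    simp [letterMat, PowerSeries.coeff_X]

/-- The upper unitriangular matrices. -/
def unitri (f : k⟦X⟧) : Matrix (Fin 2) (Fin 2) k⟦X⟧ := !![1, f; 0, 1]

theorem unitri_mul (f g : k⟦X⟧) : unitri f * unitri g = unitri (g + f) := by
  simp [unitri]

theorem commute_unitri (f g : k⟦X⟧) : Commute (unitri f) (unitri g) := by
  rw [Commute, SemiconjBy, unitri_mul, unitri_mul, add_comm]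

theorem rescaleMat_unitri (μ : k) (f : k⟦X⟧) :
    rescaleMat μ (unitri f) = unitri (PowerSeries.rescale μ f) := by
  refine Matrix.ext fun a b => ?_
  rw [rescaleMat_apply]
  fin_cases a <;> fin_cases b <;> simp [unitri]

theorem IsGrouplike.comulV_sub_mem {g : Vhat k} (hg : IsGrouplike g) {n : ℕ} {a : V k}
    (ha : g - Cpl.of k (augI k) a ∈ Cpl.fil k (augI k) n) :
    comulV k a - g ⊗ₜ g ∈ tensorFil (filV k) n := by
  have h1 : comulLevel k n g - comulLevel k n (Cpl.of k (augI k) a) = 0 :=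
    (map_sub (comulLevel k n) _ _).symm.trans (comulLevel_eq_zero ha)
  have h2 := (isGrouplike_iff.1 hg).2 n
  rw [sub_eq_zero.1 h1, comulLevel_of, leftLevel_mul_rightLevel] at h2
  exact mem_tensorIdeal.1 (Ideal.Quotient.eq.1 h2)

variable [Algebra ℚ k]

theorem expand_Xhat (i : Fin 2) : expand k (Xhat k i) =
    (expC (Cpl.of k (augNC k) (letter k i)) (letter_mem_fil i) : Cpl k (augNC k)) :=
  substV_Xhat _ _ i

theorem expand_mem {n : ℕ} {x : Vhat k} (hx : x ∈ Cpl.fil k (augI k) n) :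
    expand k x ∈ Cpl.fil k (augNC k) n := by
  unfold expand substV
  exact Cpl.extend_mem_fil _ _ hx

theorem expand_powC (i : Fin 2) (μ : k) :
    expand k (powC (Xhat k i) (Xhat_sub_one_mem k i) μ) =
      (expC (μ • Cpl.of k (augNC k) (letter k i))
        (Submodule.smul_of_tower_mem _ μ (letter_mem_fil i)) : Cpl k (augNC k)) := by
  have h := expC_sub_one_mem (k := k) _ (letter_mem_fil (k := k) i)
  have e := logC_expC _ (letter_mem_fil (k := k) i) h
  rw [map_powC (expand k) (Xhat_sub_one_mem k i) h (expand_Xhat i)]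
  simp only [powC, e]

variable (k) in
/-- The representation of `V̂` which records the coefficients of the words `(log X₀) ^ n` and
`(log X₀) ^ n log X₁`. -/
def wordMat : Vhat k →ₐ[k] Matrix (Fin 2) (Fin 2) k⟦X⟧ := (seriesMat k).comp (expand k)

theorem wordMat_mem {n : ℕ} {x : Vhat k} (hx : x ∈ Cpl.fil k (augI k) n) :
    wordMat k x ∈ matFil k n := seriesMat_mem (expand_mem hx)

theorem coeff_wordMat_zero_zero (x : Vhat k) (n : ℕ) :
    PowerSeries.coeff n (wordMat k x 0 0) = coeffWord x (List.replicate n 0) :=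
  PowerSeries.coeff_mk n fun n => coeffNC (FreeMonoid.ofList (List.replicate n 0)) (expand k x)

theorem coeff_wordMat_zero_one (x : Vhat k) (n : ℕ) : PowerSeries.coeff n (wordMat k x 0 1) =
    if n = 0 then 0 else coeffWord x (List.replicate (n - 1) 0 ++ [1]) :=
  PowerSeries.coeff_mk n fun n => if n = 0 then 0 else
    coeffNC (FreeMonoid.ofList (List.replicate (n - 1) 0 ++ [1])) (expand k x)

theorem wordMat_one_zero (x : Vhat k) : wordMat k x 1 0 = 0 := rfl

theorem wordMat_one_one (x : Vhat k) : wordMat k x 1 1 = PowerSeries.C (coeffWord x []) := rfl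

theorem wordMat_powC (i : Fin 2) (μ : k) :
    wordMat k (powC (Xhat k i) (Xhat_sub_one_mem k i) μ) =
      rescaleMat μ (wordMat k (Xhat k i)) := by
  rw [wordMat, AlgHom.comp_apply, AlgHom.comp_apply, expand_powC, expand_Xhat]
  set e := Cpl.of k (augNC k) (letter k i) with he
  have he1 : μ • e ∈ Cpl.fil k (augNC k) 1 :=
    Submodule.smul_of_tower_mem _ μ (letter_mem_fil i)
  refine AlgHom.congr_fun (φ₁ := (seriesMat k).comp (psEval (μ • e) he1))
    (φ₂ := (rescaleMat μ).comp ((seriesMat k).comp (psEval e (letter_mem_fil i))))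
    (powerSeries_algHom_ext ?_ fun y hy => eq_zero_of_mem_matFil fun n => ?_) (PowerSeries.exp k)
  · rw [AlgHom.comp_apply, AlgHom.comp_apply, AlgHom.comp_apply, psEval_X, psEval_X, map_smul, he,
      seriesMat_letter, rescaleMat_letterMat]
  · obtain ⟨u, rfl⟩ := hy n
    rw [AlgHom.comp_apply, psEval_X, ← map_pow]
    exact Ideal.mul_mem_right _ _ (seriesMat_mem (Cpl.pow_mem_fil he1 n))

-- The matrix of `e₁` has square zero, so its exponential stops after the linear term.
theorem wordMat_Xhat_one : wordMat k (Xhat k 1) = 1 + letterMat k 1 := by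
  have h2 : letterMat k 1 ^ 2 = 0 := by
    rw [pow_two]
    refine Matrix.ext fun i j => ?_
    fin_cases i <;> fin_cases j <;> simp [letterMat]
  have h := map_psEval_eq_nilEval (seriesMat k) (letter_mem_fil (k := k) 1) (n := 2)
    (by rw [seriesMat_letter, h2]) (PowerSeries.exp k)
  rw [wordMat, AlgHom.comp_apply, expand_Xhat]
  refine h.trans ?_
  rw [nilEval_apply, seriesMat_letter, Finset.sum_range_succ, Finset.sum_range_one]
  simp

/-- On all of `V̂`, `wordMat ∘ aut1 p` is rescaling by `μ` followed by conjugation by the matrix of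
`g`. On `X₀` this is the definition of `aut1`; on `X₁` it holds because that matrix and the matrix
of `X₁ ^ μ` are both unitriangular and so commute. On a unitriangular image the conjugation again
disappears. -/
theorem wordMat_aut1 {p : kˣ × (Vhat k)ˣ} {f : k⟦X⟧} (hp : wordMat k (p.2 : Vhat k) = unitri f)
    {x : Vhat k} {g : k⟦X⟧} (hx : wordMat k x = unitri g) :
    wordMat k (aut1 p x) = unitri (PowerSeries.rescale (p.1 : k) g) := by
  set G : (Matrix (Fin 2) (Fin 2) k⟦X⟧)ˣ := Units.map (wordMat k : Vhat k →* _) p.2 with hG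
  have hG' : (G : Matrix (Fin 2) (Fin 2) k⟦X⟧) = unitri f := hp
  have hconj : ∀ h : k⟦X⟧, conjAlgHom k G (unitri h) = unitri h := fun h => by
    rw [conjAlgHom_apply, hG', (commute_unitri f h).eq, ← hG', Units.mul_inv_cancel_right]
  have key : (wordMat k).comp (aut1 p) =
      (conjAlgHom k G).comp ((rescaleMat (p.1 : k)).comp (wordMat k)) := by
    refine algHom_ext_of_Xhat (fun i => ?_) fun y hy => eq_zero_of_mem_matFil fun n => ?_
    · rw [AlgHom.comp_apply, AlgHom.comp_apply, AlgHom.comp_apply]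
      fin_cases i
      · change wordMat k (aut1 p (Xhat k 0)) =
          conjAlgHom k G (rescaleMat (p.1 : k) (wordMat k (Xhat k 0)))
        rw [aut1_Xhat_zero, map_mul, map_mul, wordMat_powC, conjAlgHom_apply]
        rfl
      · change wordMat k (aut1 p (Xhat k 1)) =
          conjAlgHom k G (rescaleMat (p.1 : k) (wordMat k (Xhat k 1)))
        have e : wordMat k (Xhat k 1) = unitri PowerSeries.X := by
          rw [wordMat_Xhat_one]
          refine Matrix.ext fun a b => ?_
          fin_cases a <;> fin_cases b <;> simp [unitri, letterMat]
        rw [aut1_Xhat_one, wordMat_powC, e, rescaleMat_unitri, hconj]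
    · obtain ⟨u, hu, rfl⟩ := hy n
      have h1 : wordMat k (aut1 p u) ∈ matFil k n := wordMat_mem (aut1_mem p hu)
      have h2 : conjAlgHom k G (rescaleMat (p.1 : k) (wordMat k u)) ∈ matFil k n := by
        rw [conjAlgHom_apply]
        exact Ideal.mul_mem_right _ _ (Ideal.mul_mem_left _ _ (rescaleMat_mem (wordMat_mem hu)))
      exact sub_mem h1 h2
  have := AlgHom.congr_fun key x
  rwa [AlgHom.comp_apply, AlgHom.comp_apply, AlgHom.comp_apply, hx, rescaleMat_unitri,
    hconj] at this

theorem wordMat_circ {p q : kˣ × (Vhat k)ˣ} {f g : k⟦X⟧}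
    (hp : wordMat k (p.2 : Vhat k) = unitri f) (hq : wordMat k (q.2 : Vhat k) = unitri g) :
    wordMat k ((circ p q).2 : Vhat k) = unitri (f + PowerSeries.rescale (p.1 : k) g) := by
  rw [← unitri_mul, ← wordMat_aut1 hp hq, ← hp, ← map_mul]
  rfl

variable (k) in
/-- The morphism which records the coefficients of the words `(log X₀) ^ n`. -/
def depthZero : Vhat k →ₐ[k] k⟦X⟧ :=
  AlgHom.ofLinearMap ((Matrix.entryLinearMap k k⟦X⟧ (0 : Fin 2) (0 : Fin 2)).comp
    (wordMat k).toLinearMap) (by simp) (fun x y => by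
      simp [Matrix.mul_apply, wordMat_one_zero])

theorem depthZero_apply (x : Vhat k) : depthZero k x = wordMat k x 0 0 := rfl

theorem coeff_depthZero_eq_zero {m n : ℕ} {x : Vhat k} (hx : x ∈ Cpl.fil k (augI k) n)
    (h : m < n) : PowerSeries.coeff m (depthZero k x) = 0 :=
  PowerSeries.X_pow_dvd_iff.1 (wordMat_mem hx 0 0) m h

theorem depthZero_Xhat_zero : depthZero k (Xhat k 0) = PowerSeries.exp k := by
  let γ : Cpl k (augNC k) →ₗ[k] k⟦X⟧ := (Matrix.entryLinearMap k k⟦X⟧ (0 : Fin 2) (0 : Fin 2)).comp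
    (seriesMat k).toLinearMap
  have hγ : ∀ F, γ F = seriesMat k F 0 0 := fun _ => rfl
  let α : Cpl k (augNC k) →ₐ[k] k⟦X⟧ := AlgHom.ofLinearMap γ (by simp [hγ]) (fun x y => by
    rw [hγ, map_mul, Matrix.mul_apply, Fin.sum_univ_two, show seriesMat k y 1 0 = 0 from rfl,
      mul_zero, add_zero]
    rfl)
  have hα : α (Cpl.of k (augNC k) (letter k 0)) = PowerSeries.X := by
    change seriesMat k (Cpl.of k (augNC k) (letter k 0)) 0 0 = _
    rw [seriesMat_letter]
    rfl
  -- Evaluating a series at `e₀` and then taking the upper left entry fixes `X`, so it is the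
  -- identity; apply it to the exponential series.
  have h := powerSeries_algHom_ext (φ := AlgHom.id k k⟦X⟧)
    (ψ := α.comp (psEval _ (letter_mem_fil (k := k) 0)))
    (by rw [AlgHom.comp_apply, psEval_X, hα]; rfl) fun y hy => by
      ext n
      obtain ⟨u, rfl⟩ := hy (n + 1)
      exact PowerSeries.X_pow_dvd_iff.1 (Dvd.intro u rfl) n n.lt_succ_self
  refine Eq.trans ?_ (AlgHom.congr_fun h (PowerSeries.exp k)).symm
  rw [depthZero_apply, wordMat, AlgHom.comp_apply, expand_Xhat]
  rfl

theorem depthZero_Xhat_one : depthZero k (Xhat k 1) = 1 := by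
  rw [depthZero_apply, wordMat_Xhat_one]
  simp [letterMat]

/-- Here `X₀ ↦ exp X` and `X₁ ↦ 1`, so a word in the group goes to `exp (c X)` with `c` its exponent
sum in `X₀`. -/
theorem exists_depthZero_of (g : FreeGroup (Fin 2)) : ∃ c : k,
    depthZero k (Cpl.of k (augI k) (MonoidAlgebra.of k _ g)) =
      PowerSeries.rescale c (PowerSeries.exp k) := by
  have gen : ∀ i : Fin 2, ∃ c : k,
      depthZero k (Cpl.of k (augI k) (MonoidAlgebra.of k _ (FreeGroup.of i))) =
        PowerSeries.rescale c (PowerSeries.exp k) := by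
    intro i
    have hi : Cpl.of k (augI k) (MonoidAlgebra.of k _ (FreeGroup.of i)) = Xhat k i := by
      rw [Xhat, X, Xp, zpow_one]
    rw [hi]
    fin_cases i
    · exact ⟨1, by rw [PowerSeries.rescale_one]; exact depthZero_Xhat_zero⟩
    · exact ⟨0, by rw [PowerSeries.rescale_zero]; simpa using depthZero_Xhat_one⟩
  induction g using FreeGroup.induction_on with
  | C1 => exact ⟨0, by rw [PowerSeries.rescale_zero, map_one, map_one, map_one]; simp⟩
  | of i => exact gen i
  | inv_of i _ =>
    obtain ⟨c, hc⟩ := gen i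
    refine ⟨-c, left_inv_eq_right_inv
      (a := depthZero k (Cpl.of k (augI k) (MonoidAlgebra.of k _ (FreeGroup.of i)))) ?_ ?_⟩
    · rw [← map_mul, ← map_mul, ← map_mul, inv_mul_cancel, map_one, map_one, map_one]
    · rw [hc, PowerSeries.exp_mul_exp_eq_exp_add, add_neg_cancel, PowerSeries.rescale_zero]
      simp
  | mul g h hg hh =>
    obtain ⟨c, hc⟩ := hg
    obtain ⟨d, hd⟩ := hh
    exact ⟨c + d, by
      rw [map_mul, map_mul, map_mul, hc, hd, PowerSeries.exp_mul_exp_eq_exp_add]⟩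

/-- The linear form `x ⊗ y ↦ (x | (log X₀) ^ n) (y | log X₀)`. -/
def pairForm (k : Type*) [CommRing k] [Algebra ℚ k] (n : ℕ) : Vhat k ⊗[k] Vhat k →ₗ[k] k :=
  (LinearMap.mul' k k).comp (TensorProduct.map
    ((PowerSeries.coeff n).comp (depthZero k).toLinearMap)
    ((PowerSeries.coeff 1).comp (depthZero k).toLinearMap))

theorem pairForm_tmul (n : ℕ) (x y : Vhat k) : pairForm k n (x ⊗ₜ y) =
    PowerSeries.coeff n (depthZero k x) * PowerSeries.coeff 1 (depthZero k y) := rfl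

/-- If `i + j ≥ n + 2`, then `i > n` or `j > 1`, and one of the two factors vanishes. -/
theorem pairForm_eq_zero {n : ℕ} {z : Vhat k ⊗[k] Vhat k} (hz : z ∈ tensorFil (filV k) (n + 2)) :
    pairForm k n z = 0 := by
  suffices h : tensorFil (filV k) (n + 2) ≤ LinearMap.ker (pairForm k n) from h hz
  refine tensorFil_le fun i j hij x hx y hy => ?_
  rw [LinearMap.mem_ker, pairForm_tmul]
  rcases Nat.lt_or_ge n i with hi | hi
  · rw [coeff_depthZero_eq_zero hx hi, zero_mul]
  · rw [coeff_depthZero_eq_zero hy (show 1 < j by omega), mul_zero]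

/-- By linearity it suffices to take a group element, whose image is `exp (c X)`; the identity is
then `cⁿ / n! · c = (n + 1) cⁿ⁺¹ / (n + 1)!`. -/
theorem pairForm_comulV (n : ℕ) (v : V k) : pairForm k n (comulV k v) =
    (n + 1) * PowerSeries.coeff (n + 1) (depthZero k (Cpl.of k (augI k) v)) := by
  induction v using MonoidAlgebra.induction_linear with
  | zero => simp
  | add x y hx hy => rw [map_add, map_add, map_add, map_add, map_add, hx, hy, mul_add]
  | single m r =>
    have h1 : MonoidAlgebra.single m r = r • MonoidAlgebra.of k (FreeGroup (Fin 2)) m := by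
      simp [MonoidAlgebra.of_apply]
    have h2 : comulV k (MonoidAlgebra.of k _ m) = Cpl.of k (augI k) (MonoidAlgebra.of k _ m) ⊗ₜ
        Cpl.of k (augI k) (MonoidAlgebra.of k _ m) := by
      simp [comulV, MonoidAlgebra.of_apply]
    obtain ⟨c, hc⟩ := exists_depthZero_of (k := k) m
    rw [h1, map_smul, map_smul, map_smul, map_smul, map_smul, h2, pairForm_tmul, hc,
      smul_eq_mul, smul_eq_mul, mul_left_comm ((n : k) + 1)]
    congr 1
    have h3 : ((n : k) + 1) * algebraMap ℚ k (1 / ((n + 1).factorial : ℚ)) =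
        algebraMap ℚ k (1 / (n.factorial : ℚ)) := by
      have : (n : k) + 1 = algebraMap ℚ k (n + 1) := by simp
      rw [this, ← map_mul]
      congr 1
      rw [Nat.factorial_succ]
      push_cast
      field_simp
    rw [PowerSeries.coeff_rescale, PowerSeries.coeff_rescale, PowerSeries.coeff_rescale,
      PowerSeries.coeff_exp, PowerSeries.coeff_exp, PowerSeries.coeff_exp, ← h3]
    simp
    ring

/-- Applying `pairForm` to `Δ g = g ⊗ g` gives the recursion satisfied by the coefficients of `exp
(c X)`. Since `pairForm` ignores `Fⁿ⁺²`, `g` may be replaced by an element of `V` congruent to it.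
-/
theorem IsGrouplike.coeff_depthZero {g : Vhat k} (hg : IsGrouplike g) (n : ℕ) :
    (n + 1) * PowerSeries.coeff (n + 1) (depthZero k g) =
      PowerSeries.coeff n (depthZero k g) * PowerSeries.coeff 1 (depthZero k g) := by
  obtain ⟨a, ha⟩ := exists_sub_mem_fil g (n + 2)
  have h3 := pairForm_eq_zero (hg.comulV_sub_mem ha)
  rw [map_sub, sub_eq_zero, pairForm_comulV, pairForm_tmul] at h3
  have h4 := coeff_depthZero_eq_zero ha (show n + 1 < n + 2 by omega)
  rw [map_sub, map_sub, sub_eq_zero] at h4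
  rw [h4, h3]

theorem IsGrouplike.depthZero_eq_one {g : Vhat k} (hg : IsGrouplike g)
    (h : coeffWord g [0] = 0) : depthZero k g = 1 := by
  have h0 : PowerSeries.coeff 1 (depthZero k g) = 0 :=
    (coeff_wordMat_zero_zero g 1).trans h
  ext n
  cases n with
  | zero =>
    have := coeff_depthZero_eq_zero hg.1 one_pos
    rw [map_sub, map_one, map_sub, sub_eq_zero] at this
    exact this
  | succ n =>
    have := hg.coeff_depthZero n
    rw [h0, mul_zero] at this
    -- The recursion reads `(n + 1) cₙ₊₁ = 0`, and `n + 1` is invertible in a `ℚ`-algebra.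
    have hu : IsUnit ((n : k) + 1) := by
      have e : (n : k) + 1 = algebraMap ℚ k (n + 1) := by simp
      rw [e]
      exact (IsUnit.mk0 _ (by positivity)).map _
    rw [hu.mul_right_eq_zero.1 this, PowerSeries.coeff_one, if_neg n.succ_ne_zero]

theorem IsGrouplike.wordMat_eq {g : Vhat k} (hg : IsGrouplike g) (h : coeffWord g [0] = 0) :
    wordMat k g = unitri (wordMat k g 0 1) := by
  refine Matrix.ext fun i j => ?_
  fin_cases i <;> fin_cases j
  · exact hg.depthZero_eq_one h
  · rfl
  · rfl
  · have h1 := wordMat_mem hg.1 1 1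
    have h2 : PowerSeries.coeff 0 (wordMat k (g - 1) 1 1) = 0 :=
      PowerSeries.X_pow_dvd_iff.1 h1 0 one_pos
    have h3 : coeffWord g [] = 1 := by
      rw [map_sub, map_one, Matrix.sub_apply, wordMat_one_one] at h2
      simpa [sub_eq_zero] using h2
    change wordMat k g 1 1 = 1
    rw [wordMat_one_one, h3, map_one]

end Depth

/-! ### Functoriality of the completed tensor square -/

section CompletedSquare

variable {k : Type*} [CommRing k] {M : Type*} [AddCommGroup M] [Module k M]
  {F : ℕ → Submodule k M}

theorem TSq.map_apply (f : M →ₗ[k] M) (hf : ∀ n, ∀ x ∈ F n, f x ∈ F n) (z : TSq F) (n : ℕ)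
    (a : M ⊗[k] M) (ha : z.1 n = (tensorFil F n).mkQ a) :
    (TSq.map (G := F) f hf z).1 n = (tensorFil F n).mkQ (TensorProduct.map f f a) := by
  change Submodule.mapQ (tensorFil F n) (tensorFil F n) (TensorProduct.map f f)
    (fun _ hz => map_mem_tensorFil hf hz) (z.1 n) = _
  rw [ha]
  rfl

theorem TSq.map_comp (f g : M →ₗ[k] M) (hf : ∀ n, ∀ x ∈ F n, f x ∈ F n)
    (hg : ∀ n, ∀ x ∈ F n, g x ∈ F n) (hfg : ∀ n, ∀ x ∈ F n, f.comp g x ∈ F n) :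
    TSq.map (G := F) (f.comp g) hfg = (TSq.map (G := F) f hf).comp (TSq.map g hg) := by
  refine LinearMap.ext fun z => Subtype.ext (funext fun n => ?_)
  obtain ⟨a, ha⟩ := Submodule.mkQ_surjective _ (z.1 n)
  refine (TSq.map_apply _ hfg z n a ha.symm).trans ?_
  rw [TensorProduct.map_comp]
  exact (TSq.map_apply f hf _ n _ (TSq.map_apply g hg z n a ha.symm)).symm

theorem TSq.map_id (h : ∀ n, ∀ x ∈ F n, LinearMap.id (R := k) x ∈ F n) :
    TSq.map (G := F) LinearMap.id h = LinearMap.id := by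
  refine LinearMap.ext fun z => Subtype.ext (funext fun n => ?_)
  obtain ⟨a, ha⟩ := Submodule.mkQ_surjective _ (z.1 n)
  refine (TSq.map_apply _ h z n a ha.symm).trans ?_
  rw [TensorProduct.map_id]
  exact ha

end CompletedSquare

/-! ### The cocycle `Γ` and the stabilizer condition -/

section Stabilizer

variable {k : Type*} [CommRing k] [Algebra ℚ k]

/-- The target is commutative, so the conjugation by `g` disappears and only `X ↦ μ X` remains; no
condition on `g` is needed. -/
theorem depthZero_aut1 (p : kˣ × (Vhat k)ˣ) (x : Vhat k) :
    depthZero k (aut1 p x) = PowerSeries.rescale (p.1 : k) (depthZero k x) := by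
  have key : (depthZero k).comp (aut1 p) =
      (PowerSeries.rescaleAlgHom (p.1 : k)).comp (depthZero k) := by
    have hpow : ∀ i, depthZero k (powC (Xhat k i) (Xhat_sub_one_mem k i) (p.1 : k)) =
        PowerSeries.rescaleAlgHom (p.1 : k) (depthZero k (Xhat k i)) := fun i => by
      rw [depthZero_apply, wordMat_powC]
      rfl
    refine algHom_ext_of_Xhat (fun i => ?_) fun y hy => ?_
    · rw [AlgHom.comp_apply, AlgHom.comp_apply, ← hpow]
      fin_cases i
      · refine (congrArg (depthZero k) (aut1_Xhat_zero p)).trans ?_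
        rw [map_mul, map_mul, mul_right_comm, ← map_mul, Units.mul_inv, map_one, one_mul]
        rfl
      · exact congrArg (depthZero k) (aut1_Xhat_one p)
    · ext n
      obtain ⟨u, hu, rfl⟩ := hy (n + 1)
      rw [AlgHom.comp_apply, AlgHom.comp_apply, map_sub,
        coeff_depthZero_eq_zero (aut1_mem p hu) n.lt_succ_self, zero_sub,
        ← AlgHom.coe_toRingHom, PowerSeries.coe_rescaleAlgHom, PowerSeries.coeff_rescale,
        coeff_depthZero_eq_zero hu n.lt_succ_self, mul_zero, neg_zero, map_zero]
  rw [← PowerSeries.coe_rescaleAlgHom]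
  exact AlgHom.congr_fun key x

theorem coeff_one_depthZero (x : Vhat k) :
    PowerSeries.coeff 1 (depthZero k x) = coeffWord x [0] :=
  coeff_wordMat_zero_zero x 1

theorem coeffWord_eq (x : Vhat k) (n : ℕ) : coeffWord x (List.replicate n 0 ++ [1]) =
    PowerSeries.coeff (n + 1) (wordMat k x 0 1) := by
  rw [coeff_wordMat_zero_one, if_neg n.succ_ne_zero, Nat.add_sub_cancel]

theorem coeffWord_one (n : ℕ) : coeffWord (1 : Vhat k) (List.replicate n 0 ++ [1]) = 0 := by
  rw [coeffWord_eq, map_one]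
  simp

theorem coeffWord_one_zero : coeffWord (1 : Vhat k) [0] = 0 := by
  rw [← coeff_one_depthZero, map_one, PowerSeries.coeff_one, if_neg one_ne_zero]

section

variable {p q : kˣ × (Vhat k)ˣ} (hp : IsGrouplike (p.2 : Vhat k))
  (hq : IsGrouplike (q.2 : Vhat k)) (hp0 : coeffWord (p.2 : Vhat k) [0] = 0)

-- Only the coefficient of `p` is assumed to vanish: this is what allows `(q | log X₀) = 0` to be
-- deduced when `q` is the inverse of `p`.
include hp hp0 in
theorem coeffWord_circ_zero : coeffWord ((circ p q).2 : Vhat k) [0] =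
    p.1 * coeffWord (q.2 : Vhat k) [0] := by
  rw [← coeff_one_depthZero, ← coeff_one_depthZero, circ_snd]
  change PowerSeries.coeff 1 (depthZero k (aut1 p q.2 * p.2)) = _
  rw [map_mul, hp.depthZero_eq_one hp0, mul_one, depthZero_aut1,
    PowerSeries.coeff_rescale, pow_one]

variable (hq0 : coeffWord (q.2 : Vhat k) [0] = 0)

include hp hq hp0 hq0 in
theorem coeffWord_circ (n : ℕ) :
    coeffWord ((circ p q).2 : Vhat k) (List.replicate n 0 ++ [1]) =
      coeffWord (p.2 : Vhat k) (List.replicate n 0 ++ [1]) +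
        p.1 ^ (n + 1) * coeffWord (q.2 : Vhat k) (List.replicate n 0 ++ [1]) := by
  rw [coeffWord_eq, coeffWord_eq, coeffWord_eq,
    wordMat_circ (hp.wordMat_eq hp0) (hq.wordMat_eq hq0)]
  change PowerSeries.coeff (n + 1) (wordMat k (p.2 : Vhat k) 0 1 +
    PowerSeries.rescale (p.1 : k) (wordMat k (q.2 : Vhat k) 0 1)) = _
  rw [map_add, PowerSeries.coeff_rescale]

include hp hq hp0 hq0 in
theorem logGamma_circ : logGamma ((circ p q).2 : Vhat k) =
    logGamma (p.2 : Vhat k) + PowerSeries.rescale (p.1 : k) (logGamma (q.2 : Vhat k)) := by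
  ext n
  rw [map_add, PowerSeries.coeff_rescale, logGamma, logGamma, logGamma, PowerSeries.coeff_mk,
    PowerSeries.coeff_mk, PowerSeries.coeff_mk]
  cases n with
  | zero => simp
  | succ n =>
    rw [if_neg n.succ_ne_zero, if_neg n.succ_ne_zero, if_neg n.succ_ne_zero, Nat.add_sub_cancel,
      coeffWord_circ hp hq hp0 hq0, smul_add, mul_smul_comm]

end

theorem constantCoeff_logGamma (g : Vhat k) : PowerSeries.constantCoeff (logGamma g) = 0 := by
  simp [logGamma]

theorem neg_log_mem : -logC (Xhat k 1) (Xhat_sub_one_mem k 1) ∈ Cpl.fil k (augI k) 1 :=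
  neg_mem (logC_mem _ _)

/-- The power series `f` evaluated at `- log X₁`. -/
def logCocycle (f : k⟦X⟧) : Vhat k :=
  psEval (-logC (Xhat k 1) (Xhat_sub_one_mem k 1)) neg_log_mem f

theorem logCocycle_mem {f : k⟦X⟧} (hf : PowerSeries.constantCoeff f = 0) :
    logCocycle f ∈ Cpl.fil k (augI k) 1 := psEval_mem_fil _ _ _ hf

/-- Writing the twisting factor as the inverse of an exponential turns additivity of `logGamma` into
multiplicativity. -/
theorem cocycle_eq (g : Vhat k) : cocycle g =
    (((expC (logCocycle (logGamma g)) (logCocycle_mem (constantCoeff_logGamma g)))⁻¹ :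
      (Vhat k)ˣ) : Vhat k) := by
  have h : Units.map (psEval (-logC (Xhat k 1) (Xhat_sub_one_mem k 1)) neg_log_mem : k⟦X⟧ →* Vhat k)
      (Gamma g) = expC (logCocycle (logGamma g)) (logCocycle_mem (constantCoeff_logGamma g)) := by
    refine Units.ext ?_
    change psEval _ neg_log_mem (Gamma g : k⟦X⟧) = _
    rw [Gamma_val, psEval_subst neg_log_mem (constantCoeff_logGamma g)]
    rfl
  rw [← h, ← map_inv]
  rfl

theorem aut1_log (p : kˣ × (Vhat k)ˣ) : aut1 p (-logC (Xhat k 1) (Xhat_sub_one_mem k 1)) =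
    (p.1 : k) • (-logC (Xhat k 1) (Xhat_sub_one_mem k 1)) := by
  have h1 : aut1 p (Xhat k 1) - 1 ∈ Cpl.fil k (augI k) 1 := by
    rw [← map_one (aut1 p), ← map_sub]
    exact aut1_mem p (Xhat_sub_one_mem k 1)
  rw [map_neg, map_logC (aut1 p) (Xhat_sub_one_mem k 1) h1, smul_neg]
  simp only [aut1_Xhat_one]
  congr 1
  exact logC_expC _ _ _

theorem aut1_logCocycle (p : kˣ × (Vhat k)ˣ) (f : k⟦X⟧) :
    aut1 p (logCocycle f) = logCocycle (PowerSeries.rescale (p.1 : k) f) := by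
  have h : (p.1 : k) • (-logC (Xhat k 1) (Xhat_sub_one_mem k 1)) ∈ Cpl.fil k (augI k) 1 :=
    Submodule.smul_of_tower_mem _ _ neg_log_mem
  rw [logCocycle, logCocycle, psEval_rescale neg_log_mem h,
    map_psEval (aut1 p) neg_log_mem (aut1_mem p neg_log_mem)]
  simp only [aut1_log]

/-- Since `aut1 p` multiplies `log X₁` by `μ`, it transforms a series in `-log X₁` by `t ↦ μ t`,
which is the rescaling in `h`. Series in `log X₁` commute, so the exponential of the sum is the
product of the exponentials. -/
theorem cocycle_circ {p q : kˣ × (Vhat k)ˣ} (h : logGamma ((circ p q).2 : Vhat k) =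
    logGamma (p.2 : Vhat k) + PowerSeries.rescale (p.1 : k) (logGamma (q.2 : Vhat k))) :
    cocycle ((circ p q).2 : Vhat k) = cocycle (p.2 : Vhat k) * aut1 p (cocycle (q.2 : Vhat k)) := by
  have hr : PowerSeries.constantCoeff
      (PowerSeries.rescale (p.1 : k) (logGamma (q.2 : Vhat k))) = 0 := by
    rw [← PowerSeries.coeff_zero_eq_constantCoeff_apply, PowerSeries.coeff_rescale,
      PowerSeries.coeff_zero_eq_constantCoeff_apply, constantCoeff_logGamma, mul_zero]
  have hc := constantCoeff_logGamma (p.2 : Vhat k)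
  have h1 : Units.map (aut1 p : Vhat k →* Vhat k) (expC (logCocycle (logGamma (q.2 : Vhat k)))
      (logCocycle_mem (constantCoeff_logGamma _))) =
      expC (logCocycle (PowerSeries.rescale (p.1 : k) (logGamma (q.2 : Vhat k))))
        (logCocycle_mem hr) := by
    refine Units.ext ((map_expC (aut1 p) _ (aut1_mem p (logCocycle_mem
      (constantCoeff_logGamma _)))).trans ?_)
    simp only [aut1_logCocycle]
  have hcomm : Commute (logCocycle (PowerSeries.rescale (p.1 : k) (logGamma (q.2 : Vhat k))))
      (logCocycle (logGamma (p.2 : Vhat k))) :=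
    (Commute.all _ _).map (psEval _ (neg_log_mem (k := k)))
  have h2 := expC_add (logCocycle_mem hr) (logCocycle_mem hc) hcomm
  have h3 : logCocycle (logGamma ((circ p q).2 : Vhat k)) =
      logCocycle (PowerSeries.rescale (p.1 : k) (logGamma (q.2 : Vhat k))) +
        logCocycle (logGamma (p.2 : Vhat k)) := by
    rw [h, add_comm]
    exact map_add _ _ _
  rw [cocycle_eq, cocycle_eq, cocycle_eq]
  simp only [h3]
  rw [h2, mul_inv_rev, Units.val_mul, ← h1, ← map_inv]
  rfl

theorem cocycle_one : cocycle (1 : Vhat k) = 1 := by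
  have h0 : logGamma (1 : Vhat k) = 0 := by
    ext n
    cases n with
    | zero => simp [logGamma]
    | succ n =>
      rw [logGamma, PowerSeries.coeff_mk, if_neg n.succ_ne_zero, Nat.add_sub_cancel,
        coeffWord_one, smul_zero, map_zero]
  have h1 : (Gamma (1 : Vhat k)) = 1 := by
    refine Units.ext ?_
    rw [Gamma_val, h0, PowerSeries.subst_zero_eq_C_constantCoeff]
    simp
  rw [cocycle, h1, inv_one, Units.val_one, map_one]

/-- Write `c` for the cocycle, `p = (μ, g)` and `q = (μ', g')`. Applying the map of `q`, then that
of `p`, to `v · 1` gives the class of `c(g) · aut1 p (c(g') · aut1 q (v) · g') · g`, which the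
cocycle relation and `aut1_circ` regroup into the map of `p ⊛ q`. -/
theorem gammaAutM_circ {p q : kˣ × (Vhat k)ˣ} (h : logGamma ((circ p q).2 : Vhat k) =
    logGamma (p.2 : Vhat k) + PowerSeries.rescale (p.1 : k) (logGamma (q.2 : Vhat k))) :
    gammaAutM (circ p q) = (gammaAutM p).comp (gammaAutM q) := by
  refine LinearMap.ext fun m => ?_
  obtain ⟨v, rfl⟩ := Submodule.mkQ_surjective _ m
  change gammaAutM (circ p q) (toMhat k v) = gammaAutM p (gammaAutM q (toMhat k v))
  rw [gammaAutM_toMhat, gammaAutM_toMhat, gammaAutM_toMhat, cocycle_circ h, aut1_circ,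
    AlgHom.comp_apply, map_mul (aut1 p), map_mul (aut1 p)]
  have e : ((circ p q).2 : Vhat k) = aut1 p (q.2 : Vhat k) * (p.2 : Vhat k) := rfl
  rw [e]
  simp only [mul_assoc]

theorem gammaAutM_one : gammaAutM (1 : kˣ × (Vhat k)ˣ) = LinearMap.id := by
  refine LinearMap.ext fun m => ?_
  obtain ⟨v, rfl⟩ := Submodule.mkQ_surjective _ m
  change gammaAutM 1 (toMhat k v) = toMhat k v
  rw [gammaAutM_toMhat, aut1_one]
  change toMhat k (cocycle (1 : Vhat k) * (v * 1)) = _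
  rw [cocycle_one, one_mul, mul_one]

/-- The compatibility with the coproduct of `M̂`. -/
def IsStab (p : kˣ × (Vhat k)ˣ) : Prop :=
  (TSq.map (gammaAutM p) (gammaAutM_mem p)).comp (deltaMhat k) = (deltaMhat k).comp (gammaAutM p)

theorem TSq.map_gammaAutM_circ {p q : kˣ × (Vhat k)ˣ}
    (h : gammaAutM (circ p q) = (gammaAutM p).comp (gammaAutM q)) :
    TSq.map (gammaAutM (circ p q)) (gammaAutM_mem (circ p q)) =
      (TSq.map (gammaAutM p) (gammaAutM_mem p)).comp
        (TSq.map (gammaAutM q) (gammaAutM_mem q)) := by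
  rw [← TSq.map_comp _ _ _ _ (by rw [← h]; exact gammaAutM_mem _)]
  simp only [h]

theorem TSq.map_gammaAutM_one :
    TSq.map (gammaAutM (1 : kˣ × (Vhat k)ˣ)) (gammaAutM_mem 1) = LinearMap.id := by
  rw [← TSq.map_id (F := filMhat k) (fun _ _ hx => hx)]
  simp only [gammaAutM_one]

theorem isStab_one : IsStab (1 : kˣ × (Vhat k)ˣ) := by
  rw [IsStab, TSq.map_gammaAutM_one, gammaAutM_one, LinearMap.id_comp, LinearMap.comp_id]

theorem IsStab.circ {p q : kˣ × (Vhat k)ˣ} (hp : IsStab p) (hq : IsStab q)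
    (h : gammaAutM (circ p q) = (gammaAutM p).comp (gammaAutM q)) : IsStab (circ p q) := by
  rw [IsStab] at *
  rw [TSq.map_gammaAutM_circ h, LinearMap.comp_assoc, hq, ← LinearMap.comp_assoc, hp,
    LinearMap.comp_assoc, h]

/-- The usual argument for inverses in a stabilizer: insert the map of `p` composed with that of
`q`, which is the identity, to the right of `Δ`, move the map of `p` across `Δ`, and cancel its
tensor square against that of `q`. The composition rules are hypotheses because they fail without a
condition on the coefficients. -/
theorem IsStab.of_circ_eq_one {p q : kˣ × (Vhat k)ˣ} (hp : IsStab p)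
    (hpq : BettiDMR.circ p q = 1) (hqp : BettiDMR.circ q p = 1)
    (h : gammaAutM (BettiDMR.circ p q) = (gammaAutM p).comp (gammaAutM q))
    (h' : gammaAutM (BettiDMR.circ q p) = (gammaAutM q).comp (gammaAutM p)) : IsStab q := by
  have e1 := TSq.map_gammaAutM_circ h'
  have e2 : (gammaAutM p).comp (gammaAutM q) = LinearMap.id := by rw [← h, hpq, gammaAutM_one]
  have e3 : (TSq.map (gammaAutM q) (gammaAutM_mem q)).comp
      (TSq.map (gammaAutM p) (gammaAutM_mem p)) = LinearMap.id := by
    rw [← e1]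
    simp only [hqp]
    exact TSq.map_gammaAutM_one
  rw [IsStab] at *
  calc (TSq.map (gammaAutM q) (gammaAutM_mem q)).comp (deltaMhat k)
      = (TSq.map (gammaAutM q) (gammaAutM_mem q)).comp
        ((deltaMhat k).comp ((gammaAutM p).comp (gammaAutM q))) := by
          rw [e2, LinearMap.comp_id]
    _ = (TSq.map (gammaAutM q) (gammaAutM_mem q)).comp
        ((TSq.map (gammaAutM p) (gammaAutM_mem p)).comp
          ((deltaMhat k).comp (gammaAutM q))) := by
          rw [← LinearMap.comp_assoc (gammaAutM q) (gammaAutM p), ← hp, LinearMap.comp_assoc]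
    _ = (deltaMhat k).comp (gammaAutM q) := by
          rw [← LinearMap.comp_assoc, e3, LinearMap.id_comp]

end Stabilizer

/-! ### The subgroup `DMR` -/

section Subgroup

variable (k : Type*) [CommRing k] [Algebra ℚ k]

theorem GBquad_logGamma {k : Type*} [CommRing k] [Algebra ℚ k] {x y : GB k} (hx : x ∈ GBquad k)
    (hy : y ∈ GBquad k) : logGamma ((circ x.1 y.1).2 : Vhat k) =
    logGamma (x.1.2 : Vhat k) + PowerSeries.rescale (x.1.1 : k) (logGamma (y.1.2 : Vhat k)) :=
  logGamma_circ x.2 y.2 hx.1 hy.1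

theorem exists_subgroup_DMRB : ∃ H : @Subgroup (GB k) groupGB,
    @SetLike.coe _ _ (@Subgroup.instSetLike (GB k) groupGB) H = DMRB k := by
  let _ := groupGB (k := k)
  have hmul : ∀ x y : GB k, (x * y).1 = circ x.1 y.1 := fun _ _ => rfl
  have hone : ((1 : GB k)).1 = 1 := rfl
  have hinv : ∀ x : GB k, circ x.1 (x⁻¹).1 = 1 := fun x => by rw [← hmul, mul_inv_cancel, hone]
  have hinv' : ∀ x : GB k, circ (x⁻¹).1 x.1 = 1 := fun x => by rw [← hmul, inv_mul_cancel, hone]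
  have quad_inv : ∀ x ∈ GBquad k, x⁻¹ ∈ GBquad k := by
    intro x hx
    obtain ⟨h0, h1, h2⟩ := hx
    have e0 : coeffWord ((x⁻¹).1.2 : Vhat k) [0] = 0 := by
      have := coeffWord_circ_zero (q := (x⁻¹).1) x.2 h0
      rw [hinv] at this
      exact (Units.mul_right_eq_zero _).1 (this.symm.trans coeffWord_one_zero)
    -- Additivity of the coefficients applied to `x ⊛ x⁻¹ = 1`; the cases `n = 0` and `n = 1`
    -- concern the words `log X₁` and `log X₀ log X₁`.
    have ew : ∀ n, coeffWord (x.1.2 : Vhat k) (List.replicate n 0 ++ [1]) +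
        (x.1.1 : k) ^ (n + 1) * coeffWord ((x⁻¹).1.2 : Vhat k) (List.replicate n 0 ++ [1]) = 0 := by
      intro n
      rw [← coeffWord_circ x.2 (x⁻¹).2 h0 e0, hinv]
      exact coeffWord_one n
    have e1 := ew 0
    have e2 := ew 1
    have eμ : (x.1.1 : k) * ((x⁻¹).1.1 : k) = 1 :=
      congrArg (fun p : kˣ × (Vhat k)ˣ => (p.1 : k)) (hinv x)
    simp only [List.replicate_zero, List.nil_append, List.replicate_one,
      List.singleton_append, zero_add, pow_one] at e1 e2
    refine ⟨e0, ?_, ?_⟩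
    · rw [h1, zero_add] at e1
      exact (Units.mul_right_eq_zero _).1 e1
    · generalize ((x⁻¹).1.1 : k) = ν at *
      generalize (x.1.1 : k) = μ at *
      generalize coeffWord ((x⁻¹).1.2 : Vhat k) [0, 1] = d at *
      generalize coeffWord (x.1.2 : Vhat k) [0, 1] = c at *
      -- From `μ² = 1 + 24 c` and `c + μ² d = 0`. Thus `1 + 24 d` is the inverse of `μ²`, which is
      -- also `ν²` since `μ ν = 1`.
      have : μ ^ 2 * (1 + 24 * d) = 1 := by linear_combination h2 + 24 * e2
      linear_combination (1 + 24 * d) * (μ * ν + 1) * eμ - ν ^ 2 * this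
  refine ⟨{ carrier := DMRB k, mul_mem' := ?_, one_mem' := ?_, inv_mem' := ?_ }, rfl⟩
  · rintro x y ⟨hx, hx'⟩ ⟨hy, hy'⟩
    have hc := coeffWord_circ x.2 y.2 hx.1 hy.1
    have c0 := hc 0
    have c1 := hc 1
    simp only [List.replicate_zero, List.nil_append, List.replicate_one,
      List.singleton_append, zero_add, pow_one] at c0 c1
    refine ⟨⟨?_, ?_, ?_⟩, IsStab.circ hx' hy' (gammaAutM_circ (GBquad_logGamma hx hy))⟩
    · rw [hmul, coeffWord_circ_zero x.2 hx.1, hy.1, mul_zero]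
    · rw [hmul, c0, hx.2.1, hy.2.1, mul_zero, add_zero]
    · have e : ((x * y).1.1 : k) = x.1.1 * y.1.1 := rfl
      rw [e, hmul, c1]
      -- With `c`, `c'` the coefficients of `log X₀ log X₁`: `μ² μ'² = μ² + 24 μ² c' = 1 + 24 (c +
      -- μ² c')`.
      linear_combination (x.1.1 : k) ^ 2 * hy.2.2 + hx.2.2
  · refine ⟨⟨coeffWord_one_zero, coeffWord_one 0, ?_⟩, isStab_one⟩
    have h := coeffWord_one (k := k) 1
    change ((1 : kˣ) : k) ^ 2 = 1 + 24 * coeffWord (1 : Vhat k) [0, 1]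
    rw [show coeffWord (1 : Vhat k) [0, 1] = 0 from h]
    simp
  · rintro x ⟨hx, hx'⟩
    exact ⟨quad_inv x hx, IsStab.of_circ_eq_one hx' (hinv x) (hinv' x)
      (gammaAutM_circ (GBquad_logGamma hx (quad_inv x hx)))
      (gammaAutM_circ (GBquad_logGamma (quad_inv x hx) hx))⟩

end Subgroup

end BettiDMR

end

theorem mainTheorem8 (k : Type*) [CommRing k] [Algebra ℚ k] :
    ∃ G : Group (BettiDMR.GB k),
      (∀ x y : BettiDMR.GB k, (x * y).1 = BettiDMR.circ x.1 y.1) ∧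
        ∃ H : Subgroup (BettiDMR.GB k), (H : Set (BettiDMR.GB k)) = BettiDMR.DMRB k :=
  ⟨BettiDMR.groupGB, fun _ _ => rfl, BettiDMR.exists_subgroup_DMRB k⟩
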